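/- Let $(M^n,g)$ be a complete smooth Riemannian manifold of dimension $n$, with Levi-Civita connection $D$, and let $p$ be a symmetric $(0,2)$-tensor field of class $C^1$ on $M$. For a function $u$ put $$H(u)=\Big(g^{ij}-\frac{u^iu^j}{1+|Du|^2}\Big)\frac{D_iD_ju}{\sqrt{1+|Du|^2}},\qquad \operatorname{tr}(p)(u)=\Big(g^{ij}-\frac{u^iu^j}{1+|Du|^2}\Big)p_{ij},$$ where indices are raised with $g$. Let $x_0\in M$, let $0<\rho<\operatorname{inj}_{x_0}(M,g)$, where $\operatorname{inj}_{x_0}(M,g)$ is the injectivity radius at $x_0$, let $t\ge 0$, and let $B=B(x_0,\rho)$ be the open geodesic ball. Suppose that $u\in C^3(B)\cap C(\bar B)$ solves the regularized Jang equation $$H(u)+\operatorname{tr}(p)(u)=t\,u\quad\text{on } B,$$ and that for some $T>0$ either $u(x)\le u(x_0)+T$ for all $x\in B$, or $u(x)\ge u(x_0)-T$ for all $x\in B$. Let $P_0,P_1,\Theta,\kappa\ge 0$ be such that on $B$ $$|p(v,w)|\le P_0|v||w|,\qquad |(D_zp)(v,w)|\le P_1|z||v||w|,\qquad t|u|\le\Theta,$$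 for all tangent vectors $z,v,w$, and all sectional curvatures of $g$ at points of $B$ are at most $\kappa$ in absolute value. Then $$|Du|(x_0)\le \exp\!\Big(100\,\big[(n+1)(1+T)(1+\tfrac1\rho)(1+P_0+P_1+\Theta+\kappa)\big]^2\Big).$$ In particular $|Du|(x_0)$ is bounded explicitly in terms of $n$, $T$, $\rho$ and bounds on $B$ for $|p|$, $|Dp|$, $t|u|$ and the sectional curvatures of $g$. -/

import Mathlib

open scoped Manifold ContDiff ENNReal

noncomputable section

namespace Jang

/-- The model space `ℝⁿ` of an `n`-dimensional manifold. -/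
abbrev Model (n : ℕ) : Type := EuclideanSpace ℝ (Fin n)

/-- The tangent space of `M` at `x`. By Mathlib's convention its elements are the coordinate
vectors of tangent vectors with respect to the preferred chart `chartAt _ x` at `x`. -/
abbrev Tan (n : ℕ) {M : Type*} [TopologicalSpace M] [ChartedSpace (Model n) M] (x : M) : Type :=
  TangentSpace (𝓡 n) x

/-- The Christoffel symbols `v, w ↦ Γᵏ_{ij}(y) vⁱ wʲ` of the Levi-Civita connection of a
Riemannian metric `G` on an open set of a vector space `E`. The vector `Γ(v, w)` is determined by
`G(Γ(v, w), z) = (∂_v G(w, z) + ∂_w G(v, z) - ∂_z G(v, w)) / 2` for all `z`. -/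
def christoffelOf {E : Type*} [NormedAddCommGroup E] [NormedSpace ℝ E]
    (G : E → E →L[ℝ] E →L[ℝ] ℝ) (y v w : E) : E :=
  let dG : E →L[ℝ] E →L[ℝ] E →L[ℝ] ℝ := fderiv ℝ G y
  (G y).inverse ((1 / 2 : ℝ) • (dG v w + dG w v - (dG.flip v).flip w))

end Jang

end

open Bundle

noncomputable section

namespace Jang

section Coordinates

variable {n : ℕ} {M : Type*} [TopologicalSpace M] [ChartedSpace (Model n) M]

/-- The differential at `y` of the inverse of the preferred chart at `x`:
it sends the `i`-th basis vector of `ℝⁿ` to the coordinate vector `∂ᵢ` at the point with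
coordinates `y`. -/
def coordFrame (x : M) (y : Model n) : Model n →L[ℝ] Tan n ((extChartAt (𝓡 n) x).symm y) :=
  mfderiv 𝓘(ℝ, Model n) (𝓡 n) (extChartAt (𝓡 n) x).symm y

/-- The expression in the preferred chart at `x` of a field `B` of bilinear forms on `M`:
the matrix field `y ↦ B_{ij}(y)` of its components, as a bilinear form on `ℝⁿ`. -/
def chartForm (B : ∀ q : M, Tan n q →L[ℝ] Tan n q →L[ℝ] ℝ) (x : M) (y : Model n) :
    Model n →L[ℝ] Model n →L[ℝ] ℝ :=
  (ContinuousLinearMap.precomp ℝ (coordFrame x y)) ∘L (B ((extChartAt (𝓡 n) x).symm y)) ∘L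
    (coordFrame x y)

variable [RiemannianBundle (fun x : M ↦ TangentSpace (𝓡 n) x)]

instance instFiniteDimensionalTan (x : M) : FiniteDimensional ℝ (Tan n x) :=
  inferInstanceAs (FiniteDimensional ℝ (Model n))

instance instCompleteSpaceTan (x : M) : CompleteSpace (Tan n x) :=
  FiniteDimensional.complete ℝ (Tan n x)

/-- The Riemannian metric `g`, as a field of bilinear forms. -/
def metricForm (q : M) : Tan n q →L[ℝ] Tan n q →L[ℝ] ℝ := innerSL (E := Tan n q) ℝ

/-- The components `g_{ij}(y)` of the metric in the preferred chart at `x`. -/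
def chartMetric (x : M) (y : Model n) : Model n →L[ℝ] Model n →L[ℝ] ℝ :=
  chartForm metricForm x y

/-- The Christoffel symbols of the Levi-Civita connection in the preferred chart at `x`. -/
def christoffel (x : M) (y v w : Model n) : Model n := christoffelOf (chartMetric x) y v w

/-- The covariant derivative `(∇_z B)(v, w) = z^k v^i w^j D_k B_{ij}` of a field of bilinear
forms, at the point `x`. -/
def covDerivForm (B : ∀ q : M, Tan n q →L[ℝ] Tan n q →L[ℝ] ℝ) (x : M) (z v w : Tan n x) : ℝ :=
  let y : Model n := extChartAt (𝓡 n) x x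
  fderiv ℝ (fun y' ↦ chartForm B x y' v w) y z
    - chartForm B x y (christoffel x y z v) w - chartForm B x y v (christoffel x y z w)

/-- The curvature tensor `R(v, w) z = ∇_v ∇_w z - ∇_w ∇_v z - ∇_{[v, w]} z` at `x`. -/
def curvature (x : M) (v w z : Tan n x) : Tan n x :=
  let y : Model n := extChartAt (𝓡 n) x x
  fderiv ℝ (fun y' ↦ christoffel x y' w z) y v - fderiv ℝ (fun y' ↦ christoffel x y' v z) y w
    + christoffel x y v (christoffel x y w z) - christoffel x y w (christoffel x y v z)

/-- The sectional curvature of the plane spanned by two independent tangent vectors. -/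
def sectionalCurvature (x : M) (v w : Tan n x) : ℝ :=
  inner ℝ (curvature x v w w) v / (‖v‖ ^ 2 * ‖w‖ ^ 2 - (inner ℝ v w : ℝ) ^ 2)

variable (n) in
/-- The gradient `Du` of `u` at `x`: the tangent vector with `g(Du, v) = du(v)`. -/
def grad (u : M → ℝ) (x : M) : Tan n x :=
  (InnerProductSpace.toDual ℝ (Tan n x)).symm (mfderiv (𝓡 n) 𝓘(ℝ, ℝ) u x)

variable (n) in
/-- The covariant Hessian `D_i D_j u vⁱ wʲ` at `x`. -/
def hessian (u : M → ℝ) (x : M) (v w : Tan n x) : ℝ :=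
  let y : Model n := extChartAt (𝓡 n) x x
  let f : Model n → ℝ := u ∘ (extChartAt (𝓡 n) x).symm
  fderiv ℝ (fderiv ℝ f) y v w - fderiv ℝ f y (christoffel x y v w)

/-- The trace `(g^{ij} - uⁱ uʲ / (1 + |Du|²)) B_{ij}` of a bilinear form `B` on `T_x M` over the
tangent space of the graph of `u`. -/
def graphTrace (u : M → ℝ) (x : M) (B : Tan n x → Tan n x → ℝ) : ℝ :=
  (∑ i, B (stdOrthonormalBasis ℝ (Tan n x) i) (stdOrthonormalBasis ℝ (Tan n x) i))
    - B (grad n u x) (grad n u x) / (1 + ‖grad n u x‖ ^ 2)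

variable (n) in
/-- The mean curvature `(g^{ij} - uⁱ uʲ / (1 + |Du|²)) D_i D_j u / √(1 + |Du|²)` of the graph
of `u` in `M × ℝ`. -/
def meanCurvature (u : M → ℝ) (x : M) : ℝ :=
  graphTrace (n := n) u x (hessian n u x) / √(1 + ‖grad n u x‖ ^ 2)

variable (n) in
/-- The regularized Jang equation `(H + tr p) u = t u` at the point `x`. -/
def JangEquationAt (p : ∀ q : M, Tan n q →L[ℝ] Tan n q →L[ℝ] ℝ) (t : ℝ) (u : M → ℝ) (x : M) :
    Prop :=
  meanCurvature n u x + graphTrace u x (fun v w ↦ p x v w) = t * u x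

/-- `γ` is a geodesic on the open set `s` of times: in the preferred chart at each of its points
it satisfies `c'' + Γ(c', c') = 0`. -/
def IsGeodesicOn (n : ℕ) {M : Type*} [TopologicalSpace M] [ChartedSpace (Model n) M]
    [RiemannianBundle (fun x : M ↦ TangentSpace (𝓡 n) x)] (γ : ℝ → M) (s : Set ℝ) : Prop :=
  ContMDiffOn 𝓘(ℝ, ℝ) (𝓡 n) ∞ γ s ∧
    ∀ τ ∈ s,
      let c : ℝ → Model n := fun σ ↦ extChartAt (𝓡 n) (γ τ) (γ σ)
      deriv (deriv c) τ + christoffel (γ τ) (c τ) (deriv c τ) (deriv c τ) = 0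

/-- `q = exp_x v`: some geodesic with initial point `x` and initial velocity `v` is defined
on a neighbourhood of `[0, 1]` and has the value `q` at time `1`. -/
def IsExp (n : ℕ) {M : Type*} [TopologicalSpace M] [ChartedSpace (Model n) M]
    [RiemannianBundle (fun x : M ↦ TangentSpace (𝓡 n) x)] (x : M) (v : Tan n x) (q : M) : Prop :=
  ∃ (γ : ℝ → M) (s : Set ℝ), IsOpen s ∧ s.OrdConnected ∧ Set.Icc 0 1 ⊆ s ∧
    IsGeodesicOn n γ s ∧
    γ 0 = x ∧ deriv (fun σ ↦ extChartAt (𝓡 n) x (γ σ)) 0 = v ∧ γ 1 = q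

variable (n) in
/-- The injectivity radius at `x`: the supremum of the `r` such that the exponential map at `x`
is defined on the ball of radius `r` in `T_x M` and is a diffeomorphism from it onto its image. -/
def injRadius (x : M) : ℝ≥0∞ :=
  sSup {r : ℝ≥0∞ | ∃ F : Tan n x → M,
    (∀ v ∈ Metric.eball (0 : Tan n x) r, IsExp n x v (F v)) ∧
    Set.InjOn F (Metric.eball (0 : Tan n x) r) ∧
    IsLocalDiffeomorphOn 𝓘(ℝ, Tan n x) (𝓡 n) ∞ F (Metric.eball (0 : Tan n x) r)}

end Coordinates

end Jang

end

/-! The proof is a maximum principle for a Korevaar-type test function, carried out in geodesic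
normal coordinates at `x₀`. Write `W = √(1 + |Du|²)` and suppose `u ≤ u(x₀) + T`; the other case
follows from the symmetry `(u, p) ↦ (-u, -p)`. Put `φ = 1 + (u - u(x₀)) / T - 8 d² / ρ²`, where `d`
is the distance to `x₀`. Then `φ(x₀) = 1`, `φ ≤ 2`, and `φ ≤ 0` where `d = ρ / 2`, so `W φ^N`, with
`φ` cut off at zero, attains its maximum over `d ≤ ρ / 2` at an interior point `q` where `φ > 0`.

At `q` let `X = Du`, `S = D²u`, and let `Z = Dφ`. The first derivative test gives `S X = -(N / φ) W²
Z`. The second derivative test is traced with `g^{ij} - uⁱuʲ / W²`. The second derivatives of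
`|Du|²` are rewritten by the Bochner identity (`IsMetricAt.bochner`) as `D_X S + S² + R(·, X) X`,
and the trace of `D_X S` comes from differentiating the equation along `X`
(`IsMetricAt.fderiv_jang`). The squared second fundamental form and `t |Du|²` have a good sign. The
critical equation turns what remains of `|S X|²` into a multiple `N² / φ²` of the trace of `Z ⊗ Z`,
which beats the multiple `-N / φ²` coming from `log φ`. If `|Du|` is not small, this trace is at
least `1 / (8 T²)`. Hence `N` is bounded by the data (`no_interior_max`,
`IsMetricAt.maximum_estimate`). For `N = 80 K`, with `K` the square in the exponent, that bound is
violated (`exponent_bound`), so `|Du|(q) ≤ 1 + 16 T / ρ`, and `W(x₀) ≤ W(q) φ(q)^N ≤ 16 K · 2^(80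
K)` (`IsNormalMetric.gradient_estimate`).

The Hessian of `d²` has to be bounded above using only a lower curvature bound. In normal
coordinates `d² = |y|²`, the rays satisfy `Γ_y(y, y) = 0`, and the Gauss lemma and a Riccati
comparison follow from this identity alone (`IsNormalMetric.gauss`, `IsNormalMetric.comparison`).

Since the geometric quantities are defined in the preferred chart of each point, all of them are
shown to be natural under local isometries (`IsIsometryAt`) and are pulled back by the exponential
map, whose pullback metric is normal (`isNormalMetric_of_isExp`). -/

noncomputable section

open Filter Topology

set_option maxSynthPendingDepth 3
set_option synthInstance.maxHeartbeats 200000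

namespace Jang

/-! ### The Levi-Civita connection of a metric on an open set of a vector space. -/

section Metric

variable {E : Type*} [NormedAddCommGroup E] [NormedSpace ℝ E]

/-- `G` is a Riemannian metric of class `C²` near `y`. -/
structure IsMetricAt (G : E → E →L[ℝ] E →L[ℝ] ℝ) (y : E) : Prop where
  contDiffAt : ContDiffAt ℝ 2 G y
  symm_nhds : ∀ᶠ z in 𝓝 y, ∀ v w, G z v w = G z w v
  pos_nhds : ∀ᶠ z in 𝓝 y, ∀ v, v ≠ 0 → 0 < G z v v

/-- The Christoffel symbols as a continuous bilinear map. -/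
def christoffelL (G : E → E →L[ℝ] E →L[ℝ] ℝ) (y : E) : E →L[ℝ] E →L[ℝ] E :=
  (ContinuousLinearMap.postcomp E (G y).inverse) ∘L
    ((1 / 2 : ℝ) • (fderiv ℝ G y + (fderiv ℝ G y).flip
      - ((ContinuousLinearMap.flipₗᵢ ℝ E E ℝ).toContinuousLinearEquiv :
          (E →L[ℝ] E →L[ℝ] ℝ) →L[ℝ] (E →L[ℝ] E →L[ℝ] ℝ)) ∘L (fderiv ℝ G y).flip))

theorem christoffelL_apply (G : E → E →L[ℝ] E →L[ℝ] ℝ) (y v w : E) :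
    christoffelL G y v w = christoffelOf G y v w := by
  simp [christoffelL, christoffelOf]

namespace IsMetricAt

variable {G : E → E →L[ℝ] E →L[ℝ] ℝ} {y : E}

theorem eventually (h : IsMetricAt G y) : ∀ᶠ z in 𝓝 y, IsMetricAt G z := by
  filter_upwards [h.contDiffAt.eventually (by simp), h.symm_nhds.eventually_nhds,
    h.pos_nhds.eventually_nhds] with z h1 h2 h3 using ⟨h1, h2, h3⟩

theorem symm (h : IsMetricAt G y) (v w : E) : G y v w = G y w v := h.symm_nhds.self_of_nhds v w

theorem pos (h : IsMetricAt G y) {v : E} (hv : v ≠ 0) : 0 < G y v v :=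
  h.pos_nhds.self_of_nhds v hv

theorem nonneg (h : IsMetricAt G y) (v : E) : 0 ≤ G y v v := by
  rcases eq_or_ne v 0 with rfl | hv
  · simp
  · exact (h.pos hv).le

theorem ext (h : IsMetricAt G y) {v w : E} (H : ∀ z, G y v z = G y w z) : v = w := by
  by_contra hne
  have := h.pos (sub_ne_zero.2 hne)
  rw [map_sub] at this
  simp [H] at this

theorem differentiableAt (h : IsMetricAt G y) : DifferentiableAt ℝ G y :=
  h.contDiffAt.differentiableAt (by simp)

theorem fderiv_symm (h : IsMetricAt G y) (z v w : E) :
    fderiv ℝ G y z v w = fderiv ℝ G y z w v := by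
  have h1 (a b : E) : fderiv ℝ (fun x ↦ G x a b) y z = fderiv ℝ G y z a b := by
    rw [fderiv_clm_apply (by exact h.differentiableAt.clm_apply (by fun_prop)) (by fun_prop)]
    rw [fderiv_clm_apply h.differentiableAt (by fun_prop)]
    simp
  rw [← h1, ← h1]
  congr 1
  apply Filter.EventuallyEq.fderiv_eq
  filter_upwards [h.symm_nhds] with x hx using hx v w

variable [FiniteDimensional ℝ E]

theorem isInvertible (h : IsMetricAt G y) : (G y).IsInvertible := by
  have hinj : Function.Injective (G y) := fun v w hvw ↦ h.ext fun z ↦ by rw [hvw]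
  have hrank : Module.finrank ℝ E = Module.finrank ℝ (E →L[ℝ] ℝ) := by
    rw [← (LinearMap.toContinuousLinearMap : (E →ₗ[ℝ] ℝ) ≃ₗ[ℝ] _).finrank_eq]
    exact (Subspace.dual_finrank_eq (K := ℝ) (V := E)).symm
  refine ⟨(LinearEquiv.ofInjectiveOfFinrankEq (G y : E →ₗ[ℝ] _) hinj hrank).toContinuousLinearEquiv, ?_⟩
  ext v w
  exact congrArg (fun f : E →L[ℝ] ℝ ↦ f w) (LinearMap.congr_fun
    (LinearEquiv.coe_ofInjectiveOfFinrankEq (G y : E →ₗ[ℝ] E →L[ℝ] ℝ) hinj hrank) v)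

theorem apply_inverse (h : IsMetricAt G y) (f : E →L[ℝ] ℝ) : G y ((G y).inverse f) = f := by
  obtain ⟨e, he⟩ := h.isInvertible
  rw [← he]
  simp

theorem contDiffAt_inverse (h : IsMetricAt G y) :
    ContDiffAt ℝ 2 (fun z ↦ (G z).inverse) y :=
  (h.isInvertible.contDiffAt_map_inverse).comp y h.contDiffAt

theorem contDiffAt_christoffelL (h : IsMetricAt G y) : ContDiffAt ℝ 1 (christoffelL G) y := by
  have h1 : ContDiffAt ℝ 1 (fderiv ℝ G) y := h.contDiffAt.fderiv_right (by norm_num)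
  have h2 : ContDiffAt ℝ 1 (fun z ↦ (fderiv ℝ G z).flip) y :=
    ((ContinuousLinearMap.flipₗᵢ ℝ E E (E →L[ℝ] ℝ)).contDiff.contDiffAt).comp y h1
  have h3 : ContDiffAt ℝ 1 (fun z ↦ (G z).inverse) y := h.contDiffAt_inverse.of_le (by norm_num)
  unfold christoffelL
  refine ContDiffAt.clm_comp ?_ ?_
  · exact ((ContinuousLinearMap.compL ℝ E (E →L[ℝ] ℝ) E).contDiff.contDiffAt).comp y h3
  · exact ((h1.add h2).sub (contDiffAt_const.clm_comp h2)).const_smul _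

theorem apply_christoffelL (h : IsMetricAt G y) (v w z : E) :
    G y (christoffelL G y v w) z =
      (fderiv ℝ G y v w z + fderiv ℝ G y w v z - fderiv ℝ G y z v w) / 2 := by
  rw [christoffelL_apply, christoffelOf, h.apply_inverse]
  simp
  ring

theorem christoffelL_symm (h : IsMetricAt G y) (v w : E) :
    christoffelL G y v w = christoffelL G y w v := by
  refine h.ext fun z ↦ ?_
  rw [h.apply_christoffelL, h.apply_christoffelL, h.fderiv_symm z v w]
  ring

/-- The Levi-Civita connection is compatible with the metric. -/
theorem fderiv_eq (h : IsMetricAt G y) (z v w : E) :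
    fderiv ℝ G y z v w = G y (christoffelL G y z v) w + G y v (christoffelL G y z w) := by
  rw [h.symm v, h.apply_christoffelL, h.apply_christoffelL, h.fderiv_symm w z v,
    h.fderiv_symm v z w, h.fderiv_symm z w v, h.fderiv_symm w v z]
  ring

/-- Metric compatibility absorbs the derivative of `G` into the covariant derivatives of the two
fields. Differentiations of scalar products below go through this product rule. -/
theorem hasFDerivAt_apply (h : IsMetricAt G y) {v w : E → E} {v' w' : E →L[ℝ] E}
    (hv : HasFDerivAt v v' y) (hw : HasFDerivAt w w' y) (z : E) :
    fderiv ℝ (fun x ↦ G x (v x) (w x)) y z =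
      G y (v' z + christoffelL G y z (v y)) (w y) + G y (v y) (w' z + christoffelL G y z (w y)) := by
  have := (h.differentiableAt.hasFDerivAt.clm_apply hv).clm_apply hw
  rw [this.fderiv]
  simp [h.fderiv_eq]
  ring

end IsMetricAt

end Metric

end Jang

end


noncomputable section

open Filter Topology

set_option maxSynthPendingDepth 3
set_option synthInstance.maxHeartbeats 200000

namespace Jang

/-! ### Naturality of connection, curvature, Hessian and covariant derivative under local
isometries. -/

section Naturality

variable {E E₁ E₂ : Type*} [NormedAddCommGroup E] [NormedSpace ℝ E]
  [NormedAddCommGroup E₁] [NormedSpace ℝ E₁] [NormedAddCommGroup E₂] [NormedSpace ℝ E₂]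

/-- The curvature tensor of a metric on an open subset of a vector space. -/
def curvatureOf (G : E → E →L[ℝ] E →L[ℝ] ℝ) (y v w z : E) : E :=
  fderiv ℝ (christoffelL G) y v w z - fderiv ℝ (christoffelL G) y w v z
    + christoffelL G y v (christoffelL G y w z) - christoffelL G y w (christoffelL G y v z)

/-- The covariant Hessian of a function on an open subset of a vector space. -/
def hessianOf (G : E → E →L[ℝ] E →L[ℝ] ℝ) (f : E → ℝ) (y v w : E) : ℝ :=
  fderiv ℝ (fderiv ℝ f) y v w - fderiv ℝ f y (christoffelL G y v w)

/-- The covariant derivative of a field of bilinear forms on an open subset of a vector space. -/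
def covDerivOf (G B : E → E →L[ℝ] E →L[ℝ] ℝ) (y z v w : E) : ℝ :=
  fderiv ℝ B y z v w - B y (christoffelL G y z v) w - B y v (christoffelL G y z w)

theorem fderiv_apply_const {F : Type*} [NormedAddCommGroup F] [NormedSpace ℝ F]
    {A : E → E₁ →L[ℝ] F} {y : E} (h : DifferentiableAt ℝ A y) (z : E) (v : E₁) :
    fderiv ℝ (fun x ↦ A x v) y z = fderiv ℝ A y z v := by
  rw [(h.hasFDerivAt.clm_apply (hasFDerivAt_const v y)).fderiv]
  simp

theorem fderiv_apply_const₂ {F : Type*} [NormedAddCommGroup F] [NormedSpace ℝ F]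
    {A : E → E₁ →L[ℝ] E₂ →L[ℝ] F} {y : E} (h : DifferentiableAt ℝ A y) (z : E) (v : E₁) (w : E₂) :
    fderiv ℝ (fun x ↦ A x v w) y z = fderiv ℝ A y z v w := by
  rw [((h.hasFDerivAt.clm_apply (hasFDerivAt_const v y)).clm_apply (hasFDerivAt_const w y)).fderiv]
  simp

theorem fderiv_pullback_apply {F : Type*} [NormedAddCommGroup F] [NormedSpace ℝ F]
    {B : E₂ → E₂ →L[ℝ] E₂ →L[ℝ] F} {θ : E₁ → E₂} {y : E₁}
    (hB : DifferentiableAt ℝ B (θ y)) (hθ : ContDiffAt ℝ 2 θ y) (a v w : E₁) :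
    fderiv ℝ (fun z ↦ B (θ z) (fderiv ℝ θ z v) (fderiv ℝ θ z w)) y a =
      fderiv ℝ B (θ y) (fderiv ℝ θ y a) (fderiv ℝ θ y v) (fderiv ℝ θ y w)
        + B (θ y) (fderiv ℝ (fderiv ℝ θ) y a v) (fderiv ℝ θ y w)
        + B (θ y) (fderiv ℝ θ y v) (fderiv ℝ (fderiv ℝ θ) y a w) := by
  have h1 : HasFDerivAt θ (fderiv ℝ θ y) y := (hθ.differentiableAt (by simp)).hasFDerivAt
  have h2 : HasFDerivAt (fderiv ℝ θ) (fderiv ℝ (fderiv ℝ θ) y) y :=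
    ((hθ.fderiv_right (m := 1) (by norm_num)).differentiableAt (by simp)).hasFDerivAt
  have h3 := ((hB.hasFDerivAt.comp y h1).clm_apply
    (h2.clm_apply (hasFDerivAt_const v y))).clm_apply (h2.clm_apply (hasFDerivAt_const w y))
  have h4 := h3.fderiv
  simp only [Function.comp_def] at h4
  rw [h4]
  simp
  abel

/-- The map `θ` is, near `y`, a local isometry from the metric `G₁` to the metric `G₂`. -/
structure IsIsometryAt (G₁ : E₁ → E₁ →L[ℝ] E₁ →L[ℝ] ℝ) (G₂ : E₂ → E₂ →L[ℝ] E₂ →L[ℝ] ℝ)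
    (θ : E₁ → E₂) (y : E₁) : Prop where
  left : IsMetricAt G₁ y
  right : IsMetricAt G₂ (θ y)
  contDiffAt : ContDiffAt ℝ 3 θ y
  pullback : ∀ᶠ z in 𝓝 y, ∀ v w, G₁ z v w = G₂ (θ z) (fderiv ℝ θ z v) (fderiv ℝ θ z w)
  surjective : ∀ᶠ z in 𝓝 y, Function.Surjective (fderiv ℝ θ z)

namespace IsIsometryAt

variable {G₁ : E₁ → E₁ →L[ℝ] E₁ →L[ℝ] ℝ} {G₂ : E₂ → E₂ →L[ℝ] E₂ →L[ℝ] ℝ} {θ : E₁ → E₂} {y : E₁}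

theorem eventually (h : IsIsometryAt G₁ G₂ θ y) : ∀ᶠ z in 𝓝 y, IsIsometryAt G₁ G₂ θ z := by
  filter_upwards [h.left.eventually, h.contDiffAt.continuousAt.eventually h.right.eventually,
    h.contDiffAt.eventually (by simp), h.pullback.eventually_nhds, h.surjective.eventually_nhds]
    with z h1 h2 h3 h4 h5 using ⟨h1, h2, h3, h4, h5⟩

theorem apply_eq (h : IsIsometryAt G₁ G₂ θ y) (v w : E₁) :
    G₁ y v w = G₂ (θ y) (fderiv ℝ θ y v) (fderiv ℝ θ y w) := h.pullback.self_of_nhds v w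

theorem snd_symm (h : IsIsometryAt G₁ G₂ θ y) (v w : E₁) :
    fderiv ℝ (fderiv ℝ θ) y v w = fderiv ℝ (fderiv ℝ θ) y w v :=
  (h.contDiffAt.isSymmSndFDerivAt (by simp; norm_num)) v w

theorem differentiableAt (h : IsIsometryAt G₁ G₂ θ y) : DifferentiableAt ℝ θ y :=
  h.contDiffAt.differentiableAt (by simp)

theorem contDiffAt_fderiv (h : IsIsometryAt G₁ G₂ θ y) : ContDiffAt ℝ 2 (fderiv ℝ θ) y :=
  h.contDiffAt.fderiv_right (by norm_num)

theorem differentiableAt_fderiv (h : IsIsometryAt G₁ G₂ θ y) :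
    DifferentiableAt ℝ (fderiv ℝ θ) y :=
  h.contDiffAt_fderiv.differentiableAt (by simp)

theorem fderiv_comp_eq (h : IsIsometryAt G₁ G₂ θ y) {f : E₂ → ℝ} (hf : DifferentiableAt ℝ f (θ y))
    (v : E₁) : fderiv ℝ (f ∘ θ) y v = fderiv ℝ f (θ y) (fderiv ℝ θ y v) := by
  rw [fderiv_comp y hf h.differentiableAt]
  rfl

variable [FiniteDimensional ℝ E₁] [FiniteDimensional ℝ E₂]

/-- The transformation law of the Christoffel symbols. -/
theorem fderiv_christoffelL (h : IsIsometryAt G₁ G₂ θ y) (v w : E₁) :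
    fderiv ℝ θ y (christoffelL G₁ y v w) =
      christoffelL G₂ (θ y) (fderiv ℝ θ y v) (fderiv ℝ θ y w)
        + fderiv ℝ (fderiv ℝ θ) y v w := by
  -- In the Koszul combination of three such derivatives the terms with the symmetric `D²θ` cancel,
  -- except for twice `G₂ (D²θ v w)`, the inhomogeneous term of the law.
  have key (a v w : E₁) : fderiv ℝ G₁ y a v w =
      fderiv ℝ G₂ (θ y) (fderiv ℝ θ y a) (fderiv ℝ θ y v) (fderiv ℝ θ y w)
        + G₂ (θ y) (fderiv ℝ (fderiv ℝ θ) y a v) (fderiv ℝ θ y w)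
        + G₂ (θ y) (fderiv ℝ θ y v) (fderiv ℝ (fderiv ℝ θ) y a w) := by
    rw [← fderiv_pullback_apply h.right.differentiableAt (h.contDiffAt.of_le (by norm_num)),
      ← fderiv_apply_const₂ h.left.differentiableAt]
    congr 1
    apply Filter.EventuallyEq.fderiv_eq
    filter_upwards [h.pullback] with z hz using hz v w
  refine h.right.ext fun z' ↦ ?_
  obtain ⟨z, rfl⟩ := h.surjective.self_of_nhds z'
  rw [← h.apply_eq, h.left.apply_christoffelL, map_add, add_apply,
    h.right.apply_christoffelL, key, key, key, h.snd_symm w v, h.snd_symm z v, h.snd_symm w z,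
    h.right.symm (fderiv ℝ θ y w), h.right.symm (fderiv ℝ θ y v)]
  ring

/-- Differentiating the transformation law of `Γ` produces second and third derivatives of `θ`. The
third derivatives are symmetric and disappear on antisymmetrizing; the second derivatives are
cancelled by the transformation of the quadratic terms in `Γ`. -/
theorem curvatureOf_eq (h : IsIsometryAt G₁ G₂ θ y) (v w z : E₁) :
    fderiv ℝ θ y (curvatureOf G₁ y v w z) =
      curvatureOf G₂ (θ y) (fderiv ℝ θ y v) (fderiv ℝ θ y w) (fderiv ℝ θ y z) := by
  have hΓ₁ : HasFDerivAt (christoffelL G₁) (fderiv ℝ (christoffelL G₁) y) y :=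
    (h.left.contDiffAt_christoffelL.differentiableAt (by simp)).hasFDerivAt
  have hΓ₂ := h.right.contDiffAt_christoffelL.differentiableAt (by simp)
  have h1 := h.differentiableAt_fderiv.hasFDerivAt
  have h2 : DifferentiableAt ℝ (fderiv ℝ (fderiv ℝ θ)) y :=
    (h.contDiffAt_fderiv.fderiv_right (m := 1) (by norm_num)).differentiableAt (by simp)
  have hsymm (a b : E₁) : fderiv ℝ (fderiv ℝ (fderiv ℝ θ)) y a b
      = fderiv ℝ (fderiv ℝ (fderiv ℝ θ)) y b a :=
    (h.contDiffAt_fderiv.isSymmSndFDerivAt (by simp)) a b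
  have key (v w : E₁) :
      fderiv ℝ (fderiv ℝ θ) y v (christoffelL G₁ y w z)
        + fderiv ℝ θ y (fderiv ℝ (christoffelL G₁) y v w z) =
      fderiv ℝ (christoffelL G₂) (θ y) (fderiv ℝ θ y v) (fderiv ℝ θ y w) (fderiv ℝ θ y z)
        + christoffelL G₂ (θ y) (fderiv ℝ (fderiv ℝ θ) y v w) (fderiv ℝ θ y z)
        + christoffelL G₂ (θ y) (fderiv ℝ θ y w) (fderiv ℝ (fderiv ℝ θ) y v z)
        + fderiv ℝ (fderiv ℝ (fderiv ℝ θ)) y v w z := by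
    have e1 := (h1.clm_apply ((hΓ₁.clm_apply (hasFDerivAt_const w y)).clm_apply
      (hasFDerivAt_const z y))).fderiv
    have e2 : fderiv ℝ (fun x ↦ fderiv ℝ θ x (christoffelL G₁ x w z)) y v =
        fderiv ℝ (fun x ↦ christoffelL G₂ (θ x) (fderiv ℝ θ x w) (fderiv ℝ θ x z)
          + fderiv ℝ (fderiv ℝ θ) x w z) y v := by
      congr 1
      apply Filter.EventuallyEq.fderiv_eq
      filter_upwards [h.eventually] with x hx using hx.fderiv_christoffelL w z
    rw [fderiv_fun_add, add_apply, fderiv_pullback_apply hΓ₂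
      (h.contDiffAt.of_le (by norm_num)), fderiv_apply_const₂ h2, e1] at e2
    · rw [← e2]
      simp
      abel
    · exact ((hΓ₂.comp y h.differentiableAt).clm_apply (h.differentiableAt_fderiv.clm_apply
        (by fun_prop))).clm_apply (h.differentiableAt_fderiv.clm_apply (by fun_prop))
    · exact (h2.clm_apply (by fun_prop)).clm_apply (by fun_prop)
  have k1 := key v w
  have k2 := key w v
  rw [hsymm w v, h.snd_symm w v] at k2
  have k3 := eq_sub_of_add_eq' k1
  have k4 := eq_sub_of_add_eq' k2
  simp only [curvatureOf, map_add, map_sub, k3, k4, h.fderiv_christoffelL]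
  abel

/-- The chain rule contributes `df (D²θ v w)`, which is exactly the inhomogeneous term in the
transformation law of the Christoffel symbols. -/
theorem hessianOf_comp (h : IsIsometryAt G₁ G₂ θ y) {f : E₂ → ℝ} (hf : ContDiffAt ℝ 2 f (θ y))
    (v w : E₁) :
    hessianOf G₁ (f ∘ θ) y v w = hessianOf G₂ f (θ y) (fderiv ℝ θ y v) (fderiv ℝ θ y w) := by
  have hf' : DifferentiableAt ℝ f (θ y) := hf.differentiableAt (by simp)
  have h2 : HasFDerivAt (fderiv ℝ f) (fderiv ℝ (fderiv ℝ f) (θ y)) (θ y) :=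
    ((hf.fderiv_right (m := 1) (by norm_num)).differentiableAt (by simp)).hasFDerivAt
  have e1 : fderiv ℝ (fderiv ℝ (f ∘ θ)) y v w =
      fderiv ℝ (fun x ↦ fderiv ℝ f (θ x) (fderiv ℝ θ x w)) y v := by
    rw [← fderiv_apply_const]
    · congr 1
      apply Filter.EventuallyEq.fderiv_eq
      filter_upwards [h.eventually,
        h.differentiableAt.continuousAt.eventually (hf.eventually (by simp))] with x hx hx'
      exact hx.fderiv_comp_eq (hx'.differentiableAt (by simp)) w
    · exact ((hf.comp y (h.contDiffAt.of_le (by norm_num))).fderiv_right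
        (m := 1) (by norm_num)).differentiableAt (by simp)
  have e2 := ((h2.comp y h.differentiableAt.hasFDerivAt).clm_apply
    (h.differentiableAt_fderiv.hasFDerivAt.clm_apply (hasFDerivAt_const w y))).fderiv
  simp only [Function.comp_def] at e2
  rw [hessianOf, hessianOf, e1, e2, h.fderiv_comp_eq hf', h.fderiv_christoffelL]
  simp
  ring

theorem covDerivOf_eq (h : IsIsometryAt G₁ G₂ θ y) {B₁ : E₁ → E₁ →L[ℝ] E₁ →L[ℝ] ℝ}
    {B₂ : E₂ → E₂ →L[ℝ] E₂ →L[ℝ] ℝ}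
    (hB₁ : DifferentiableAt ℝ B₁ y) (hB₂ : DifferentiableAt ℝ B₂ (θ y))
    (hB : ∀ᶠ z in 𝓝 y, ∀ v w, B₁ z v w = B₂ (θ z) (fderiv ℝ θ z v) (fderiv ℝ θ z w))
    (a v w : E₁) :
    covDerivOf G₁ B₁ y a v w =
      covDerivOf G₂ B₂ (θ y) (fderiv ℝ θ y a) (fderiv ℝ θ y v) (fderiv ℝ θ y w) := by
  have key : fderiv ℝ B₁ y a v w =
      fderiv ℝ (fun z ↦ B₂ (θ z) (fderiv ℝ θ z v) (fderiv ℝ θ z w)) y a := by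
    rw [← fderiv_apply_const₂ hB₁]
    congr 1
    apply Filter.EventuallyEq.fderiv_eq
    filter_upwards [hB] with z hz using hz v w
  rw [covDerivOf, covDerivOf, key, fderiv_pullback_apply hB₂ (h.contDiffAt.of_le (by norm_num)),
    hB.self_of_nhds, hB.self_of_nhds, h.fderiv_christoffelL, h.fderiv_christoffelL]
  simp
  ring

end IsIsometryAt

end Naturality

end Jang

end


noncomputable section

open Filter Topology

set_option maxSynthPendingDepth 3
set_option synthInstance.maxHeartbeats 200000

namespace Jang

/-! ### Normal coordinates: radial geodesics, the Gauss lemma and radial curvature. -/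

section RadialGauge

variable {E : Type*} [NormedAddCommGroup E] [InnerProductSpace ℝ E]

/-- `G` is a metric on the ball of radius `r` for which the identity is the exponential map at
the origin: `G` is the given inner product at `0` and the rays from `0` are geodesics. -/
structure IsNormalMetric (G : E → E →L[ℝ] E →L[ℝ] ℝ) (r : ℝ) : Prop where
  isMetricAt : ∀ y ∈ Metric.ball (0 : E) r, IsMetricAt G y
  zero : ∀ v w, G 0 v w = inner ℝ v w
  christoffelL_self : ∀ y ∈ Metric.ball (0 : E) r, christoffelL G y y y = 0

theorem smul_mem_ball_zero {y : E} {r τ : ℝ} (hy : y ∈ Metric.ball (0 : E) r)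
    (hτ : τ ∈ Set.Icc (0 : ℝ) 1) : τ • y ∈ Metric.ball (0 : E) r := by
  rw [mem_ball_zero_iff] at *
  rw [norm_smul, Real.norm_of_nonneg hτ.1]
  nlinarith [hτ.1, hτ.2, norm_nonneg y]

theorem hasDerivAt_comp_ray {F : Type*} [NormedAddCommGroup F] [NormedSpace ℝ F] {f : E → F}
    {y : E} {τ : ℝ} (hf : DifferentiableAt ℝ f (τ • y)) :
    HasDerivAt (fun σ : ℝ ↦ f (σ • y)) (fderiv ℝ f (τ • y) y) τ := by
  have h : HasDerivAt (fun σ : ℝ ↦ σ • y) y τ := by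
    simpa using (hasDerivAt_id τ).smul_const y
  exact hf.hasFDerivAt.comp_hasDerivAt τ h

namespace IsNormalMetric

variable [FiniteDimensional ℝ E] {G : E → E →L[ℝ] E →L[ℝ] ℝ} {r : ℝ} {y : E}

/-- For `τ > 0` this is `Γ_x(x, x) = 0` at `x = τ y` divided by `τ²`; the case `τ = 0` follows by
continuity. -/
theorem ray (h : IsNormalMetric G r) (hy : y ∈ Metric.ball (0 : E) r) {τ : ℝ}
    (hτ : τ ∈ Set.Icc (0 : ℝ) 1) : christoffelL G (τ • y) y y = 0 := by
  have hpos : ∀ σ ∈ Set.Ioc (0 : ℝ) 1, christoffelL G (σ • y) y y = 0 := by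
    intro σ hσ
    have := h.christoffelL_self _ (smul_mem_ball_zero hy ⟨hσ.1.le, hσ.2⟩)
    simpa [hσ.1.ne'] using this
  rcases hτ.1.eq_or_lt with rfl | h0
  · have hc : ContinuousAt (christoffelL G) ((0 : ℝ) • y) :=
      (h.isMetricAt _ (smul_mem_ball_zero hy hτ)).contDiffAt_christoffelL.continuousAt
    have hc' : ContinuousAt (fun σ : ℝ ↦ christoffelL G (σ • y) y y) 0 :=
      ((ContinuousAt.comp (g := christoffelL G) (f := fun σ : ℝ ↦ σ • y) hc
        (by fun_prop)).clm_apply continuousAt_const).clm_apply continuousAt_const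
    refine tendsto_nhds_unique (hc'.tendsto.mono_left (nhdsWithin_le_nhds (s := Set.Ioi 0))) ?_
    refine tendsto_const_nhds.congr' ?_
    filter_upwards [Ioc_mem_nhdsGT (zero_lt_one' ℝ)] with σ hσ using (hpos σ hσ).symm
  · exact hpos τ ⟨h0, hτ.2⟩

/-- A geodesic has constant speed, so the squared speed of a ray equals its value at the origin. -/
theorem apply_ray_self (h : IsNormalMetric G r) (hy : y ∈ Metric.ball (0 : E) r) {τ : ℝ}
    (hτ : τ ∈ Set.Icc (0 : ℝ) 1) : G (τ • y) y y = inner ℝ y y := by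
  have hd : ∀ σ ∈ Set.Icc (0 : ℝ) 1, HasDerivAt (fun σ : ℝ ↦ G (σ • y) y y) 0 σ := by
    intro σ hσ
    have hm := h.isMetricAt _ (smul_mem_ball_zero hy hσ)
    have h1 := hasDerivAt_comp_ray (f := fun z ↦ G z y y) (y := y) (τ := σ)
      ((hm.differentiableAt.clm_apply (by fun_prop)).clm_apply (by fun_prop))
    rwa [fderiv_apply_const₂ hm.differentiableAt, hm.fderiv_eq, h.ray hy hσ, map_zero, map_zero,
      zero_apply, add_zero] at h1
  have := constant_of_has_deriv_right_zero (a := 0) (b := 1)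
    (fun σ hσ ↦ (hd σ hσ).continuousAt.continuousWithinAt)
    (fun σ hσ ↦ (hd σ ⟨hσ.1, hσ.2.le⟩).hasDerivWithinAt) τ hτ
  rw [this, zero_smul, h.zero]

theorem apply_self_self (h : IsNormalMetric G r) (hy : y ∈ Metric.ball (0 : E) r) :
    G y y y = inner ℝ y y := by
  simpa using h.apply_ray_self hy (τ := 1) ⟨zero_le_one, le_rfl⟩

/-- The Gauss lemma. -/
theorem gauss (h : IsNormalMetric G r) (hy : y ∈ Metric.ball (0 : E) r) (w : E) :
    G y y w = inner ℝ y w := by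
  -- This is the derivative of `G_x(x, x) = ⟨x, x⟩` in the direction `w` at `x = τ y`, divided by `2
  -- τ`.
  have key : ∀ τ ∈ Set.Icc (0 : ℝ) 1,
      G (τ • y) w y + τ * G (τ • y) (christoffelL G (τ • y) w y) y = inner ℝ w y := by
    intro τ hτ
    rcases hτ.1.eq_or_lt with rfl | h0
    · simp [h.zero]
    have hb := smul_mem_ball_zero hy hτ
    have hm := h.isMetricAt _ hb
    have e1 := hm.hasFDerivAt_apply (hasFDerivAt_id _) (hasFDerivAt_id _) w
    have e2 : fderiv ℝ (fun x ↦ G x (id x) (id x)) (τ • y) w = 2 * inner ℝ (τ • y) w := by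
      have : (fun x ↦ G x (id x) (id x)) =ᶠ[𝓝 (τ • y)] fun x ↦ inner ℝ (id x) (id x) := by
        filter_upwards [Metric.isOpen_ball.mem_nhds hb] with z hz using h.apply_self_self hz
      rw [this.fderiv_eq, ((hasFDerivAt_id _).inner ℝ (hasFDerivAt_id _)).fderiv]
      simp [fderivInnerCLM_apply, real_inner_comm, two_mul]
    rw [e2] at e1
    simp only [id, ContinuousLinearMap.id_apply, map_add, map_smul, add_apply, smul_apply,
      inner_smul_left, smul_eq_mul, hm.symm y] at e1
    rw [real_inner_comm y w]
    refine mul_left_cancel₀ h0.ne' ?_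
    simp at e1
    linarith
  -- The factor `σ` makes the function vanish at the origin; since its derivative is zero it also
  -- vanishes at `σ = 1`, which is the claim.
  have hd : ∀ τ ∈ Set.Icc (0 : ℝ) 1,
      HasDerivAt (fun σ : ℝ ↦ σ * (G (σ • y) y w - inner ℝ y w)) 0 τ := by
    intro τ hτ
    have hm := h.isMetricAt _ (smul_mem_ball_zero hy hτ)
    have h1 := hasDerivAt_comp_ray (f := fun z ↦ G z y w) (y := y) (τ := τ)
      ((hm.differentiableAt.clm_apply (by fun_prop)).clm_apply (by fun_prop))
    rw [fderiv_apply_const₂ hm.differentiableAt, hm.fderiv_eq, h.ray hy hτ, map_zero, zero_apply,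
      zero_add, hm.christoffelL_symm, hm.symm] at h1
    refine ((hasDerivAt_id τ).mul (h1.sub_const (inner ℝ y w))).congr_deriv ?_
    have := key τ hτ
    rw [hm.symm w, real_inner_comm] at this
    simp only [id]
    linarith
  have := constant_of_has_deriv_right_zero (a := 0) (b := 1)
    (fun σ hσ ↦ (hd σ hσ).continuousAt.continuousWithinAt)
    (fun σ hσ ↦ (hd σ ⟨hσ.1, hσ.2.le⟩).hasDerivWithinAt) 1 ⟨zero_le_one, le_rfl⟩
  simp at this
  linarith

theorem gauss_fderiv (h : IsNormalMetric G r) (hy : y ∈ Metric.ball (0 : E) r) (v w : E) :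
    G y (v + christoffelL G y v y) w + G y y (christoffelL G y v w) = inner ℝ v w := by
  have e1 := (h.isMetricAt _ hy).hasFDerivAt_apply (hasFDerivAt_id _) (hasFDerivAt_const w y) v
  have : (fun x ↦ G x (id x) w) =ᶠ[𝓝 y] fun x ↦ inner ℝ (id x) w := by
    filter_upwards [Metric.isOpen_ball.mem_nhds hy] with z hz using h.gauss hz w
  rw [this.fderiv_eq, ((hasFDerivAt_id _).inner ℝ (hasFDerivAt_const w y)).fderiv] at e1
  simpa [fderivInnerCLM_apply] using e1.symm

/-- All other terms of the differentiated Gauss lemma `gauss_fderiv` are symmetric in `v` and `w`.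
This is the symmetry of the Hessian of `|y|²`. -/
theorem christoffelL_radial_symm (h : IsNormalMetric G r) (hy : y ∈ Metric.ball (0 : E) r)
    (v w : E) : G y (christoffelL G y v y) w = G y (christoffelL G y w y) v := by
  have h1 := h.gauss_fderiv hy v w
  have h2 := h.gauss_fderiv hy w v
  have hm := h.isMetricAt _ hy
  rw [hm.christoffelL_symm w v, real_inner_comm] at h2
  simp only [map_add, add_apply, hm.symm w v] at h1 h2
  linarith

/-- Along a ray the curvature is the derivative of the second fundamental form of the distance
spheres. -/
theorem curvatureOf_ray (h : IsNormalMetric G r) (hy : y ∈ Metric.ball (0 : E) r) {τ : ℝ}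
    (hτ : τ ∈ Set.Ioc (0 : ℝ) 1) (w : E) :
    τ ^ 2 • curvatureOf G (τ • y) w y y = -((2 * τ) • christoffelL G (τ • y) w y
      + τ ^ 2 • (fderiv ℝ (christoffelL G) (τ • y) y w y
        + christoffelL G (τ • y) y (christoffelL G (τ • y) w y))) := by
  have hτ' : τ ∈ Set.Icc (0 : ℝ) 1 := ⟨hτ.1.le, hτ.2⟩
  have hb := smul_mem_ball_zero hy hτ'
  have hm := h.isMetricAt _ hb
  have hΓ := hm.contDiffAt_christoffelL.differentiableAt (by simp)
  have e1 := ((hΓ.hasFDerivAt.clm_apply (hasFDerivAt_id _)).clm_apply (hasFDerivAt_id _)).fderiv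
  have : (fun x ↦ christoffelL G x (id x) (id x)) =ᶠ[𝓝 (τ • y)] fun _ ↦ 0 := by
    filter_upwards [Metric.isOpen_ball.mem_nhds hb] with z hz using h.christoffelL_self z hz
  rw [this.fderiv_eq] at e1
  -- Differentiating `Γ_x(x, x) = 0` in the direction `w` expresses the derivative `∂_w Γ` on `(x,
  -- x)` by `-2 Γ(w, x)`, so that only the derivative of `Γ` along the ray remains in the curvature.
  have e2 := congrArg (fun A : E →L[ℝ] E ↦ A w) e1
  simp [hm.christoffelL_symm y w] at e2
  rw [curvatureOf, h.ray hy hτ', map_zero]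
  have e3 : τ ^ 2 • fderiv ℝ (christoffelL G) (τ • y) w y y
      = -((2 * τ) • christoffelL G (τ • y) w y) := by
    rw [eq_neg_iff_add_eq_zero, e2]
    module
  rw [add_zero, smul_sub, smul_sub, e3]
  module

end IsNormalMetric

end RadialGauge

end Jang

end


noncomputable section

open Filter Topology

set_option maxSynthPendingDepth 3
set_option synthInstance.maxHeartbeats 200000

namespace Jang

/-! ### Hessian comparison for the squared distance. -/

section Comparison

theorem apply_eq_zero_of_nonneg {V : Type*} [AddCommGroup V] [Module ℝ V]
    {B : V →ₗ[ℝ] V →ₗ[ℝ] ℝ} (hs : ∀ v w, B v w = B w v) (hB : ∀ v, 0 ≤ B v v) {w : V}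
    (hw : B w w = 0) (v : V) : B w v = 0 := by
  by_contra hb
  -- The coefficient is chosen so that the form takes the value `-1` on this vector.
  have h := hB ((-(B v v + 1) / (2 * B w v)) • w + v)
  simp only [map_add, map_smul, LinearMap.add_apply, LinearMap.smul_apply, hw, hs v w,
    smul_eq_mul] at h
  have : -(B v v + 1) / (2 * B w v) * B w v = -(B v v + 1) / 2 := by field_simp
  rw [this] at h
  linarith

theorem nonpos_of_hasDerivAt_of_nonneg_left {f : ℝ → ℝ} {f' b : ℝ} (hf : HasDerivAt f f' b)
    {a : ℝ} (hab : a < b) (h0 : f b ≤ 0) (h : ∀ x ∈ Set.Ico a b, 0 ≤ f x) : f' ≤ 0 := by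
  have hf' : Tendsto (slope f b) (𝓝[<] b) (𝓝 f') :=
    (hasDerivAt_iff_tendsto_slope.1 hf).mono_left (nhdsWithin_mono _ fun x hx ↦ ne_of_lt hx)
  refine le_of_tendsto hf' ?_
  filter_upwards [Ico_mem_nhdsLT hab] with x hx
  rw [slope_def_field]
  exact div_nonpos_of_nonneg_of_nonpos (by linarith [h x hx]) (by linarith [hx.2])

variable {E : Type*} [NormedAddCommGroup E] [InnerProductSpace ℝ E] [FiniteDimensional ℝ E]
  {G : E → E →L[ℝ] E →L[ℝ] ℝ} {r : ℝ} {y : E}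

/-- The comparison form `D_τ(v, w)`, nonnegative for all `τ` by the comparison theorem. -/
def comparisonForm (G : E → E →L[ℝ] E →L[ℝ] ℝ) (y : E) (μ τ : ℝ) : E →L[ℝ] E →L[ℝ] ℝ :=
  μ • G (τ • y) - τ ^ 2 • (G (τ • y)).comp ((christoffelL G (τ • y)).flip y)

omit [FiniteDimensional ℝ E] in
theorem comparisonForm_apply (μ τ : ℝ) (v w : E) : comparisonForm G y μ τ v w =
    μ * G (τ • y) v w - τ ^ 2 * G (τ • y) (christoffelL G (τ • y) v y) w := by
  simp [comparisonForm]

namespace IsNormalMetric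

/-- The Riccati equation along the ray: the second fundamental form of the distance spheres has a
derivative consisting of its square and the radial curvature. The factor `τ²` in the comparison form
removes the singularity at the origin. -/
theorem hasDerivAt_comparisonForm (h : IsNormalMetric G r) (hy : y ∈ Metric.ball (0 : E) r) {τ : ℝ}
    (hτ : τ ∈ Set.Ioc (0 : ℝ) 1) {μ : ℝ → ℝ} {μ' : ℝ} (hμ : HasDerivAt μ μ' τ) (w : E) :
    HasDerivAt (fun σ ↦ comparisonForm G y (μ σ) σ w w)
      (μ' * G (τ • y) w w + 2 * μ τ * G (τ • y) (christoffelL G (τ • y) w y) w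
        - τ ^ 2 * G (τ • y) (christoffelL G (τ • y) w y) (christoffelL G (τ • y) w y)
        + τ ^ 2 * G (τ • y) (curvatureOf G (τ • y) w y y) w) τ := by
  have hτ' : τ ∈ Set.Icc (0 : ℝ) 1 := ⟨hτ.1.le, hτ.2⟩
  have hm := h.isMetricAt _ (smul_mem_ball_zero hy hτ')
  have hΓ := hm.contDiffAt_christoffelL.differentiableAt (by simp)
  have hA := (hΓ.hasFDerivAt.clm_apply (hasFDerivAt_const w _)).clm_apply (hasFDerivAt_const y _)
  have h1 := hasDerivAt_comp_ray (f := fun z ↦ G z w w) (y := y) (τ := τ)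
    ((hm.differentiableAt.clm_apply (by fun_prop)).clm_apply (by fun_prop))
  have h2 := hasDerivAt_comp_ray (f := fun z ↦ G z (christoffelL G z w y) w) (y := y) (τ := τ)
    ((hm.differentiableAt.clm_apply hA.differentiableAt).clm_apply (by fun_prop))
  rw [fderiv_apply_const₂ hm.differentiableAt, hm.fderiv_eq, hm.christoffelL_symm y w,
    hm.symm w] at h1
  rw [hm.hasFDerivAt_apply hA (hasFDerivAt_const w _)] at h2
  have h3 := (hμ.mul h1).sub (((hasDerivAt_id τ).pow 2).mul h2)
  have e := congrArg (fun v ↦ G (τ • y) v w) (h.curvatureOf_ray hy hτ w)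
  simp only [map_smul, smul_apply, smul_eq_mul, map_neg, neg_apply, map_add, add_apply] at e
  have h4 := h3.congr_of_eventuallyEq (f₁ := fun σ ↦ comparisonForm G y (μ σ) σ w w)
    (Eventually.of_forall fun σ ↦ by simp [comparisonForm_apply])
  refine h4.congr_deriv ?_
  rw [e, hm.christoffelL_symm y w]
  simp
  ring

/-- The Hessian comparison theorem under a lower curvature bound. -/
theorem comparison (h : IsNormalMetric G r) (hy : y ∈ Metric.ball (0 : E) r) {κ : ℝ} (hκ : 0 ≤ κ)
    (hR : ∀ z ∈ Metric.ball (0 : E) r, ∀ v w,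
      -(κ * G z v v * G z w w) ≤ G z (curvatureOf G z v w w) v) (w : E) :
    G y (christoffelL G y w y) w ≤ κ * ‖y‖ ^ 2 / 3 * G y w w := by
  have hm (τ : ℝ) (hτ : τ ∈ Set.Icc (0 : ℝ) 1) := h.isMetricAt _ (smul_mem_ball_zero hy hτ)
  -- The summand `ε` makes the form positive definite at time `0`. If positivity fails at a later
  -- time, the first such time and a null vector there are obtained from compactness of the unit
  -- sphere.
  have claim : ∀ ε > 0, ∀ w ∈ Metric.sphere (0 : E) 1,
      0 < comparisonForm G y (ε + κ * ‖y‖ ^ 2 * 1 ^ 3 / 3) 1 w w := by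
    intro ε hε
    set μ : ℝ → ℝ := fun τ ↦ ε + κ * ‖y‖ ^ 2 * τ ^ 3 / 3 with hμ
    have hμ' (τ : ℝ) : HasDerivAt μ (κ * ‖y‖ ^ 2 * τ ^ 2) τ := by
      refine (((((hasDerivAt_id τ).pow 3).const_mul (κ * ‖y‖ ^ 2)).div_const 3).const_add
        ε).congr_deriv ?_
      simp
      ring
    set D : ℝ × E → ℝ := fun q ↦ comparisonForm G y (μ q.1) q.1 q.2 q.2 with hD
    have hDc : ContinuousOn D (Set.Icc (0 : ℝ) 1 ×ˢ Metric.sphere (0 : E) 1) := by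
      intro q hq
      have hmq := hm q.1 hq.1
      have c0 : ContinuousAt (fun q : ℝ × E ↦ q.1 • y) q := by fun_prop
      have c1 : ContinuousAt (fun q : ℝ × E ↦ G (q.1 • y)) q :=
        ContinuousAt.comp (g := G) hmq.contDiffAt.continuousAt c0
      have c2 : ContinuousAt (fun q : ℝ × E ↦ christoffelL G (q.1 • y)) q :=
        ContinuousAt.comp (g := christoffelL G) hmq.contDiffAt_christoffelL.continuousAt c0
      have c3 : ContinuousAt (fun q : ℝ × E ↦ q.2) q := by fun_prop
      have c4 : ContinuousAt (fun q : ℝ × E ↦ μ q.1) q := by simp only [hμ]; fun_prop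
      have c5 : ContinuousAt (fun q : ℝ × E ↦ q.1 ^ 2) q := by fun_prop
      have : D = fun q ↦ μ q.1 * G (q.1 • y) q.2 q.2
          - q.1 ^ 2 * G (q.1 • y) (christoffelL G (q.1 • y) q.2 y) q.2 := by
        ext q
        simp [hD, comparisonForm_apply]
      rw [this]
      exact ((c4.mul ((c1.clm_apply c3).clm_apply c3)).sub (c5.mul ((c1.clm_apply
        ((c2.clm_apply c3).clm_apply continuousAt_const)).clm_apply c3))).continuousWithinAt
    set K : Set (ℝ × E) := (Set.Icc (0 : ℝ) 1 ×ˢ Metric.sphere (0 : E) 1) ∩ D ⁻¹' Set.Iic 0 with hK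
    have hKc : IsCompact K := by
      have hc : IsCompact (Set.Icc (0 : ℝ) 1 ×ˢ Metric.sphere (0 : E) 1) :=
        isCompact_Icc.prod (isCompact_sphere 0 1)
      exact hc.of_isClosed_subset (hDc.preimage_isClosed_of_isClosed hc.isClosed isClosed_Iic)
        Set.inter_subset_left
    by_contra! hcon
    obtain ⟨w₀, hw₀, hw₀'⟩ := hcon
    have hne : K.Nonempty := ⟨(1, w₀), ⟨⟨by simp, hw₀⟩, hw₀'⟩⟩
    obtain ⟨⟨τ, w⟩, ⟨⟨hτ, hw⟩, hDw⟩, hmin⟩ := hKc.exists_isMinOn hne continuousOn_fst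
    simp only at hτ hw
    have hw1 : ‖w‖ = 1 := by simpa using hw
    have hw0 : w ≠ 0 := by
      rintro rfl
      simp at hw1
    have hbefore : ∀ σ ∈ Set.Ico 0 τ, ∀ v ∈ Metric.sphere (0 : E) 1, 0 < D (σ, v) := by
      intro σ hσ v hv
      by_contra! hle
      have := hmin (show ((σ, v) : ℝ × E) ∈ K from ⟨⟨⟨hσ.1, hσ.2.le.trans hτ.2⟩, hv⟩, hle⟩)
      simp only [Set.mem_ofPred_eq] at this
      exact absurd hσ.2 (not_lt.2 this)
    have hτ0 : 0 < τ := by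
      refine hτ.1.lt_of_ne ?_
      rintro rfl
      have : 0 < ε * G 0 w w := by
        rw [h.zero, real_inner_self_eq_norm_sq, hw1]
        simpa using hε
      simp [hD, hμ, comparisonForm_apply] at hDw
      linarith
    have hat : ∀ v ∈ Metric.sphere (0 : E) 1, 0 ≤ D (τ, v) := by
      intro v hv
      have hcv : ContinuousWithinAt (fun σ ↦ D (σ, v)) (Set.Icc 0 1) τ :=
        (hDc (τ, v) ⟨hτ, hv⟩).comp (f := fun σ : ℝ ↦ ((σ, v) : ℝ × E)) (by fun_prop)
          fun σ hσ ↦ ⟨hσ, hv⟩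
      have hcv' : Tendsto (fun σ ↦ D (σ, v)) (𝓝[Set.Ico 0 τ] τ) (𝓝 (D (τ, v))) :=
        hcv.mono fun σ hσ ↦ ⟨hσ.1, hσ.2.le.trans hτ.2⟩
      have : (𝓝[Set.Ico 0 τ] τ).NeBot := by
        rw [nhdsWithin_Ico_eq_nhdsLT hτ0]
        infer_instance
      refine ge_of_tendsto hcv' ?_
      filter_upwards [self_mem_nhdsWithin] with σ hσ using (hbefore σ hσ v hv).le
    have hb := smul_mem_ball_zero hy hτ
    have hmτ := hm τ hτ
    have hτ' : τ ∈ Set.Ioc (0 : ℝ) 1 := ⟨hτ0, hτ.2⟩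
    have hsymm (v v' : E) : G (τ • y) (christoffelL G (τ • y) v y) v' =
        G (τ • y) (christoffelL G (τ • y) v' y) v := by
      have := h.christoffelL_radial_symm hb v v'
      simp only [map_smul, smul_apply, smul_eq_mul] at this
      exact mul_left_cancel₀ hτ0.ne' this
    set B : E →ₗ[ℝ] E →ₗ[ℝ] ℝ :=
      LinearMap.mk₂ ℝ (fun v v' ↦ comparisonForm G y (μ τ) τ v v') (by simp) (by simp) (by simp)
        (by simp) with hB
    have hBnonneg : ∀ v, 0 ≤ B v v := by
      intro v
      rcases eq_or_ne v 0 with rfl | hv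
      · simp
      have h1 := hat (‖v‖⁻¹ • v) (by simp [norm_smul, hv])
      simp only [hD, map_smul, smul_apply, smul_eq_mul] at h1
      have h2 : 0 < ‖v‖⁻¹ := by positivity
      rw [hB, LinearMap.mk₂_apply]
      by_contra! hlt
      have := mul_neg_of_pos_of_neg h2 (mul_neg_of_pos_of_neg h2 hlt)
      linarith
    have hBw : B w w = 0 := le_antisymm (by simpa [hB] using hDw) (hBnonneg w)
    have hBz := apply_eq_zero_of_nonneg (B := B) (by
      intro v v'
      simp [hB, comparisonForm_apply, hmτ.symm v v', hsymm v v']) hBnonneg hBw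
    -- At the first bad time the form is still semidefinite, so its null vector lies in the kernel
    -- and is an eigenvector. The quadratic Riccati term can therefore be evaluated on it.
    have heig : τ ^ 2 • christoffelL G (τ • y) w y = μ τ • w := by
      refine hmτ.ext fun z ↦ ?_
      have := hBz z
      simp [hB, comparisonForm_apply] at this
      simp
      linarith
    have hder := nonpos_of_hasDerivAt_of_nonneg_left
      (h.hasDerivAt_comparisonForm hy hτ' (hμ' τ) w) hτ0 hDw fun σ hσ ↦ (hbefore σ hσ w hw).le
    have heig' : christoffelL G (τ • y) w y = (μ τ / τ ^ 2) • w := by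
      rw [div_eq_inv_mul, mul_smul, ← heig, smul_smul, inv_mul_cancel₀ (by positivity), one_smul]
    have hRw := hR _ hb w y
    rw [h.apply_ray_self hy hτ, real_inner_self_eq_norm_sq] at hRw
    have hN := hmτ.pos hw0
    have hμpos : 0 < μ τ := by
      simp only [hμ]
      have := hτ.1
      positivity
    rw [heig'] at hder
    simp only [map_smul, smul_apply, smul_eq_mul] at hder
    -- On the eigenvector the terms in `μ` combine to `μ² / τ² > 0`. The derivative `κ |y|² τ²` of
    -- `μ` compensates the curvature, so the derivative of the form is positive, whereas at a first
    -- zero it cannot be.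
    have e1 : κ * ‖y‖ ^ 2 * τ ^ 2 * G (τ • y) w w + 2 * μ τ * (μ τ / τ ^ 2 * G (τ • y) w w)
        - τ ^ 2 * (μ τ / τ ^ 2 * (μ τ / τ ^ 2 * G (τ • y) w w))
        + τ ^ 2 * G (τ • y) (curvatureOf G (τ • y) w y y) w =
        μ τ ^ 2 / τ ^ 2 * G (τ • y) w w + τ ^ 2 * (κ * G (τ • y) w w * ‖y‖ ^ 2
          + G (τ • y) (curvatureOf G (τ • y) w y y) w) := by
      field_simp
      ring
    rw [e1] at hder
    have e2 : 0 < μ τ ^ 2 / τ ^ 2 * G (τ • y) w w := by positivity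
    have e3 : 0 ≤ τ ^ 2 * (κ * G (τ • y) w w * ‖y‖ ^ 2
          + G (τ • y) (curvatureOf G (τ • y) w y y) w) :=
      mul_nonneg (sq_nonneg _) (by linarith)
    linarith
  have claim2 : ∀ w ∈ Metric.sphere (0 : E) 1,
      G y (christoffelL G y w y) w ≤ κ * ‖y‖ ^ 2 / 3 * G y w w := by
    intro w hw
    have hw0 : w ≠ 0 := by
      rintro rfl
      simp at hw
    have hN := (h.isMetricAt y hy).pos hw0
    refine le_of_forall_pos_le_add fun ε hε ↦ ?_
    have := claim (ε / G y w w) (by positivity) w hw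
    simp only [comparisonForm_apply, one_smul] at this
    have e : ε / G y w w * G y w w = ε := by field_simp
    linarith
  rcases eq_or_ne w 0 with rfl | hw
  · simp
  have h1 := claim2 (‖w‖⁻¹ • w) (by simp [norm_smul, hw])
  simp only [map_smul, smul_apply, smul_eq_mul] at h1
  have h2 : 0 < ‖w‖⁻¹ * ‖w‖⁻¹ := by positivity
  refine le_of_mul_le_mul_left ?_ h2
  linarith

/-- The flat second derivative `2 ⟨w, w⟩` and the correction `-2 ⟨y, Γ(w, w)⟩` are both converted to
`G` by the Gauss lemma and its derivative. The result is the quantity bounded by `comparison`. -/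
theorem hessianOf_norm_sq (h : IsNormalMetric G r) (hy : y ∈ Metric.ball (0 : E) r) (w : E) :
    hessianOf G (fun z ↦ ‖z‖ ^ 2) y w w = 2 * (G y w w + G y (christoffelL G y w y) w) := by
  have e1 : fderiv ℝ (fun z : E ↦ ‖z‖ ^ 2) = ⇑(2 • innerSL ℝ : E →L[ℝ] E →L[ℝ] ℝ) := by
    ext z : 1
    exact (hasStrictFDerivAt_norm_sq z).hasFDerivAt.fderiv
  have e2 := h.gauss_fderiv hy w w
  rw [h.gauss hy, map_add, add_apply] at e2
  rw [hessianOf, e1, ContinuousLinearMap.fderiv]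
  simp
  rw [innerSL_apply_apply, innerSL_apply_apply]
  linarith

end IsNormalMetric

end Comparison

end Jang

end


noncomputable section

open Filter Topology

set_option maxSynthPendingDepth 3
set_option synthInstance.maxHeartbeats 200000

namespace Jang

/-! ### Linear algebra of the graph trace and the pointwise inequality at a maximum. -/

section Algebra

variable {V : Type*} [NormedAddCommGroup V] [InnerProductSpace ℝ V] [FiniteDimensional ℝ V]

/-- The trace `(g^{ij} - XⁱXʲ / (1 + |X|²)) B_{ij}` of a bilinear form. -/
def formTrace (X : V) : (V →ₗ[ℝ] V →ₗ[ℝ] ℝ) →ₗ[ℝ] ℝ where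
  toFun B := (∑ i, B (stdOrthonormalBasis ℝ V i) (stdOrthonormalBasis ℝ V i))
    - B X X / (1 + ‖X‖ ^ 2)
  map_add' B C := by
    simp [Finset.sum_add_distrib]
    ring
  map_smul' c B := by
    simp [← Finset.mul_sum]
    ring

theorem formTrace_apply (X : V) (B : V →ₗ[ℝ] V →ₗ[ℝ] ℝ) : formTrace X B =
    (∑ i, B (stdOrthonormalBasis ℝ V i) (stdOrthonormalBasis ℝ V i)) - B X X / (1 + ‖X‖ ^ 2) := rfl

/-- The bilinear form `⟨T v, w⟩`. -/
def opForm (T : V →ₗ[ℝ] V) : V →ₗ[ℝ] V →ₗ[ℝ] ℝ := (innerₗ V) ∘ₗ T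

/-- The bilinear form `⟨a, v⟩⟨a, w⟩`. -/
def sqForm (a : V) : V →ₗ[ℝ] V →ₗ[ℝ] ℝ := (innerₗ V a).smulRight (innerₗ V a)

omit [FiniteDimensional ℝ V] in
@[simp] theorem opForm_apply (T : V →ₗ[ℝ] V) (v w : V) : opForm T v w = inner ℝ (T v) w := rfl

omit [FiniteDimensional ℝ V] in
@[simp] theorem sqForm_apply (a v w : V) : sqForm a v w = inner ℝ a v * inner ℝ a w := rfl

theorem formTrace_opForm (X : V) (T : V →ₗ[ℝ] V) :
    formTrace X (opForm T) = LinearMap.trace ℝ V T - inner ℝ (T X) X / (1 + ‖X‖ ^ 2) := by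
  rw [formTrace_apply, LinearMap.trace_eq_sum_inner T (stdOrthonormalBasis ℝ V)]
  simp [real_inner_comm]

theorem formTrace_sqForm (X a : V) :
    formTrace X (sqForm a) = ‖a‖ ^ 2 - inner ℝ a X ^ 2 / (1 + ‖X‖ ^ 2) := by
  rw [formTrace_apply, ← OrthonormalBasis.sum_sq_inner_left (stdOrthonormalBasis ℝ V) a]
  simp [sq]

/-- The frame `eᵢ - β ⟨eᵢ, X⟩ X` which diagonalizes `formTrace X`. -/
def traceFrame (X : V) (i : Fin (Module.finrank ℝ V)) : V :=
  stdOrthonormalBasis ℝ V i - ((√(1 + ‖X‖ ^ 2) * (√(1 + ‖X‖ ^ 2) + 1))⁻¹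
    * inner ℝ (stdOrthonormalBasis ℝ V i) X) • X

theorem formTrace_eq_sum (X : V) (B : V →ₗ[ℝ] V →ₗ[ℝ] ℝ) :
    formTrace X B = ∑ i, B (traceFrame X i) (traceFrame X i) := by
  set W := √(1 + ‖X‖ ^ 2) with hW
  -- With this `β` the map `1 - β X ⊗ X` multiplies `X` by `1 / W` and fixes its orthogonal
  -- complement, so it is the positive square root of `1 - X ⊗ X / W²`.
  set β := (W * (W + 1))⁻¹ with hβ
  have hWpos : 0 < W := by positivity
  have hW2 : W ^ 2 = 1 + ‖X‖ ^ 2 := Real.sq_sqrt (by positivity)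
  set e := stdOrthonormalBasis ℝ V with he
  have hX : ∑ i, (inner ℝ (e i) X : ℝ) • e i = X := e.sum_repr' X
  have h1 : ∑ i, inner ℝ (e i) X * B (e i) X = B X X := by
    have := congrArg (fun x ↦ B x X) hX
    simpa only [map_sum, map_smul, LinearMap.sum_apply, LinearMap.smul_apply, smul_eq_mul] using this
  have h2 : ∑ i, inner ℝ (e i) X * B X (e i) = B X X := by
    have := congrArg (B X) hX
    simpa only [map_sum, map_smul, smul_eq_mul] using this
  have h3 : ∑ i, inner ℝ (e i) X * inner ℝ (e i) X = ‖X‖ ^ 2 := by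
    rw [← OrthonormalBasis.sum_sq_inner_right e X]
    simp [sq]
  have h4 (i) : B (traceFrame X i) (traceFrame X i) = B (e i) (e i)
      - β * (inner ℝ (e i) X * B (e i) X) - β * (inner ℝ (e i) X * B X (e i))
      + β ^ 2 * B X X * (inner ℝ (e i) X * inner ℝ (e i) X) := by
    simp only [traceFrame, map_sub, map_smul, LinearMap.sub_apply, LinearMap.smul_apply,
      smul_eq_mul]
    ring
  simp only [h4, Finset.sum_add_distrib, Finset.sum_sub_distrib, ← Finset.mul_sum, h1, h2, h3]
  have h5 : ‖X‖ ^ 2 = W ^ 2 - 1 := by linarith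
  rw [formTrace_apply, ← hW2, h5, hβ]
  field_simp
  ring

theorem formTrace_nonneg (X : V) {B : V →ₗ[ℝ] V →ₗ[ℝ] ℝ} (hB : ∀ v, 0 ≤ B v v) :
    0 ≤ formTrace X B := by
  rw [formTrace_eq_sum]
  exact Finset.sum_nonneg fun i _ ↦ hB _

theorem formTrace_mono (X : V) {B C : V →ₗ[ℝ] V →ₗ[ℝ] ℝ} (h : ∀ v, B v v ≤ C v v) :
    formTrace X B ≤ formTrace X C := by
  rw [formTrace_eq_sum, formTrace_eq_sum]
  exact Finset.sum_le_sum fun i _ ↦ h _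

theorem formTrace_le (X : V) {B : V →ₗ[ℝ] V →ₗ[ℝ] ℝ} {c : ℝ} (hc : 0 ≤ c)
    (h : ∀ v, B v v ≤ c * ‖v‖ ^ 2) : formTrace X B ≤ c * Module.finrank ℝ V := by
  have h1 : formTrace X B ≤ formTrace X (c • innerₗ V) :=
    formTrace_mono X fun v ↦ by simpa using h v
  refine h1.trans ?_
  rw [map_smul, smul_eq_mul]
  refine mul_le_mul_of_nonneg_left ?_ hc
  rw [formTrace_apply]
  have : 0 ≤ innerₗ V X X / (1 + ‖X‖ ^ 2) := by
    simp only [innerₗ_apply_apply, real_inner_self_eq_norm_sq]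
    positivity
  simpa using this

theorem abs_formTrace_le (X : V) {B : V →ₗ[ℝ] V →ₗ[ℝ] ℝ} {c : ℝ} (hc : 0 ≤ c)
    (h : ∀ v, |B v v| ≤ c * ‖v‖ ^ 2) : |formTrace X B| ≤ c * Module.finrank ℝ V := by
  refine abs_le.2 ⟨?_, formTrace_le X hc fun v ↦ (le_abs_self _).trans (h v)⟩
  have := formTrace_le X (B := -B) hc fun v ↦ (neg_le_abs _).trans (h v)
  rw [map_neg] at this
  linarith

/-- The squared norm of the second fundamental form of a graph is nonnegative. -/
theorem trace_sq_sub_nonneg (X : V) {S : V →ₗ[ℝ] V} (hS : S.IsSymmetric) :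
    0 ≤ LinearMap.trace ℝ V (S ∘ₗ S) - 2 * ‖S X‖ ^ 2 / (1 + ‖X‖ ^ 2)
      + inner ℝ (S X) X ^ 2 / (1 + ‖X‖ ^ 2) ^ 2 := by
  -- In the frame `fⱼ` this double trace is `∑ ⟨S fⱼ, fᵢ⟩²`, that is, `W²` times the squared norm of
  -- the second fundamental form.
  have h0 : 0 ≤ ∑ j, formTrace X (sqForm (S (traceFrame X j))) :=
    Finset.sum_nonneg fun j _ ↦ formTrace_nonneg X fun v ↦ mul_self_nonneg _
  have h1 (j) : formTrace X (sqForm (S (traceFrame X j))) =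
      opForm (S ∘ₗ S) (traceFrame X j) (traceFrame X j)
        - (1 + ‖X‖ ^ 2)⁻¹ * sqForm (S X) (traceFrame X j) (traceFrame X j) := by
    rw [formTrace_sqForm, opForm_apply, sqForm_apply, LinearMap.comp_apply, hS, hS,
      real_inner_self_eq_norm_sq, real_inner_comm]
    ring
  simp only [h1, Finset.sum_sub_distrib, ← Finset.mul_sum, ← formTrace_eq_sum, formTrace_opForm,
    formTrace_sqForm, LinearMap.comp_apply] at h0
  rw [hS, real_inner_self_eq_norm_sq] at h0
  convert h0 using 1
  have : (1 + ‖X‖ ^ 2) ≠ 0 := by positivity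
  field_simp
  ring

/-- The traced test after the critical equation has been inserted. The contributions of order `W Q /
T` cancel and leave `(Q / W) (1 / T + I)`. Once the squared second fundamental form is split off,
`γ` has the coefficient `3 ℓ² - 2 ℓ² - N / φ² = ℓ (N - 1) / φ`, which is positive for `N > 1`. -/
theorem maximum_identity {a b s Q W k T I ℓ γ h d N φ : ℝ} (hW : 0 < W) (hT : 0 < T) (hφ : 0 < φ)
    (hk : W ^ 2 = 1 + k) (hℓ : ℓ = N / φ) (hs : s = -(W ^ 2 * ℓ * (k / T - I))) :
    1 / W ^ 2 * (a - 2 * (W ^ 4 * ℓ ^ 2 * γ + s ^ 2 / W ^ 2) / W ^ 2 + s ^ 2 / W ^ 4) + b / W ^ 2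
        + ℓ * (Q / W * (1 / T + I)) + d / W - ℓ * h + ℓ * ((N - 1) / φ) * γ =
      1 / W ^ 2 * (a + b + (W ^ 4 * ℓ ^ 2 * γ + s ^ 2 / W ^ 2) / W ^ 2 - 2 * s ^ 2 / W ^ 4
        + s * Q / W + W * d) - 2 / W ^ 4 * (W ^ 4 * ℓ ^ 2 * γ) + ℓ * (1 / T * (W * Q) - h)
        - N / φ ^ 2 * γ := by
  have e1 : s * Q / W ^ 3 = -(ℓ * Q / W * ((W ^ 2 - 1) / T - I)) := by
    rw [hs, eq_sub_of_add_eq' hk.symm]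
    field_simp
  have e2 : N = ℓ * φ := by
    rw [hℓ]
    field_simp
  rw [e2]
  have e3 : 1 / W ^ 2 * (a + b + (W ^ 4 * ℓ ^ 2 * γ + s ^ 2 / W ^ 2) / W ^ 2 - 2 * s ^ 2 / W ^ 4
        + s * Q / W + W * d) = 1 / W ^ 2 * (a + b + (W ^ 4 * ℓ ^ 2 * γ + s ^ 2 / W ^ 2) / W ^ 2
        - 2 * s ^ 2 / W ^ 4 + W * d) + s * Q / W ^ 3 := by
    field_simp
    ring
  rw [e3, e1]
  clear e1 e3 hs
  field_simp
  ring

set_option maxHeartbeats 1000000 in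
/-- The pointwise inequality at a maximum of `½ log (1 + |Du|²) + N log φ`, with `X = Du`,
`S = D²u`, `A = D_X S`, `M = ½ D²|Du|²`, `Y = Dψ`, `H = D²ψ` and `φ = u / T - ψ + const`. -/
theorem no_interior_max {X Y : V} {S A R H : V →ₗ[ℝ] V} {p Dp : V →ₗ[ℝ] V →ₗ[ℝ] ℝ}
    {W Q q t T N φ P₀ P₁ κ y C : ℝ} (hS : S.IsSymmetric) (hW : 0 < W) (hW2 : W ^ 2 = 1 + ‖X‖ ^ 2)
    (ht : 0 ≤ t) (hT : 0 < T) (hφ : 0 < φ) (hφ2 : φ ≤ 2) (hN : 2 ≤ N)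
    (hP₀ : 0 ≤ P₀) (hP₁ : 0 ≤ P₁) (hκ : 0 ≤ κ) (hC : 0 ≤ C)
    (hp : ∀ v w, |p v w| ≤ P₀ * ‖v‖ * ‖w‖) (hDp : ∀ v w, |Dp v w| ≤ P₁ * ‖X‖ * ‖v‖ * ‖w‖)
    (hR : ∀ v, -(κ * ‖X‖ ^ 2 * ‖v‖ ^ 2) ≤ inner ℝ (R v) v)
    (hH : ∀ v, inner ℝ (H v) v ≤ C * ‖v‖ ^ 2) (hY : ‖Y‖ ≤ y)
    (hX1 : 1 ≤ ‖X‖) (hXY : 2 * T * y ≤ ‖X‖) (hQ : |Q| ≤ q)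
    (h1 : formTrace X (opForm S) = W * Q)
    (h2 : LinearMap.trace ℝ V A
        - (inner ℝ ((A + S ∘ₗ S + R) X) X + ‖S X‖ ^ 2) / W ^ 2 + 2 * inner ℝ (S X) X ^ 2 / W ^ 4 =
      inner ℝ (S X) X * Q / W + W * (t * ‖X‖ ^ 2 - formTrace X Dp + 2 * p (S X) X / W ^ 2
        - 2 * inner ℝ (S X) X * p X X / W ^ 4))
    (h3 : (1 / W ^ 2) • S X + (N / φ) • ((1 / T) • X - Y) = 0)
    (h4 : ∀ v, inner ℝ ((A + S ∘ₗ S + R) v) v / W ^ 2 - 2 * inner ℝ (S X) v ^ 2 / W ^ 4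
      + (N / φ) * (inner ℝ (S v) v / T - inner ℝ (H v) v)
      - N / φ ^ 2 * inner ℝ ((1 / T) • X - Y) v ^ 2 ≤ 0) :
    (N - 1) / (16 * T ^ 2) ≤
      Module.finrank ℝ V * (κ + P₁ + C) + (q + 2 * P₀) * (1 / T + y) := by
  set n : ℝ := ((Module.finrank ℝ V : ℕ) : ℝ) with hn
  have hn0 : 0 ≤ n := by positivity
  set ℓ := N / φ with hℓ
  -- This uses `φ ≤ 2 ≤ N`. It allows the terms without a factor `ℓ` to be bounded by `ℓ` times
  -- themselves, so that `ℓ` can be cancelled at the end.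
  have hℓ1 : 1 ≤ ℓ := by
    rw [hℓ, le_div_iff₀ hφ]
    linarith
  set Z := (1 / T) • X - Y with hZ
  set s : ℝ := inner ℝ (S X) X with hs
  set k := ‖X‖ ^ 2 with hk
  have hk0 : 0 ≤ k := by positivity
  have hk1 : 1 ≤ k := by rw [hk]; exact one_le_pow₀ hX1
  have hm : 0 < W ^ 2 := by positivity
  have hy : 0 ≤ y := (norm_nonneg Y).trans hY
  have hXW : ‖X‖ ≤ W := by
    refine abs_le_of_sq_le_sq' (by linarith) hW.le |>.2
  have hW1 : 1 ≤ W := hX1.trans hXW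
  have hSX : S X = -(W ^ 2 * ℓ) • Z := by
    have := eq_neg_of_add_eq_zero_left h3
    have h5 := congrArg (fun v ↦ (W ^ 2) • v) this
    simp only [smul_smul, smul_neg] at h5
    rw [mul_one_div_cancel hm.ne', one_smul] at h5
    rw [h5, neg_smul]
  set z : ℝ := inner ℝ Z X with hz
  have hsz : s = -(W ^ 2 * ℓ * z) := by
    rw [hs, hSX, inner_smul_left, hz]
    simp
  have hzY : z = k / T - inner ℝ Y X := by
    rw [hz, hZ, inner_sub_left, inner_smul_left, real_inner_self_eq_norm_sq]
    simp
    ring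
  have hYX : |inner ℝ Y X| ≤ y * ‖X‖ :=
    (abs_real_inner_le_norm Y X).trans (mul_le_mul_of_nonneg_right hY (norm_nonneg _))
  -- the traced second derivative test
  have ht4 : formTrace X ((1 / W ^ 2) • opForm (A + S ∘ₗ S + R) - (2 / W ^ 4) • sqForm (S X)
      + ℓ • ((1 / T) • opForm S - opForm H) - (N / φ ^ 2) • sqForm Z) ≤ 0 := by
    have := formTrace_nonneg X (B := -((1 / W ^ 2) • opForm (A + S ∘ₗ S + R)
      - (2 / W ^ 4) • sqForm (S X)
      + ℓ • ((1 / T) • opForm S - opForm H) - (N / φ ^ 2) • sqForm Z)) fun v ↦ by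
        have h5 := h4 v
        simp only [LinearMap.neg_apply, LinearMap.sub_apply, LinearMap.add_apply,
          LinearMap.smul_apply, opForm_apply, sqForm_apply, smul_eq_mul] at h5 ⊢
        rw [neg_nonneg]
        refine le_of_eq_of_le ?_ h5
        ring
    rw [map_neg] at this
    linarith
  set γ := formTrace X (sqForm Z) with hγ
  have hSXZ : formTrace X (sqForm (S X)) = W ^ 4 * ℓ ^ 2 * γ := by
    have : sqForm (S X) = (W ^ 4 * ℓ ^ 2) • sqForm Z := by
      ext v w
      rw [hSX]
      simp [inner_smul_left]
      ring
    rw [this, map_smul, smul_eq_mul]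
  have hSX2 : formTrace X (sqForm (S X)) = ‖S X‖ ^ 2 - s ^ 2 / W ^ 2 := by
    rw [formTrace_sqForm, ← hk, ← hW2]
  have hM : formTrace X (opForm (A + S ∘ₗ S + R)) =
      LinearMap.trace ℝ V (S ∘ₗ S) + LinearMap.trace ℝ V R + ‖S X‖ ^ 2 / W ^ 2
        - 2 * s ^ 2 / W ^ 4 + s * Q / W + W * (t * k - formTrace X Dp + 2 * p (S X) X / W ^ 2
        - 2 * s * p X X / W ^ 4) := by
    rw [formTrace_opForm, map_add, map_add, ← hk, ← hW2]
    rw [add_div] at h2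
    linarith
  have hII : 0 ≤ LinearMap.trace ℝ V (S ∘ₗ S) - 2 * ‖S X‖ ^ 2 / W ^ 2 + s ^ 2 / W ^ 4 := by
    have := trace_sq_sub_nonneg X hS
    rw [← hk, ← hW2] at this
    refine this.trans_eq ?_
    rw [← hs]
    ring
  have hRtr : -(n * (κ * k)) ≤ LinearMap.trace ℝ V R := by
    rw [LinearMap.trace_eq_sum_inner R (stdOrthonormalBasis ℝ V)]
    have : ∑ _i : Fin (Module.finrank ℝ V), (-(κ * k)) ≤
        ∑ i, inner ℝ (stdOrthonormalBasis ℝ V i) (R (stdOrthonormalBasis ℝ V i)) := by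
      refine Finset.sum_le_sum fun i _ ↦ ?_
      have := hR (stdOrthonormalBasis ℝ V i)
      rw [real_inner_comm]
      simpa using this
    simp only [Finset.sum_const, Finset.card_univ, Fintype.card_fin, nsmul_eq_mul] at this
    linarith
  have hDptr : |formTrace X Dp| ≤ P₁ * ‖X‖ * n := by
    refine abs_formTrace_le X (by positivity) fun v ↦ (hDp v v).trans_eq (by ring)
  have hHtr : formTrace X (opForm H) ≤ C * n := formTrace_le X hC hH
  -- The part of `Z` along `X` suffices: `⟨Z, X⟩ ≥ |X|² / (2T)` because `|Y|` is small relative to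
  -- `|X| / T`. Along `X` the graph trace only retains the factor `1 / W²`, so `γ ≥ |X|² / (4 T²
  -- W²)`, and `W² ≤ 2 |X|²`.
  have hγ0 : 1 / (8 * T ^ 2) ≤ γ := by
    have hzlow : k / (2 * T) ≤ z := by
      have h5 : y * ‖X‖ ≤ k / (2 * T) := by
        rw [le_div_iff₀ (by positivity), hk]
        have := mul_le_mul_of_nonneg_right hXY (norm_nonneg X)
        linarith only [this, sq ‖X‖]
      have h6 : k / T = k / (2 * T) + k / (2 * T) := by
        field_simp
        ring
      have := (abs_le.1 hYX).2
      rw [hzY]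
      linarith
    have hcs : z ^ 2 ≤ ‖Z‖ ^ 2 * k := by
      have h5 := abs_real_inner_le_norm Z X
      rw [hk, ← mul_pow]
      exact sq_le_sq' (by linarith [(abs_le.1 h5).1]) (abs_le.1 h5).2
    have hz2 : (k / (2 * T)) ^ 2 ≤ z ^ 2 := pow_le_pow_left₀ (by positivity) hzlow 2
    rw [hγ, formTrace_sqForm, ← hk, ← hW2]
    have h6 : z ^ 2 / k ≤ ‖Z‖ ^ 2 := by rwa [div_le_iff₀ (by linarith)]
    have h7 : z ^ 2 / k - z ^ 2 / W ^ 2 = z ^ 2 * (1 / (k * W ^ 2)) := by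
      rw [hW2]
      field_simp
      ring
    have h8 : (k / (2 * T)) ^ 2 * (1 / (k * W ^ 2)) ≤ z ^ 2 * (1 / (k * W ^ 2)) :=
      mul_le_mul_of_nonneg_right hz2 (by positivity)
    have h9 : 1 / (8 * T ^ 2) ≤ (k / (2 * T)) ^ 2 * (1 / (k * W ^ 2)) := by
      rw [hW2]
      have : (k / (2 * T)) ^ 2 * (1 / (k * (1 + k))) = k / (4 * T ^ 2 * (1 + k)) := by
        field_simp
        ring
      rw [this, div_le_div_iff₀ (by positivity) (by positivity)]
      have h10 : 0 ≤ T ^ 2 * (k - 1) := mul_nonneg (sq_nonneg T) (sub_nonneg.2 hk1)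
      clear * - h10
      linarith
    linarith
  -- the term with `p (S X) X`
  have hpterm : |(2 * p (S X) X / W ^ 2 - 2 * s * p X X / W ^ 4) / W| ≤
      ℓ * (2 * P₀ * (1 / T + y)) := by
    -- Inserting `S X = -W² ℓ Z` shows that the two terms carry the vector `Z - (⟨Z, X⟩ / W²) X`.
    -- Its component from `X / T` shrinks to `X / (T W²)`, so the vector stays bounded by `1 / T +
    -- y` however large `X` is.
    have e1 : 2 * p (S X) X / W ^ 2 - 2 * s * p X X / W ^ 4 =
        -(2 * ℓ * p ((1 / (T * W ^ 2)) • X - (Y - (inner ℝ Y X / W ^ 2) • X)) X) := by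
      rw [hsz, hSX, hzY, hZ]
      simp only [map_sub, map_smul, LinearMap.sub_apply, LinearMap.smul_apply, smul_eq_mul]
      have : k = W ^ 2 - 1 := by linarith
      rw [this]
      field_simp
      ring
    have e2 : ‖Y - (inner ℝ Y X / W ^ 2) • X‖ ≤ y := by
      refine le_trans ?_ hY
      refine abs_le_of_sq_le_sq' ?_ (norm_nonneg _) |>.2
      rw [norm_sub_sq_real, norm_smul, mul_pow, inner_smul_right, Real.norm_eq_abs, sq_abs, ← hk]
      have : (inner ℝ Y X / W ^ 2) ^ 2 * k ≤ inner ℝ Y X / W ^ 2 * inner ℝ Y X := by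
        have h5 : inner ℝ Y X / W ^ 2 * inner ℝ Y X - (inner ℝ Y X / W ^ 2) ^ 2 * k
            = (inner ℝ Y X / W ^ 2) ^ 2 * (W ^ 2 - k) := by
          field_simp
        have h6 : 0 ≤ (inner ℝ Y X / W ^ 2) ^ 2 * (W ^ 2 - k) :=
          mul_nonneg (sq_nonneg _) (by linarith)
        linarith
      have h7 : 0 ≤ (inner ℝ Y X / W ^ 2) ^ 2 * k := by positivity
      linarith
    have e3 : ‖(1 / (T * W ^ 2)) • X‖ ≤ 1 / T := by
      rw [norm_smul, Real.norm_of_nonneg (by positivity)]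
      rw [div_mul_eq_mul_div, one_mul, div_le_div_iff₀ (by positivity) hT]
      have h5 := mul_le_mul_of_nonneg_left hXW hT.le
      have h6 := mul_le_mul_of_nonneg_left hW1 (mul_nonneg hT.le hW.le)
      linarith only [h5, h6]
    have e4 := hp ((1 / (T * W ^ 2)) • X - (Y - (inner ℝ Y X / W ^ 2) • X)) X
    have e5 := norm_sub_le ((1 / (T * W ^ 2)) • X) (Y - (inner ℝ Y X / W ^ 2) • X)
    rw [e1, abs_div, abs_neg, abs_mul, abs_of_pos hW, abs_of_nonneg (by linarith : 0 ≤ 2 * ℓ),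
      div_le_iff₀ hW]
    have e6 : P₀ * ‖(1 / (T * W ^ 2)) • X - (Y - (inner ℝ Y X / W ^ 2) • X)‖ * ‖X‖ ≤
        P₀ * (1 / T + y) * W := by
      gcongr
      linarith
    calc _ ≤ 2 * ℓ * (P₀ * (1 / T + y) * W) := by gcongr; linarith
      _ = _ := by ring
  have hQterm : |Q / W * (1 / T + inner ℝ Y X)| ≤ q * (1 / T + y) := by
    have e1 : |1 / T + inner ℝ Y X| ≤ W * (1 / T + y) := by
      refine (abs_add_le _ _).trans ?_
      rw [abs_of_pos (by positivity : 0 < 1 / T)]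
      have : y * ‖X‖ ≤ W * y := by
        rw [mul_comm]
        exact mul_le_mul_of_nonneg_right hXW hy
      have : 1 / T ≤ W * (1 / T) := le_mul_of_one_le_left (by positivity) hW1
      linarith
    rw [abs_mul, abs_div, abs_of_pos hW, div_mul_eq_mul_div, div_le_iff₀ hW]
    calc |Q| * |1 / T + inner ℝ Y X| ≤ q * (W * (1 / T + y)) :=
          mul_le_mul hQ e1 (abs_nonneg _) ((abs_nonneg _).trans hQ)
      _ = _ := by ring
  -- conclusion
  rw [map_sub, map_add, map_sub, map_smul, map_smul, map_smul, map_smul, map_sub, map_smul, hM,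
    h1, ← hγ] at ht4
  simp only [smul_eq_mul] at ht4
  have key : (1 / W ^ 2) * (LinearMap.trace ℝ V (S ∘ₗ S) - 2 * ‖S X‖ ^ 2 / W ^ 2 + s ^ 2 / W ^ 4)
      + LinearMap.trace ℝ V R / W ^ 2 + ℓ * (Q / W * (1 / T + inner ℝ Y X))
      + (t * k - formTrace X Dp + 2 * p (S X) X / W ^ 2 - 2 * s * p X X / W ^ 4) / W
      - ℓ * formTrace X (opForm H) + ℓ * ((N - 1) / φ) * γ ≤ 0 := by
    refine le_of_eq_of_le ?_ ht4
    have e1 : ‖S X‖ ^ 2 = W ^ 4 * ℓ ^ 2 * γ + s ^ 2 / W ^ 2 := by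
      rw [← hSXZ, hSX2]
      ring
    rw [hSXZ, e1]
    exact maximum_identity hW hT hφ hW2 hℓ (by rw [hsz, hzY])
  have b1 : 0 ≤ (1 / W ^ 2) *
      (LinearMap.trace ℝ V (S ∘ₗ S) - 2 * ‖S X‖ ^ 2 / W ^ 2 + s ^ 2 / W ^ 4) :=
    mul_nonneg (by positivity) hII
  have b2 : -(n * κ) ≤ LinearMap.trace ℝ V R / W ^ 2 := by
    rw [le_div_iff₀ hm, hW2]
    have : 0 ≤ n * κ := by positivity
    linarith only [this, hRtr]
  have b3 : -(ℓ * (q * (1 / T + y))) ≤ ℓ * (Q / W * (1 / T + inner ℝ Y X)) := by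
    have := mul_le_mul_of_nonneg_left (abs_le.1 hQterm).1 (by linarith : 0 ≤ ℓ)
    linarith
  -- The regularizing term `t u` contributes with a favourable sign, so no bound on `t` itself
  -- enters.
  have b4 : 0 ≤ t * k / W := by positivity
  have b5 : formTrace X Dp / W ≤ P₁ * n := by
    rw [div_le_iff₀ hW]
    refine (le_abs_self _).trans (hDptr.trans ?_)
    have : P₁ * n * ‖X‖ ≤ P₁ * n * W := mul_le_mul_of_nonneg_left hXW (by positivity)
    linarith
  have b6 := (abs_le.1 hpterm).1
  have b7 : ℓ * formTrace X (opForm H) ≤ ℓ * (C * n) :=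
    mul_le_mul_of_nonneg_left hHtr (by linarith)
  have b8 : ℓ * ((N - 1) / (16 * T ^ 2)) ≤ ℓ * ((N - 1) / φ) * γ := by
    have e1 : (N - 1) / 2 ≤ (N - 1) / φ := div_le_div_of_nonneg_left (by linarith) hφ hφ2
    have e2 : (N - 1) / (16 * T ^ 2) = (N - 1) / 2 * (1 / (8 * T ^ 2)) := by
      field_simp
      ring
    rw [e2, mul_assoc]
    refine mul_le_mul_of_nonneg_left ?_ (by linarith)
    exact mul_le_mul e1 hγ0 (by positivity) (le_trans (by linarith) e1)
  have b9 : n * (κ + P₁) ≤ ℓ * (n * (κ + P₁)) :=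
    le_mul_of_one_le_left (mul_nonneg hn0 (add_nonneg hκ hP₁)) hℓ1
  have b10 : (t * k - formTrace X Dp + 2 * p (S X) X / W ^ 2 - 2 * s * p X X / W ^ 4) / W =
      t * k / W - formTrace X Dp / W + (2 * p (S X) X / W ^ 2 - 2 * s * p X X / W ^ 4) / W := by
    ring
  have fin : ℓ * ((N - 1) / (16 * T ^ 2)) ≤
      ℓ * (n * (κ + P₁ + C) + (q + 2 * P₀) * (1 / T + y)) := by
    linarith only [key, b1, b2, b3, b4, b5, b6, b7, b8, b9, b10]
  exact le_of_mul_le_mul_left fin (by linarith)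

end Algebra

end Jang

end


noncomputable section

open Filter Topology

set_option maxSynthPendingDepth 3
set_option synthInstance.maxHeartbeats 200000

namespace Jang

/-! ### The Bochner identity and the second derivative test. -/

section Bochner

variable {E : Type*} [NormedAddCommGroup E] [NormedSpace ℝ E]

/-- The gradient of a function with respect to a metric. -/
def gradOf (G : E → E →L[ℝ] E →L[ℝ] ℝ) (f : E → ℝ) (y : E) : E := (G y).inverse (fderiv ℝ f y)

/-- The covariant derivative `w ↦ ∇_w X` of a vector field. -/
def covOp (G : E → E →L[ℝ] E →L[ℝ] ℝ) (X : E → E) (y : E) : E →L[ℝ] E :=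
  fderiv ℝ X y + (christoffelL G y).flip (X y)

theorem covOp_apply (G : E → E →L[ℝ] E →L[ℝ] ℝ) (X : E → E) (y w : E) :
    covOp G X y w = fderiv ℝ X y w + christoffelL G y w (X y) := rfl

/-- The covariant derivative in the direction `v` of a field of endomorphisms. -/
def covEnd (G : E → E →L[ℝ] E →L[ℝ] ℝ) (S : E → E →L[ℝ] E) (y v : E) : E →L[ℝ] E :=
  fderiv ℝ S y v + (christoffelL G y v ∘L S y - S y ∘L christoffelL G y v)

/-- The endomorphism `w ↦ R(w, X) X`. -/
def jacobiOp (G : E → E →L[ℝ] E →L[ℝ] ℝ) (y X : E) : E →ₗ[ℝ] E where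
  toFun w := curvatureOf G y w X X
  map_add' v w := by
    simp [curvatureOf]
    abel
  map_smul' c w := by
    simp [curvatureOf, smul_sub]

/-- The covariant Hessian as a continuous bilinear form. -/
def hessianL (G : E → E →L[ℝ] E →L[ℝ] ℝ) (f : E → ℝ) (y : E) : E →L[ℝ] E →L[ℝ] ℝ :=
  fderiv ℝ (fderiv ℝ f) y - (ContinuousLinearMap.postcomp E (fderiv ℝ f y)) ∘L christoffelL G y

theorem hessianL_apply (G : E → E →L[ℝ] E →L[ℝ] ℝ) (f : E → ℝ) (y v w : E) :
    hessianL G f y v w = hessianOf G f y v w := rfl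

namespace IsMetricAt

variable [FiniteDimensional ℝ E] {G : E → E →L[ℝ] E →L[ℝ] ℝ} {y : E}

theorem apply_gradOf (h : IsMetricAt G y) (f : E → ℝ) (w : E) :
    G y (gradOf G f y) w = fderiv ℝ f y w := by
  rw [gradOf, h.apply_inverse]

theorem contDiffAt_gradOf (h : IsMetricAt G y) {f : E → ℝ} (hf : ContDiffAt ℝ 3 f y) :
    ContDiffAt ℝ 2 (gradOf G f) y :=
  h.contDiffAt_inverse.clm_apply (hf.fderiv_right (by norm_num))

theorem contDiffAt_covOp (h : IsMetricAt G y) {X : E → E} (hX : ContDiffAt ℝ 2 X y) :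
    ContDiffAt ℝ 1 (covOp G X) y := by
  refine (hX.fderiv_right (by norm_num)).add ?_
  exact ((ContinuousLinearMap.flipₗᵢ ℝ E E E).contDiff.contDiffAt.comp y
    h.contDiffAt_christoffelL).clm_apply (hX.of_le (by norm_num))

theorem apply_covOp_gradOf (h : IsMetricAt G y) {f : E → ℝ} (hf : ContDiffAt ℝ 3 f y) (v w : E) :
    G y (covOp G (gradOf G f) y v) w = hessianOf G f y v w := by
  have hX := (h.contDiffAt_gradOf hf).differentiableAt (by simp)
  have e1 := h.hasFDerivAt_apply hX.hasFDerivAt (hasFDerivAt_const w y) v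
  have : (fun x ↦ G x (gradOf G f x) w) =ᶠ[𝓝 y] fun x ↦ fderiv ℝ f x w := by
    filter_upwards [h.eventually] with x hx using hx.apply_gradOf f w
  rw [this.fderiv_eq, fderiv_apply_const
    ((hf.fderiv_right (m := 2) (by norm_num)).differentiableAt (by simp)), zero_apply,
    zero_add, h.apply_gradOf] at e1
  rw [hessianOf, e1, covOp_apply]
  ring

theorem hessianOf_symm (h : IsMetricAt G y) {f : E → ℝ} (hf : ContDiffAt ℝ 2 f y) (v w : E) :
    hessianOf G f y v w = hessianOf G f y w v := by
  rw [hessianOf, hessianOf, h.christoffelL_symm v w, (hf.isSymmSndFDerivAt (by simp)) v w]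

/-- The Bochner identity: the covariant derivative of `∇_X X` for a vector field `X`. -/
theorem bochner (h : IsMetricAt G y) {X : E → E} (hX : ContDiffAt ℝ 2 X y) (w : E) :
    covOp G (fun x ↦ covOp G X x (X x)) y w =
      covEnd G (covOp G X) y (X y) w + covOp G X y (covOp G X y w) + jacobiOp G y (X y) w := by
  have hX1 : HasFDerivAt X (fderiv ℝ X y) y := (hX.differentiableAt (by simp)).hasFDerivAt
  have hX2 : HasFDerivAt (fderiv ℝ X) (fderiv ℝ (fderiv ℝ X) y) y :=
    ((hX.fderiv_right (m := 1) (by norm_num)).differentiableAt (by simp)).hasFDerivAt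
  have hΓ : HasFDerivAt (christoffelL G) (fderiv ℝ (christoffelL G) y) y :=
    (h.contDiffAt_christoffelL.differentiableAt (by simp)).hasFDerivAt
  have hS : DifferentiableAt ℝ (covOp G X) y := (h.contDiffAt_covOp hX).differentiableAt (by simp)
  have e1 (v : E) : fderiv ℝ (covOp G X) y (X y) v = fderiv ℝ (fderiv ℝ X) y (X y) v
      + fderiv ℝ (christoffelL G) y (X y) v (X y) + christoffelL G y v (fderiv ℝ X y (X y)) := by
    rw [← fderiv_apply_const hS]
    have := ((hX2.clm_apply (hasFDerivAt_const v y)).add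
      ((hΓ.clm_apply (hasFDerivAt_const v y)).clm_apply hX1)).fderiv
    change fderiv ℝ (fun x ↦ fderiv ℝ X x v + christoffelL G x v (X x)) y (X y) = _
    rw [show (fun x ↦ fderiv ℝ X x v + christoffelL G x v (X x)) =
      (fun x ↦ fderiv ℝ X x v) + fun x ↦ christoffelL G x v (X x) from rfl, this]
    simp
    abel
  have e2 : fderiv ℝ (fun x ↦ covOp G X x (X x)) y w = fderiv ℝ (fderiv ℝ X) y w (X y)
      + fderiv ℝ X y (fderiv ℝ X y w) + fderiv ℝ (christoffelL G) y w (X y) (X y)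
      + christoffelL G y (fderiv ℝ X y w) (X y) + christoffelL G y (X y) (fderiv ℝ X y w) := by
    have := ((hX2.clm_apply hX1).add ((hΓ.clm_apply hX1).clm_apply hX1)).fderiv
    rw [show (fun x ↦ covOp G X x (X x)) =
      (fun x ↦ fderiv ℝ X x (X x)) + fun x ↦ christoffelL G x (X x) (X x) from rfl, this]
    simp
    abel
  -- Second partial derivatives of `X` commute; the failure of covariant derivatives to commute is
  -- thus entirely in the Christoffel terms, which make up the curvature.
  have e3 : fderiv ℝ (fderiv ℝ X) y w (X y) = fderiv ℝ (fderiv ℝ X) y (X y) w :=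
    (hX.isSymmSndFDerivAt (by simp)) w (X y)
  rw [covOp_apply, e2, e3]
  simp only [covEnd, add_apply, sub_apply, ContinuousLinearMap.comp_apply, e1, covOp_apply,
    jacobiOp, LinearMap.coe_mk, AddHom.coe_mk, curvatureOf, map_add,
    h.christoffelL_symm (fderiv ℝ X y w) (X y), h.christoffelL_symm w (fderiv ℝ X y (X y)),
    h.christoffelL_symm w (X y)]
  abel

omit [FiniteDimensional ℝ E] in
-- The connection acts on endomorphisms by a commutator, which has trace zero.
theorem trace_covEnd (S : E → E →L[ℝ] E) (v : E) :
    LinearMap.trace ℝ E (covEnd G S y v) = LinearMap.trace ℝ E (fderiv ℝ S y v) := by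
  have : ((covEnd G S y v : E →L[ℝ] E) : E →ₗ[ℝ] E) = (fderiv ℝ S y v : E →ₗ[ℝ] E)
      + ((christoffelL G y v : E →ₗ[ℝ] E) * (S y : E →ₗ[ℝ] E)
        - (S y : E →ₗ[ℝ] E) * (christoffelL G y v : E →ₗ[ℝ] E)) := rfl
  rw [this, map_add, map_sub, LinearMap.trace_mul_comm, sub_self, add_zero]

/-- Raising an index commutes with covariant differentiation. -/
theorem apply_covEnd_sharp (h : IsMetricAt G y) {P : E → E →L[ℝ] E →L[ℝ] ℝ}
    (hP : DifferentiableAt ℝ P y) (v w z : E) :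
    G y (covEnd G (fun x ↦ (G x).inverse ∘L P x) y v w) z = covDerivOf G P y v w z := by
  have hd : DifferentiableAt ℝ (fun x ↦ (G x).inverse ∘L P x) y :=
    (h.contDiffAt_inverse.differentiableAt (by simp)).clm_comp hP
  have e1 := h.hasFDerivAt_apply (hd.clm_apply (differentiableAt_const w)).hasFDerivAt
    (hasFDerivAt_const z y) v
  have : (fun x ↦ G x (((G x).inverse ∘L P x) w) z) =ᶠ[𝓝 y] fun x ↦ P x w z := by
    filter_upwards [h.eventually] with x hx
    simp [hx.apply_inverse]
  rw [this.fderiv_eq, fderiv_apply_const₂ hP, fderiv_apply_const hd] at e1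
  simp only [ContinuousLinearMap.comp_apply, zero_apply, zero_add, h.apply_inverse, map_add,
    add_apply] at e1
  simp only [covEnd, covDerivOf, e1, add_apply, sub_apply, ContinuousLinearMap.comp_apply, map_add,
    map_sub, h.apply_inverse]
  ring

end IsMetricAt

/-- The trace as a continuous linear functional. -/
def traceL (E : Type*) [NormedAddCommGroup E] [NormedSpace ℝ E] [FiniteDimensional ℝ E] :
    (E →L[ℝ] E) →L[ℝ] ℝ :=
  LinearMap.toContinuousLinearMap ((LinearMap.trace ℝ E) ∘ₗ ContinuousLinearMap.coeLM ℝ)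

theorem traceL_apply [FiniteDimensional ℝ E] (T : E →L[ℝ] E) :
    traceL E T = LinearMap.trace ℝ E T := rfl

/-- Were the second derivative along `w` positive, the restriction to that line would also have a
local minimum. It would then be locally constant, with second derivative zero. -/
theorem _root_.IsLocalMax.fderiv_fderiv_nonpos {f : E → ℝ} {y : E} (h : IsLocalMax f y)
    (hf : ContDiffAt ℝ 2 f y) (w : E) : fderiv ℝ (fderiv ℝ f) y w w ≤ 0 := by
  by_contra! hpos
  set g : ℝ → ℝ := fun s ↦ f (y + s • w) with hg
  have hl (s : ℝ) : HasDerivAt (fun s : ℝ ↦ y + s • w) w s := by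
    simpa using ((hasDerivAt_id s).smul_const w).const_add y
  have hc : Tendsto (fun s : ℝ ↦ y + s • w) (𝓝 0) (𝓝 y) := by
    have := (hl 0).continuousAt.tendsto
    simpa using this
  have hd : deriv g =ᶠ[𝓝 0] fun s ↦ fderiv ℝ f (y + s • w) w := by
    filter_upwards [hc.eventually (hf.eventually (by simp))] with s hs
    exact ((hs.differentiableAt (by simp)).hasFDerivAt.comp_hasDerivAt s (hl s)).deriv
  have hf1 : DifferentiableAt ℝ (fderiv ℝ f) y :=
    (hf.fderiv_right (m := 1) (by norm_num)).differentiableAt (by simp)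
  have hf2 : HasFDerivAt (fun z ↦ fderiv ℝ f z w) (fderiv ℝ (fun z ↦ fderiv ℝ f z w) y)
      (y + (0 : ℝ) • w) := by
    rw [zero_smul, add_zero]
    exact (hf1.clm_apply (differentiableAt_const w)).hasFDerivAt
  have hd2 : deriv (deriv g) 0 = fderiv ℝ (fderiv ℝ f) y w w := by
    rw [hd.deriv_eq, ← fderiv_apply_const hf1]
    exact (hf2.comp_hasDerivAt (0 : ℝ) (hl 0)).deriv
  have hmax : IsLocalMax g 0 := by
    have : ∀ᶠ s in 𝓝 (0 : ℝ), f (y + s • w) ≤ f y := hc.eventually h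
    simpa [IsLocalMax, IsMaxFilter, hg] using this
  have hmin : IsLocalMin g 0 := by
    refine isLocalMin_of_deriv_deriv_pos (by rwa [hd2]) hmax.deriv_eq_zero ?_
    exact (ContinuousAt.comp (g := f) (f := fun s : ℝ ↦ y + s • w)
      (by simpa using hf.continuousAt) (by fun_prop))
  have hconst : g =ᶠ[𝓝 0] fun _ ↦ g 0 := by
    filter_upwards [hmax, hmin] with s h1 h2 using le_antisymm h1 h2
  have : deriv (deriv g) 0 = 0 := by
    rw [hconst.deriv.deriv_eq]
    simp
  linarith

end Bochner

end Jang

end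


noncomputable section

open Filter Topology

set_option maxSynthPendingDepth 3
set_option synthInstance.maxHeartbeats 200000

namespace Jang

/-! ### Differentiating the Jang equation along the gradient. -/

section MaximumPoint

variable {E : Type*} [NormedAddCommGroup E] [NormedSpace ℝ E] [FiniteDimensional ℝ E]

/-- The square `1 + |Du|²` of the area element of the graph of `u`. -/
def areaSq (G : E → E →L[ℝ] E →L[ℝ] ℝ) (u : E → ℝ) (y : E) : ℝ :=
  1 + G y (gradOf G u y) (gradOf G u y)

/-- The trace of a field of bilinear forms over the tangent spaces of the graph of `u`. -/
def graphTraceOf (G : E → E →L[ℝ] E →L[ℝ] ℝ) (u : E → ℝ) (P : E → E →L[ℝ] E →L[ℝ] ℝ) (y : E) : ℝ :=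
  traceL E ((G y).inverse ∘L P y) - P y (gradOf G u y) (gradOf G u y) / areaSq G u y

/-- The regularized Jang equation at a point of an open subset of a vector space. -/
def JangEquationOf (G P : E → E →L[ℝ] E →L[ℝ] ℝ) (t : ℝ) (u : E → ℝ) (y : E) : Prop :=
  traceL E (covOp G (gradOf G u) y)
      - G y (covOp G (gradOf G u) y (gradOf G u y)) (gradOf G u y) / areaSq G u y =
    √(areaSq G u y) * (t * u y - graphTraceOf G u P y)

namespace IsMetricAt

variable {G P : E → E →L[ℝ] E →L[ℝ] ℝ} {u : E → ℝ} {y : E}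

omit [FiniteDimensional ℝ E] in
theorem areaSq_pos (h : IsMetricAt G y) : 0 < areaSq G u y := by
  have := h.nonneg (gradOf G u y)
  unfold areaSq
  linarith

theorem apply_covOp_symm (h : IsMetricAt G y) (hu : ContDiffAt ℝ 3 u y) (v w : E) :
    G y (covOp G (gradOf G u) y v) w = G y (covOp G (gradOf G u) y w) v := by
  rw [h.apply_covOp_gradOf hu, h.apply_covOp_gradOf hu, h.hessianOf_symm (hu.of_le (by norm_num))]

theorem differentiableAt_gradOf (h : IsMetricAt G y) (hu : ContDiffAt ℝ 3 u y) :
    DifferentiableAt ℝ (gradOf G u) y := (h.contDiffAt_gradOf hu).differentiableAt (by simp)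

theorem differentiableAt_covOp (h : IsMetricAt G y) (hu : ContDiffAt ℝ 3 u y) :
    DifferentiableAt ℝ (covOp G (gradOf G u)) y :=
  (h.contDiffAt_covOp (h.contDiffAt_gradOf hu)).differentiableAt (by simp)

theorem contDiffAt_areaSq (h : IsMetricAt G y) (hu : ContDiffAt ℝ 3 u y) :
    ContDiffAt ℝ 2 (areaSq G u) y :=
  contDiffAt_const.add ((h.contDiffAt.clm_apply (h.contDiffAt_gradOf hu)).clm_apply
    (h.contDiffAt_gradOf hu))

/-- By the symmetry of the Hessian, half the gradient of `|Du|²` is the field `D_X X` with `X = Du`,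
to which the Bochner identity applies. -/
theorem fderiv_areaSq (h : IsMetricAt G y) (hu : ContDiffAt ℝ 3 u y) (w : E) :
    fderiv ℝ (areaSq G u) y w =
      2 * G y (covOp G (gradOf G u) y (gradOf G u y)) w := by
  have hX := (h.differentiableAt_gradOf hu).hasFDerivAt
  have e1 := h.hasFDerivAt_apply hX hX w
  unfold areaSq
  rw [fderiv_const_add, e1, ← covOp_apply, h.symm (gradOf G u y), h.apply_covOp_symm hu w]
  ring

/-- The Jang equation differentiated in the direction of the gradient. -/
theorem fderiv_jang (h : IsMetricAt G y) (hu : ContDiffAt ℝ 3 u y) (hP : DifferentiableAt ℝ P y)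
    (hPs : ∀ v w, P y v w = P y w v) {t : ℝ} (hJ : ∀ᶠ z in 𝓝 y, JangEquationOf G P t u z)
    {X σ : E} {S : E →L[ℝ] E} {W : ℝ} (hX : X = gradOf G u y)
    (hS : S = covOp G (gradOf G u) y) (hσ : σ = S X) (hW : W = √(areaSq G u y)) :
    LinearMap.trace ℝ E (covEnd G (covOp G (gradOf G u)) y X)
      - (G y (covEnd G (covOp G (gradOf G u)) y X X + S (S X) + jacobiOp G y X X) X
        + G y σ σ) / W ^ 2 + 2 * G y σ X ^ 2 / W ^ 4 =
      G y σ X * (t * u y - graphTraceOf G u P y) / W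
        + W * (t * G y X X - (LinearMap.trace ℝ E
          (covEnd G (fun x ↦ (G x).inverse ∘L P x) y X) - covDerivOf G P y X X X / W ^ 2)
        + 2 * P y σ X / W ^ 2 - 2 * G y σ X * P y X X / W ^ 4) := by
  have hapos := h.areaSq_pos (u := u)
  have hWpos : 0 < W := by rw [hW]; positivity
  have hW2 : W ^ 2 = areaSq G u y := by rw [hW, Real.sq_sqrt hapos.le]
  have dX := h.differentiableAt_gradOf hu
  have dS := h.differentiableAt_covOp hu
  have dm : DifferentiableAt ℝ (areaSq G u) y :=
    (h.contDiffAt_areaSq hu).differentiableAt (by simp)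
  have dσ : DifferentiableAt ℝ (fun z ↦ covOp G (gradOf G u) z (gradOf G u z)) y :=
    dS.clm_apply dX
  have dsharp : DifferentiableAt ℝ (fun z ↦ (G z).inverse ∘L P z) y :=
    (h.contDiffAt_inverse.differentiableAt (by simp)).clm_comp hP
  have f1 : HasFDerivAt (fun z ↦ traceL E (covOp G (gradOf G u) z))
      (traceL E ∘L fderiv ℝ (covOp G (gradOf G u)) y) y :=
    (traceL E).hasFDerivAt.comp y dS.hasFDerivAt
  have dGσX : DifferentiableAt ℝ
      (fun z ↦ G z (covOp G (gradOf G u) z (gradOf G u z)) (gradOf G u z)) y :=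
    (h.differentiableAt.clm_apply dσ).clm_apply dX
  have f2 := h.hasFDerivAt_apply dσ.hasFDerivAt dX.hasFDerivAt X
  -- The curvature term `R(X, X) X` is zero; it is kept so that the operator `D_X S + S² + R(·, X)
  -- X` is the same one as in the second derivative test.
  rw [← covOp_apply, ← covOp_apply, h.bochner (h.contDiffAt_gradOf hu), ← hX, ← hS, ← hσ] at f2
  have f3 : HasFDerivAt (fun z ↦ traceL E ((G z).inverse ∘L P z))
      (traceL E ∘L fderiv ℝ (fun z ↦ (G z).inverse ∘L P z) y) y :=
    (traceL E).hasFDerivAt.comp y dsharp.hasFDerivAt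
  have f4 := (hP.hasFDerivAt.clm_apply dX.hasFDerivAt).clm_apply dX.hasFDerivAt
  have hu1 : HasFDerivAt u (fderiv ℝ u y) y := (hu.differentiableAt (by simp)).hasFDerivAt
  have hdiv {f : E → ℝ} {f' : E →L[ℝ] ℝ} (hf : HasFDerivAt f f' y) :
      HasFDerivAt (fun z ↦ f z / areaSq G u z) ((areaSq G u y ^ 2)⁻¹ •
        (areaSq G u y • f' - f y • fderiv ℝ (areaSq G u) y)) y := by
    have := hf.mul (hasDerivAt_inv hapos.ne' |>.comp_hasFDerivAt y dm.hasFDerivAt)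
    refine (this.congr_fderiv ?_).congr_of_eventuallyEq (Eventually.of_forall fun z ↦ ?_)
    · ext v
      simp
      field_simp
      ring
    · simp [div_eq_mul_inv]
  have L := f1.sub (hdiv dGσX.hasFDerivAt)
  have hsqrt := dm.hasFDerivAt.sqrt hapos.ne'
  have R := hsqrt.mul ((hu1.const_mul t).sub (f3.sub (hdiv f4)))
  have hJy : (fun z ↦ traceL E (covOp G (gradOf G u) z)
      - G z (covOp G (gradOf G u) z (gradOf G u z)) (gradOf G u z) / areaSq G u z) =ᶠ[𝓝 y]
      fun z ↦ √(areaSq G u z) * (t * u z - graphTraceOf G u P z) := hJ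
  have key := (hJy.fderiv_eq.symm.trans L.fderiv).symm.trans R.fderiv
  have key2 := congrArg (fun A : E →L[ℝ] ℝ ↦ A X) key
  simp only [sub_apply, ContinuousLinearMap.comp_apply, smul_apply, add_apply, f2, smul_eq_mul,
    h.fderiv_areaSq hu, ← hX, ← hS, ← hσ, traceL_apply, ← trace_covEnd (G := G),
    ContinuousLinearMap.flip_apply, ← h.apply_gradOf u, ← hW2] at key2
  -- The derivative of `p(X, X)` along `X`, regrouped into covariant form with `D_X X = S X`.
  have f5 : fderiv ℝ P y X X X + P y (fderiv ℝ (gradOf G u) y X) X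
      + P y X (fderiv ℝ (gradOf G u) y X) = covDerivOf G P y X X X + 2 * P y σ X := by
    have : σ = fderiv ℝ (gradOf G u) y X + christoffelL G y X X := by
      rw [hσ, hS, covOp_apply, ← hX]
    rw [covDerivOf, this, hPs X (fderiv ℝ (gradOf G u) y X), hPs X (christoffelL G y X X)]
    simp
    ring
  have f6 : fderiv ℝ P y X X X = covDerivOf G P y X X X + 2 * P y σ X
      - P y (fderiv ℝ (gradOf G u) y X) X - P y X (fderiv ℝ (gradOf G u) y X) := by linarith
  rw [f6] at key2
  rw [graphTraceOf, ← hX, ← hW2, traceL_apply]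
  simp only [Real.sqrt_sq hWpos.le, Pi.sub_apply, ← hX, ← hW2] at key2
  rw [← hσ]
  clear L R hdiv hsqrt hJ hJy key f1 f2 f3 f4 f5 f6 hW hW2
  refine Eq.trans ?_ (key2.trans ?_)
  · field_simp
    ring
  · field_simp
    ring

end IsMetricAt

end MaximumPoint

end Jang

end


noncomputable section

open Filter Topology

set_option maxSynthPendingDepth 3
set_option synthInstance.maxHeartbeats 200000

namespace Jang

/-! ### First and second derivative tests for the logarithm of the test function. -/

section MaximumEstimate

variable {E : Type*} [NormedAddCommGroup E] [NormedSpace ℝ E]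

namespace IsMetricAt

variable {G P : E → E →L[ℝ] E →L[ℝ] ℝ} {u ψ : E → ℝ} {y : E}

/-- Makes the metric at one point the inner product of an auxiliary space, so that orthonormal bases
and adjoints are available for the pointwise algebra. -/
theorem exists_isometry.{v} {F : Type v} [NormedAddCommGroup F] [NormedSpace ℝ F]
    {G : F → F →L[ℝ] F →L[ℝ] ℝ} {y : F} (h : IsMetricAt G y) :
    ∃ (V : Type v) (_ : NormedAddCommGroup V) (_ : InnerProductSpace ℝ V) (e : F ≃ₗ[ℝ] V),
      ∀ v w, G y v w = inner ℝ (e v) (e w) := by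
  let core : InnerProductSpace.Core ℝ F :=
    { inner := fun v w ↦ G y v w
      conj_inner_symm := fun v w ↦ by simp [h.symm w v]
      re_inner_nonneg := fun v ↦ by simpa using h.nonneg v
      add_left := fun v w z ↦ by simp
      smul_left := fun v w c ↦ by simp
      definite := fun v hv ↦ by
        by_contra hne
        exact (h.pos hne).ne' hv }
  exact ⟨F, core.toNormedAddCommGroup, InnerProductSpace.ofCore core.toCore,
    LinearEquiv.refl ℝ F, fun v w ↦ rfl⟩

variable [FiniteDimensional ℝ E]

/-- The derivatives of `½ log (1 + |Du|²) + N log φ`. -/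
theorem hasFDerivAt_log_areaSq (h : IsMetricAt G y) (hu : ContDiffAt ℝ 3 u y) {φ : E → ℝ}
    (hφ : DifferentiableAt ℝ φ y) (hφ0 : 0 < φ y) (N : ℝ) (w : E) :
    fderiv ℝ (fun z ↦ 1 / 2 * Real.log (areaSq G u z) + N * Real.log (φ z)) y w =
      G y (covOp G (gradOf G u) y (gradOf G u y)) w / areaSq G u y
        + N * (fderiv ℝ φ y w / φ y) := by
  have h1 : DifferentiableAt ℝ (areaSq G u) y :=
    (h.contDiffAt_areaSq hu).differentiableAt (by simp)
  have := ((h1.hasFDerivAt.log h.areaSq_pos.ne').const_mul (1 / 2)).add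
    ((hφ.hasFDerivAt.log hφ0.ne').const_mul N)
  refine (congrArg (fun A : E →L[ℝ] ℝ ↦ A w) this.fderiv).trans ?_
  simp [h.fderiv_areaSq hu]
  ring

/-- The coordinate second derivative at a critical point is the covariant one: the critical equation
applied to `Γ(w, w)` makes the Christoffel corrections of the two summands cancel. -/
theorem fderiv_fderiv_log_areaSq (h : IsMetricAt G y) (hu : ContDiffAt ℝ 3 u y) {φ : E → ℝ}
    (hφ : ContDiffAt ℝ 2 φ y) (hφ0 : 0 < φ y) {N : ℝ}
    (hmax : IsLocalMax (fun z ↦ 1 / 2 * Real.log (areaSq G u z) + N * Real.log (φ z)) y) (w : E) :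
    (∀ v, G y (covOp G (gradOf G u) y (gradOf G u y)) v / areaSq G u y
        + N * (fderiv ℝ φ y v / φ y) = 0) ∧
    G y (covOp G (fun z ↦ covOp G (gradOf G u) z (gradOf G u z)) y w) w / areaSq G u y
      - 2 * G y (covOp G (gradOf G u) y (gradOf G u y)) w ^ 2 / areaSq G u y ^ 2
      + N / φ y * hessianOf G φ y w w - N / φ y ^ 2 * fderiv ℝ φ y w ^ 2 ≤ 0 := by
  have hapos := h.areaSq_pos (u := u)
  have hφd : DifferentiableAt ℝ φ y := hφ.differentiableAt (by simp)
  have hcrit (v : E) : G y (covOp G (gradOf G u) y (gradOf G u y)) v / areaSq G u y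
      + N * (fderiv ℝ φ y v / φ y) = 0 := by
    rw [← h.hasFDerivAt_log_areaSq hu hφd hφ0, hmax.fderiv_eq_zero]
    rfl
  refine ⟨hcrit, ?_⟩
  have hC2 : ContDiffAt ℝ 2 (fun z ↦ 1 / 2 * Real.log (areaSq G u z) + N * Real.log (φ z)) y :=
    (contDiffAt_const.mul ((h.contDiffAt_areaSq hu).log hapos.ne')).add
      (contDiffAt_const.mul (hφ.log hφ0.ne'))
  have hneg := hmax.fderiv_fderiv_nonpos hC2 w
  rw [← fderiv_apply_const ((hC2.fderiv_right (m := 1) (by norm_num)).differentiableAt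
    (by simp))] at hneg
  have heq : (fun z ↦ fderiv ℝ (fun z ↦ 1 / 2 * Real.log (areaSq G u z) + N * Real.log (φ z)) z w)
      =ᶠ[𝓝 y] fun z ↦ G z (covOp G (gradOf G u) z (gradOf G u z)) w * (areaSq G u z)⁻¹
        + N * (fderiv ℝ φ z w * (φ z)⁻¹) := by
    filter_upwards [h.eventually, hu.eventually (by simp), hφ.eventually (by simp),
      hφ.continuousAt.eventually (lt_mem_nhds hφ0)] with z h1 h2 h3 h4
    simpa [div_eq_mul_inv] using h1.hasFDerivAt_log_areaSq h2 (h3.differentiableAt (by simp)) h4 N w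
  rw [heq.fderiv_eq] at hneg
  have dσ : DifferentiableAt ℝ (fun z ↦ covOp G (gradOf G u) z (gradOf G u z)) y :=
    (h.differentiableAt_covOp hu).clm_apply (h.differentiableAt_gradOf hu)
  have dm : DifferentiableAt ℝ (areaSq G u) y :=
    (h.contDiffAt_areaSq hu).differentiableAt (by simp)
  have d2φ : DifferentiableAt ℝ (fderiv ℝ φ) y :=
    (hφ.fderiv_right (m := 1) (by norm_num)).differentiableAt (by simp)
  have f1 := h.hasFDerivAt_apply dσ.hasFDerivAt (hasFDerivAt_const w y) w
  rw [← covOp_apply, zero_apply, zero_add] at f1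
  have df1 : DifferentiableAt ℝ
      (fun z ↦ G z (covOp G (gradOf G u) z (gradOf G u z)) w) y :=
    (h.differentiableAt.clm_apply dσ).clm_apply (by fun_prop)
  have f2 := (df1.hasFDerivAt.mul (hasDerivAt_inv hapos.ne' |>.comp_hasFDerivAt y
    dm.hasFDerivAt)).add (((d2φ.hasFDerivAt.clm_apply (hasFDerivAt_const w y)).mul
      (hasDerivAt_inv hφ0.ne' |>.comp_hasFDerivAt y hφd.hasFDerivAt)).const_mul N)
  have f3 := (congrArg (fun A : E →L[ℝ] ℝ ↦ A w) f2.fderiv)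
  have f4 := le_of_eq_of_le f3.symm hneg
  simp only [add_apply, smul_apply, f1, smul_eq_mul, h.fderiv_areaSq hu,
    ContinuousLinearMap.comp_apply, ContinuousLinearMap.flip_apply, zero_apply, map_zero, zero_add,
    Function.comp_apply] at f4
  have f5 := hcrit (christoffelL G y w w)
  rw [hessianOf]
  refine le_of_eq_of_le ?_ f4
  have f6 : N * (fderiv ℝ φ y (christoffelL G y w w) / φ y) =
    -(G y (covOp G (gradOf G u) y (gradOf G u y)) (christoffelL G y w w) / areaSq G u y) := by
    linarith
  have f7 : N / φ y * (fderiv ℝ (fderiv ℝ φ) y w w - fderiv ℝ φ y (christoffelL G y w w)) =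
    N * (fderiv ℝ (fderiv ℝ φ) y w w * (φ y)⁻¹)
      - N * (fderiv ℝ φ y (christoffelL G y w w) / φ y) := by ring
  rw [f7, f6]
  field_simp
  ring

end IsMetricAt

end MaximumEstimate

end Jang

end


noncomputable section

open Filter Topology

set_option maxSynthPendingDepth 3
set_option synthInstance.maxHeartbeats 200000

namespace Jang

/-! ### The inequality at an interior maximum, transported to an inner product space. -/

section MaximumEstimate

variable {E : Type*} [NormedAddCommGroup E] [NormedSpace ℝ E] [FiniteDimensional ℝ E]

namespace IsMetricAt

variable {G P : E → E →L[ℝ] E →L[ℝ] ℝ} {u ψ : E → ℝ} {y : E}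

/-- The estimate at an interior maximum of `½ log (1 + |Du|²) + N log (u / T + c - ψ)`. -/
theorem maximum_estimate (h : IsMetricAt G y) (hu : ContDiffAt ℝ 3 u y) (hψ : ContDiffAt ℝ 2 ψ y)
    (hP : DifferentiableAt ℝ P y) (hPs : ∀ v w, P y v w = P y w v) {t T N c P₀ P₁ Θ κ a C : ℝ}
    (ht : 0 ≤ t) (hT : 0 < T) (hN : 2 ≤ N) (hP₀ : 0 ≤ P₀) (hP₁ : 0 ≤ P₁) (hκ : 0 ≤ κ) (hC : 0 ≤ C)
    (hJ : ∀ᶠ z in 𝓝 y, JangEquationOf G P t u z)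
    (hp : ∀ v w, |P y v w| ≤ P₀ * √(G y v v) * √(G y w w))
    (hDp : ∀ z v w, |covDerivOf G P y z v w| ≤ P₁ * √(G y z z) * √(G y v v) * √(G y w w))
    (hR : ∀ v w, -(κ * G y v v * G y w w) ≤ G y (curvatureOf G y v w w) v)
    (hΘ : t * |u y| ≤ Θ) (hHψ : ∀ v, hessianOf G ψ y v v ≤ C * G y v v)
    (hdψ : ∀ v, |fderiv ℝ ψ y v| ≤ a * √(G y v v))
    (hX1 : 1 ≤ √(G y (gradOf G u y) (gradOf G u y)))
    (hXa : 2 * T * a ≤ √(G y (gradOf G u y) (gradOf G u y)))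
    (hφ0 : 0 < u y / T + c - ψ y) (hφ2 : u y / T + c - ψ y ≤ 2)
    (hmax : IsLocalMax (fun z ↦ 1 / 2 * Real.log (areaSq G u z)
      + N * Real.log (u z / T + c - ψ z)) y) :
    (N - 1) / (16 * T ^ 2) ≤ Module.finrank ℝ E * (κ + P₁ + C)
      + (Θ + P₀ * Module.finrank ℝ E + 2 * P₀) * (1 / T + a) := by
  obtain ⟨V, _, _, e, he⟩ := h.exists_isometry
  have : FiniteDimensional ℝ V := LinearEquiv.finiteDimensional e
  have hnorm (v : E) : √(G y v v) = ‖e v‖ := by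
    rw [he, real_inner_self_eq_norm_sq, Real.sqrt_sq (norm_nonneg _)]
  have hnormsq (v : E) : G y v v = ‖e v‖ ^ 2 := by rw [he, real_inner_self_eq_norm_sq]
  simp only [hnorm] at hp hDp hdψ hX1 hXa
  simp only [hnormsq] at hHψ hR
  have hsymm (v : V) : e (e.symm v) = v := e.apply_symm_apply v
  set X := gradOf G u y with hX
  set S := covOp G (gradOf G u) y with hS
  set W := √(areaSq G u y) with hW
  set φ : E → ℝ := fun z ↦ u z / T + c - ψ z with hφ
  have hapos := h.areaSq_pos (u := u)
  have hWpos : 0 < W := by positivity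
  have hW2 : W ^ 2 = areaSq G u y := by rw [hW, Real.sq_sqrt hapos.le]
  have hW4 : W ^ 4 = areaSq G u y ^ 2 := by rw [← hW2]; ring
  have hW2' : W ^ 2 = 1 + ‖e X‖ ^ 2 := by rw [hW2, areaSq, ← hnormsq]
  have hu2 : ContDiffAt ℝ 2 u y := hu.of_le (by norm_num)
  have hφC : ContDiffAt ℝ 2 φ y := ((hu2.div_const T).add contDiffAt_const).sub hψ
  have ht1 (A : E →L[ℝ] E) : LinearMap.trace ℝ V (e.conj (A : E →ₗ[ℝ] E)) =
      LinearMap.trace ℝ E (A : E →ₗ[ℝ] E) := LinearMap.trace_conj' _ e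
  have hconj (A : E →ₗ[ℝ] E) (v w : V) : inner ℝ (e.conj A v) w = G y (A (e.symm v)) (e.symm w) := by
    rw [he, hsymm]
    rfl
  have hadd (A B : E →ₗ[ℝ] E) : e.conj (A + B) = e.conj A + e.conj B := map_add _ _ _
  have hfin : Module.finrank ℝ V = Module.finrank ℝ E := e.symm.finrank_eq
  -- derivatives of `φ`
  have hdφ1 (z : E) (huz : DifferentiableAt ℝ u z) (hψz : DifferentiableAt ℝ ψ z) :
      fderiv ℝ φ z = T⁻¹ • fderiv ℝ u z - fderiv ℝ ψ z := by
    have := ((huz.hasFDerivAt.const_mul T⁻¹).add_const c).sub hψz.hasFDerivAt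
    refine (this.congr_of_eventuallyEq (Eventually.of_forall fun x ↦ ?_)).fderiv
    simp [hφ, div_eq_inv_mul]
  have hdφ : fderiv ℝ φ y = T⁻¹ • fderiv ℝ u y - fderiv ℝ ψ y :=
    hdφ1 y (hu.differentiableAt (by simp)) (hψ.differentiableAt (by simp))
  have hd2φ : fderiv ℝ (fderiv ℝ φ) y = T⁻¹ • fderiv ℝ (fderiv ℝ u) y - fderiv ℝ (fderiv ℝ ψ) y := by
    have : fderiv ℝ φ =ᶠ[𝓝 y] fun z ↦ T⁻¹ • fderiv ℝ u z - fderiv ℝ ψ z := by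
      filter_upwards [hu.eventually (by simp), hψ.eventually (by simp)] with z h1 h2
      exact hdφ1 z (h1.differentiableAt (by simp)) (h2.differentiableAt (by simp))
    rw [this.fderiv_eq]
    exact ((((hu2.fderiv_right (m := 1) (by norm_num)).differentiableAt (by simp)).hasFDerivAt.const_smul
      T⁻¹).sub ((hψ.fderiv_right (m := 1) (by norm_num)).differentiableAt (by simp)).hasFDerivAt).fderiv
  have hHφ (w : E) : hessianOf G φ y w w = G y (S w) w / T - hessianOf G ψ y w w := by
    rw [h.apply_covOp_gradOf hu, hessianOf, hessianOf, hessianOf, hdφ, hd2φ]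
    simp
    ring
  obtain ⟨hcrit, hsecond⟩ := (fun hm ↦ ⟨(h.fderiv_fderiv_log_areaSq hu hφC hφ0 hm 0).1,
    fun w ↦ (h.fderiv_fderiv_log_areaSq hu hφC hφ0 hm w).2⟩ :
    _ → (_ ∧ ∀ w, _)) hmax
  set Y := gradOf G ψ y with hY
  set H : E →L[ℝ] E := (G y).inverse ∘L hessianL G ψ y with hH
  set A := covEnd G (covOp G (gradOf G u)) y X with hA
  set D := covEnd G (fun x ↦ (G x).inverse ∘L P x) y X with hD
  have hGH (v w : E) : G y (H v) w = hessianOf G ψ y v w := by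
    rw [hH, ContinuousLinearMap.comp_apply, h.apply_inverse, hessianL_apply]
  set pV : V →ₗ[ℝ] V →ₗ[ℝ] ℝ := LinearMap.mk₂ ℝ (fun v w ↦ P y (e.symm v) (e.symm w))
    (by simp) (by simp) (by simp) (by simp) with hpV
  set DpV : V →ₗ[ℝ] V →ₗ[ℝ] ℝ := LinearMap.mk₂ ℝ (fun v w ↦ covDerivOf G P y X (e.symm v) (e.symm w))
    (by intros; simp [covDerivOf]; ring) (by intros; simp [covDerivOf]; ring)
    (by intros; simp [covDerivOf]; ring) (by intros; simp [covDerivOf]; ring) with hDpV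
  have hpapp (v w : E) : pV (e v) (e w) = P y v w := by simp [hpV]
  have hDpapp (v w : E) : DpV (e v) (e w) = covDerivOf G P y X v w := by simp [hDpV]
  have hDpop : DpV = opForm (e.conj (D : E →ₗ[ℝ] E)) := by
    ext v w
    rw [opForm_apply, hconj]
    exact (h.apply_covEnd_sharp hP _ _ _).symm
  have hpop : pV = opForm (e.conj (((G y).inverse ∘L P y : E →L[ℝ] E) : E →ₗ[ℝ] E)) := by
    ext v w
    rw [opForm_apply, hconj]
    simp [h.apply_inverse, hpV]
  have hcX (B : E →ₗ[ℝ] E) (v : E) : e.conj B (e v) = e (B v) := by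
    simp [LinearEquiv.conj_apply]
  have hQeq : graphTraceOf G u P y = formTrace (e X) pV := by
    rw [graphTraceOf, hpop, formTrace_opForm, ht1, ← hW2', ← hW2, hconj]
    simp [h.apply_inverse, traceL_apply, hX]
  have hDtr : formTrace (e X) DpV =
      LinearMap.trace ℝ E (D : E →ₗ[ℝ] E) - covDerivOf G P y X X X / W ^ 2 := by
    rw [hDpop, formTrace_opForm, ht1, ← hW2', ← hDpapp, hDpop, opForm_apply]
  have hσ : e.conj (S : E →ₗ[ℝ] E) (e X) = e (S X) := hcX _ _
  have hM : e.conj (A : E →ₗ[ℝ] E) + e.conj (S : E →ₗ[ℝ] E) ∘ₗ e.conj (S : E →ₗ[ℝ] E)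
      + e.conj (jacobiOp G y X) = e.conj ((A : E →ₗ[ℝ] E) + (S : E →ₗ[ℝ] E) ∘ₗ (S : E →ₗ[ℝ] E)
        + jacobiOp G y X) := by
    rw [hadd, hadd, LinearEquiv.conj_comp]
  rw [← hfin]
  refine no_interior_max (X := e X) (Y := e Y) (S := e.conj (S : E →ₗ[ℝ] E))
    (A := e.conj (A : E →ₗ[ℝ] E)) (R := e.conj (jacobiOp G y X)) (H := e.conj (H : E →ₗ[ℝ] E))
    (p := pV) (Dp := DpV) (W := W) (Q := t * u y - graphTraceOf G u P y) (φ := φ y)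
    ?_ hWpos hW2' ht hT hφ0 hφ2 hN hP₀ hP₁ hκ hC ?_ ?_ ?_ ?_ ?_ hX1 hXa ?_ ?_ ?_ ?_ ?_
  · intro v w
    rw [hconj, real_inner_comm, hconj]
    exact h.apply_covOp_symm hu _ _
  · intro v w
    simpa [hpV, hsymm] using hp (e.symm v) (e.symm w)
  · intro v w
    simpa [hDpV, hsymm] using hDp X (e.symm v) (e.symm w)
  · intro v
    have := hR (e.symm v) X
    rw [hsymm] at this
    rw [hconj]
    refine le_trans (le_of_eq ?_) this
    ring
  · intro v
    have := hHψ (e.symm v)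
    rw [hsymm] at this
    rw [hconj]
    exact (hGH _ _).trans_le this
  · have h1 : ‖e Y‖ ^ 2 ≤ a * ‖e Y‖ := by
      rw [← hnormsq, h.apply_gradOf]
      exact (le_abs_self _).trans (hdψ Y)
    -- The bound `|Y|² ≤ a |Y|` can be divided by `|Y|` unless `Y = 0`. In that case `a ≥ 0` is
    -- needed, which follows from the bound on `dψ` at the nonzero vector `X`.
    rcases (norm_nonneg (e Y)).eq_or_lt with h0 | h0
    · have h2 := hdψ X
      rw [← h0]
      by_contra! hneg
      have : a * ‖e X‖ < 0 := mul_neg_of_neg_of_pos hneg (by linarith)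
      linarith [abs_nonneg (fderiv ℝ ψ y X)]
    · exact le_of_mul_le_mul_right (by rwa [← sq]) h0
  · have h1 : |graphTraceOf G u P y| ≤ P₀ * Module.finrank ℝ V := by
      rw [hQeq]
      refine abs_formTrace_le _ hP₀ fun v ↦ ?_
      have := hp (e.symm v) (e.symm v)
      rw [hsymm] at this
      refine le_trans (le_of_eq ?_) (this.trans_eq (by ring))
      rfl
    refine (abs_sub _ _).trans (add_le_add ?_ h1)
    rwa [abs_mul, abs_of_nonneg ht]
  · rw [formTrace_opForm, ht1, ← hW2', hW2, hconj]
    have := hJ.self_of_nhds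
    rw [JangEquationOf, traceL_apply] at this
    simpa using this
  · have := h.fderiv_jang hu hP hPs hJ rfl rfl rfl rfl
    rw [hσ, ht1, hM, hcX, ← he, ← hnormsq, hDtr, ← hnormsq, ← he, hpapp, hpapp]
    exact this
  · rw [hσ]
    have : (1 / W ^ 2) • S X + (N / φ y) • ((1 / T) • X - Y) = 0 := by
      refine h.ext fun z ↦ ?_
      have h1 := hcrit z
      rw [hdφ] at h1
      simp only [map_add, map_sub, map_smul, add_apply, sub_apply, smul_apply, smul_eq_mul,
        h.apply_gradOf, hX, hY, map_zero, zero_apply] at h1 ⊢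
      rw [hW2, ← h1]
      ring
    have h2 := congrArg e this
    simpa using h2
  · intro v
    have h1 := hsecond (e.symm v)
    rw [h.bochner (h.contDiffAt_gradOf hu), hHφ, hdφ] at h1
    rw [hM, hσ, hconj, hconj, hconj]
    have e1 : inner ℝ (e (S X)) v = G y (S X) (e.symm v) := by rw [he, hsymm]
    have e2 : inner ℝ ((1 / T) • e X - e Y) v =
        T⁻¹ * fderiv ℝ u y (e.symm v) - fderiv ℝ ψ y (e.symm v) := by
      rw [inner_sub_left, inner_smul_left, ← h.apply_gradOf u, ← h.apply_gradOf ψ, he, he, hsymm]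
      simp [hX, hY]
    rw [e1, e2, hW2, hW4]
    simp only [sub_apply, smul_apply, smul_eq_mul, ← hGH] at h1
    exact h1

end IsMetricAt

end MaximumEstimate

end Jang

end


noncomputable section

open Filter Topology

set_option maxSynthPendingDepth 3
set_option synthInstance.maxHeartbeats 200000

namespace Jang

/-! ### The choice of the exponent and the gradient estimate in normal coordinates. -/

section GradientEstimate

/-- With `s = P₀ + P₁ + Θ + κ` and `B` the square without its last factor, multiplying by `16 T²`
turns the left side into at most `64 B + (28/3 + 72) s B`. The right side is at least `80 B + 160 s
B - 1`, and `B ≥ 1`. -/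
theorem exponent_bound {n T ρ P₀ P₁ Θ κ : ℝ} (hn : 0 ≤ n) (hT : 0 < T) (hρ : 0 < ρ) (hP₀ : 0 ≤ P₀)
    (hP₁ : 0 ≤ P₁) (hΘ : 0 ≤ Θ) (hκ : 0 ≤ κ) :
    n * (κ + P₁ + (16 / ρ ^ 2 + 4 / 3 * κ)) + (Θ + P₀ * n + 2 * P₀) * (1 / T + 8 / ρ) <
      (80 * ((n + 1) * (1 + T) * (1 + 1 / ρ) * (1 + P₀ + P₁ + Θ + κ)) ^ 2 - 1) / (16 * T ^ 2) := by
  set s := P₀ + P₁ + Θ + κ with hs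
  set R := 1 / ρ with hR
  have hs0 : 0 ≤ s := by positivity
  have hR0 : 0 < R := by positivity
  have e1 : 16 / ρ ^ 2 = 16 * R ^ 2 := by rw [hR]; field_simp
  have e2 : 8 / ρ = 8 * R := by rw [hR]; field_simp
  have e3 : 1 + P₀ + P₁ + Θ + κ = 1 + s := by rw [hs]; ring
  rw [e1, e2, e3, lt_div_iff₀ (by positivity)]
  set B := ((n + 1) * (1 + T) * (1 + R)) ^ 2 with hB
  have hB1 : 1 ≤ B := by
    refine one_le_pow₀ ?_
    have h1 : 1 ≤ (n + 1) * (1 + T) := one_le_mul_of_one_le_of_one_le (by linarith) (by linarith)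
    exact one_le_mul_of_one_le_of_one_le h1 (by linarith)
  have hA : B = (n + 1) ^ 2 * ((1 + T) ^ 2 * (1 + R) ^ 2) := by rw [hB]; ring
  set Z := (1 + T) ^ 2 * (1 + R) ^ 2 with hZ
  have hn1 : 4 * n ≤ (n + 1) ^ 2 := by nlinarith only [sq_nonneg (n - 1)]
  have hn2 : n + 2 ≤ 2 * (n + 1) ^ 2 := by nlinarith only [hn, sq_nonneg n]
  have hT2 : T ^ 2 ≤ (1 + T) ^ 2 := pow_le_pow_left₀ hT.le (by linarith) 2
  have hT2R2 : T ^ 2 * R ^ 2 ≤ Z := mul_le_mul hT2 (pow_le_pow_left₀ hR0.le (by linarith) 2)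
    (by positivity) (by positivity)
  have h1R : 1 ≤ (1 + R) ^ 2 := one_le_pow₀ (by linarith)
  have h4R : 4 * R ≤ (1 + R) ^ 2 := by nlinarith only [sq_nonneg (1 - R)]
  have h4T : 4 * T ≤ (1 + T) ^ 2 := by nlinarith only [sq_nonneg (1 - T)]
  have hT2' : T ^ 2 ≤ Z := by
    have := mul_le_mul hT2 h1R zero_le_one (by positivity)
    rwa [mul_one] at this
  have hT1 : 4 * T ≤ Z := by
    have := mul_le_mul h4T h1R zero_le_one (by positivity)
    rwa [mul_one] at this
  have hT2R : 4 * (T ^ 2 * R) ≤ Z := by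
    have := mul_le_mul hT2 h4R (by positivity) (by positivity)
    refine le_trans (le_of_eq ?_) this
    ring
  have hZ0 : 0 ≤ Z := by positivity
  have rhs : ((n + 1) * (1 + T) * (1 + R) * (1 + s)) ^ 2 = B * (1 + s) ^ 2 := by rw [hB]; ring
  clear_value Z B s R
  clear hZ hB
  -- the three groups of terms
  have g1 : 256 * (n * (T ^ 2 * R ^ 2)) ≤ 64 * B := by
    rw [hA]
    have := mul_le_mul hn1 hT2R2 (by positivity) (by positivity)
    linarith
  have g2 : (κ + P₁ + 4 / 3 * κ) * (16 * (n * T ^ 2)) ≤ 7 / 3 * s * (4 * B) := by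
    have h1 : κ + P₁ + 4 / 3 * κ ≤ 7 / 3 * s := by rw [hs]; linarith
    have h2 : 16 * (n * T ^ 2) ≤ 4 * B := by
      rw [hA]
      have := mul_le_mul hn1 hT2' (by positivity) (by positivity)
      linarith
    exact mul_le_mul h1 h2 (by positivity) (by positivity)
  have g3 : (Θ + P₀ * n + 2 * P₀) * (16 * T + 128 * (T ^ 2 * R)) ≤ s * (72 * B) := by
    have h1 : Θ + P₀ * n + 2 * P₀ ≤ s * (n + 2) := by
      rw [hs]
      have : 0 ≤ P₁ * (n + 2) := by positivity
      have : 0 ≤ κ * (n + 2) := by positivity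
      have : 0 ≤ Θ * (n + 1) := by positivity
      linarith
    have h2 : 16 * T + 128 * (T ^ 2 * R) ≤ 36 * Z := by linarith
    have h3 : (n + 2) * (36 * Z) ≤ 72 * B := by
      rw [hA]
      have := mul_le_mul_of_nonneg_right hn2 hZ0
      linarith
    calc _ ≤ s * (n + 2) * (36 * Z) := mul_le_mul h1 h2 (by positivity) (by positivity)
      _ = s * ((n + 2) * (36 * Z)) := by ring
      _ ≤ _ := mul_le_mul_of_nonneg_left h3 hs0
  have lhs : (n * (κ + P₁ + (16 * R ^ 2 + 4 / 3 * κ)) + (Θ + P₀ * n + 2 * P₀) * (1 / T + 8 * R))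
      * (16 * T ^ 2) = 256 * (n * (T ^ 2 * R ^ 2)) + (κ + P₁ + 4 / 3 * κ) * (16 * (n * T ^ 2))
        + (Θ + P₀ * n + 2 * P₀) * (16 * T + 128 * (T ^ 2 * R)) := by
    field_simp
    ring
  rw [lhs, rhs]
  have h1 : B * (1 + 2 * s) ≤ B * (1 + s) ^ 2 :=
    mul_le_mul_of_nonneg_left (by nlinarith only [sq_nonneg s]) (by linarith)
  have h2 : 0 ≤ s * B := by positivity
  linarith

variable {E : Type*} [NormedAddCommGroup E] [InnerProductSpace ℝ E] [FiniteDimensional ℝ E]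

namespace IsNormalMetric

variable {G P : E → E →L[ℝ] E →L[ℝ] ℝ} {u : E → ℝ} {ρ t T P₀ P₁ Θ κ : ℝ}

/-- By the Gauss lemma the gradient of `|z|²` is `2 z`, whose `G`-length at `q` is `2 |q| ≤ ρ`. -/
theorem abs_fderiv_cutoff_le (h : IsNormalMetric G ρ) (hρ : 0 < ρ) {q : E}
    (hq' : q ∈ Metric.ball (0 : E) ρ) (hqnorm : ‖q‖ ≤ ρ / 2) (v : E) :
    |fderiv ℝ (fun z : E ↦ (8 / ρ ^ 2) * ‖z‖ ^ 2) q v| ≤ 8 / ρ * √(G q v v) := by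
  have hm := h.isMetricAt q hq'
  have e1 : fderiv ℝ (fun z : E ↦ (8 / ρ ^ 2) * ‖z‖ ^ 2) q v = 16 / ρ ^ 2 * G q q v := by
    have := ((hasStrictFDerivAt_norm_sq q).hasFDerivAt.const_mul (8 / ρ ^ 2)).fderiv
    rw [this, h.gauss hq']
    simp
    ring
  have hcs : |G q q v| ≤ ‖q‖ * √(G q v v) := by
    obtain ⟨V, _, _, e, he⟩ := hm.exists_isometry
    have e2 : ‖q‖ = ‖e q‖ := by
      have := h.apply_self_self hq'
      rw [he, real_inner_self_eq_norm_sq, real_inner_self_eq_norm_sq] at this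
      exact ((sq_eq_sq₀ (norm_nonneg _) (norm_nonneg _)).1 this).symm
    rw [he, he, e2, real_inner_self_eq_norm_sq, Real.sqrt_sq (norm_nonneg _)]
    exact abs_real_inner_le_norm _ _
  rw [e1, abs_mul, abs_of_pos (by positivity)]
  calc 16 / ρ ^ 2 * |G q q v| ≤ 16 / ρ ^ 2 * (ρ / 2 * √(G q v v)) :=
        mul_le_mul_of_nonneg_left
          (hcs.trans (mul_le_mul_of_nonneg_right hqnorm (Real.sqrt_nonneg _))) (by positivity)
    _ = _ := by
        field_simp
        ring

/-- Hessian comparison with `|q| ≤ ρ / 2`; the factor `1 / ρ²` of the cutoff cancels against `|q|²`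
in the curvature term. -/
theorem hessianOf_cutoff_le (h : IsNormalMetric G ρ) (hρ : 0 < ρ) (hκ : 0 ≤ κ)
    (hR : ∀ y ∈ Metric.ball (0 : E) ρ, ∀ v w,
      -(κ * G y v v * G y w w) ≤ G y (curvatureOf G y v w w) v) {q : E}
    (hq' : q ∈ Metric.ball (0 : E) ρ) (hqnorm : ‖q‖ ≤ ρ / 2) (v : E) :
    hessianOf G (fun z : E ↦ (8 / ρ ^ 2) * ‖z‖ ^ 2) q v v ≤
      (16 / ρ ^ 2 + 4 / 3 * κ) * G q v v := by
  have hm := h.isMetricAt q hq'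
  have e1 : hessianOf G (fun z : E ↦ (8 / ρ ^ 2) * ‖z‖ ^ 2) q v v =
      8 / ρ ^ 2 * hessianOf G (fun z ↦ ‖z‖ ^ 2) q v v := by
    have e2 : fderiv ℝ (fun z : E ↦ (8 / ρ ^ 2) * ‖z‖ ^ 2) =
        fun z ↦ (8 / ρ ^ 2) • fderiv ℝ (fun z : E ↦ ‖z‖ ^ 2) z := by
      ext z : 1
      exact fderiv_const_mul ((contDiff_norm_sq ℝ (n := 1)).differentiable (by simp) z) _
    have e3 : DifferentiableAt ℝ (fderiv ℝ (fun z : E ↦ ‖z‖ ^ 2)) q :=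
      ((contDiff_norm_sq ℝ (n := 2)).contDiffAt.fderiv_right (m := 1) (by norm_num)).differentiableAt
        (by simp)
    rw [hessianOf, hessianOf, e2, fderiv_fun_const_smul e3]
    simp only [smul_apply, smul_eq_mul]
    ring
  rw [e1, h.hessianOf_norm_sq hq']
  have h1 := h.comparison hq' hκ hR v
  have h2 := hm.nonneg v
  have h3 : κ * ‖q‖ ^ 2 / 3 * G q v v ≤ κ * (ρ / 2) ^ 2 / 3 * G q v v := by gcongr
  calc 8 / ρ ^ 2 * (2 * (G q v v + G q (christoffelL G q v q) v))
      ≤ 8 / ρ ^ 2 * (2 * (G q v v + κ * (ρ / 2) ^ 2 / 3 * G q v v)) :=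
        mul_le_mul_of_nonneg_left (by linarith) (by positivity)
    _ = (16 / ρ ^ 2 + 4 / 3 * κ) * G q v v := by
        field_simp
        ring

set_option maxHeartbeats 400000 in
theorem gradient_estimate (h : IsNormalMetric G ρ) (hρ : 0 < ρ) (ht : 0 ≤ t) (hT : 0 < T)
    (hP₀ : 0 ≤ P₀) (hP₁ : 0 ≤ P₁) (hΘ : 0 ≤ Θ) (hκ : 0 ≤ κ)
    (hP : ∀ y ∈ Metric.ball (0 : E) ρ, DifferentiableAt ℝ P y)
    (hPs : ∀ y ∈ Metric.ball (0 : E) ρ, ∀ v w, P y v w = P y w v)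
    (hu : ∀ y ∈ Metric.ball (0 : E) ρ, ContDiffAt ℝ 3 u y)
    (hJ : ∀ y ∈ Metric.ball (0 : E) ρ, JangEquationOf G P t u y)
    (hosc : ∀ y ∈ Metric.ball (0 : E) ρ, u y ≤ u 0 + T)
    (hp : ∀ y ∈ Metric.ball (0 : E) ρ, ∀ v w, |P y v w| ≤ P₀ * √(G y v v) * √(G y w w))
    (hDp : ∀ y ∈ Metric.ball (0 : E) ρ, ∀ z v w,
      |covDerivOf G P y z v w| ≤ P₁ * √(G y z z) * √(G y v v) * √(G y w w))
    (hR : ∀ y ∈ Metric.ball (0 : E) ρ, ∀ v w,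
      -(κ * G y v v * G y w w) ≤ G y (curvatureOf G y v w w) v)
    (htu : ∀ y ∈ Metric.ball (0 : E) ρ, t * |u y| ≤ Θ) :
    √(G 0 (gradOf G u 0) (gradOf G u 0)) ≤ Real.exp (100 * ((Module.finrank ℝ E + 1) * (1 + T)
      * (1 + 1 / ρ) * (1 + P₀ + P₁ + Θ + κ)) ^ 2) := by
  set n : ℝ := ((Module.finrank ℝ E : ℕ) : ℝ) with hn
  have hn0 : 0 ≤ n := by positivity
  set K := ((n + 1) * (1 + T) * (1 + 1 / ρ) * (1 + P₀ + P₁ + Θ + κ)) ^ 2 with hK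
  set N := 80 * K with hN
  have hR0 : 0 < 1 / ρ := by positivity
  have hKlow : 1 + T / ρ ≤ K := by
    have h1 : 1 + T / ρ ≤ (1 + T) * (1 + 1 / ρ) := by
      have : (1 + T) * (1 + 1 / ρ) = 1 + T / ρ + T + 1 / ρ := by ring
      linarith
    have h2 : (1 + T) * (1 + 1 / ρ) ≤ (n + 1) * (1 + T) * (1 + 1 / ρ) * (1 + P₀ + P₁ + Θ + κ) := by
      have h3 : 1 ≤ (n + 1) * (1 + P₀ + P₁ + Θ + κ) :=
        one_le_mul_of_one_le_of_one_le (by linarith) (by linarith)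
      calc (1 + T) * (1 + 1 / ρ) ≤ ((n + 1) * (1 + P₀ + P₁ + Θ + κ)) * ((1 + T) * (1 + 1 / ρ)) :=
            le_mul_of_one_le_left (by positivity) h3
        _ = _ := by ring
    have h4 : 0 ≤ T / ρ := by positivity
    calc 1 + T / ρ ≤ (n + 1) * (1 + T) * (1 + 1 / ρ) * (1 + P₀ + P₁ + Θ + κ) := h1.trans h2
      _ ≤ K := le_self_pow₀ (by linarith) (by norm_num)
  have hTρ : 0 ≤ T / ρ := by positivity
  have hK1 : 1 ≤ K := by linarith only [hTρ, hKlow]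
  have hexp := exponent_bound hn0 hT hρ hP₀ hP₁ hΘ hκ
  rw [← hK, ← hN] at hexp
  have hN0 : 0 < N := by linarith only [hN, hK1]
  have hK0 : 0 < K := by linarith only [hK1]
  clear_value K N
  clear hK
  set ψ : E → ℝ := fun z ↦ (8 / ρ ^ 2) * ‖z‖ ^ 2 with hψ
  set c := 1 - u 0 / T with hc
  set φ : E → ℝ := fun z ↦ u z / T + c - ψ z with hφ
  have hsub : Metric.closedBall (0 : E) (ρ / 2) ⊆ Metric.ball 0 ρ :=
    Metric.closedBall_subset_ball (half_lt_self hρ)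
  have hφ2 : ∀ z ∈ Metric.ball (0 : E) ρ, φ z ≤ 2 - (8 / ρ ^ 2) * ‖z‖ ^ 2 := by
    intro z hz
    have : u z / T ≤ u 0 / T + 1 := by
      rw [div_add_one hT.ne']
      exact div_le_div_of_nonneg_right (hosc z hz) hT.le
    simp only [hφ, hc, hψ]
    linarith only [this]
  have hψC : ContDiff ℝ 2 ψ := contDiff_const.mul (contDiff_norm_sq ℝ)
  -- Truncating `φ` at zero makes the test function continuous on the closed ball. It is positive at
  -- the origin, so its maximum point satisfies `φ > 0`.
  set g : E → ℝ := fun z ↦ √(areaSq G u z) * (max (φ z) 0) ^ N with hg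
  have hcont : ContinuousOn g (Metric.closedBall 0 (ρ / 2)) := by
    intro z hz
    have hz' := hsub hz
    have c1 : ContinuousAt (areaSq G u) z :=
      ((h.isMetricAt z hz').contDiffAt_areaSq (hu z hz')).continuousAt
    have c2 : ContinuousAt φ z :=
      (((hu z hz').continuousAt.div_const T).add continuousAt_const).sub hψC.continuous.continuousAt
    exact (c1.sqrt.mul ((c2.max continuousAt_const).rpow_const
      (Or.inr (by positivity)))).continuousWithinAt
  obtain ⟨q, hq, hqmax⟩ := (isCompact_closedBall (0 : E) (ρ / 2)).exists_isMaxOn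
    ⟨0, Metric.mem_closedBall_self (by positivity)⟩ hcont
  have hq' := hsub hq
  have h0 : (0 : E) ∈ Metric.ball (0 : E) ρ := Metric.mem_ball_self hρ
  have hφ0 : φ 0 = 1 := by simp [hφ, hc, hψ]
  have hg0 : g 0 = √(areaSq G u 0) := by simp [hg, hφ0]
  have hgq : √(areaSq G u 0) ≤ g q := by
    rw [← hg0]
    exact hqmax (Metric.mem_closedBall_self (by positivity))
  have hφq : 0 < φ q := by
    by_contra! hle
    have : g q = 0 := by
      simp only [hg]
      rw [max_eq_right hle, Real.zero_rpow (by positivity), mul_zero]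
    have h1 := Real.sqrt_pos.2 ((h.isMetricAt 0 h0).areaSq_pos (u := u))
    linarith only [h1, this, hgq]
  -- The constant `8` in the cutoff is chosen so that `2 - 8 |z|² / ρ²` vanishes on the sphere of
  -- radius `ρ / 2`, where therefore `φ ≤ 0`.
  have hqball : q ∈ Metric.ball (0 : E) (ρ / 2) := by
    rw [mem_ball_zero_iff]
    by_contra! hge
    have h1 := hφ2 q hq'
    have h2 : 8 / ρ ^ 2 * (ρ / 2) ^ 2 ≤ 8 / ρ ^ 2 * ‖q‖ ^ 2 := by gcongr
    have h3 : 8 / ρ ^ 2 * (ρ / 2) ^ 2 = 2 := by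
      field_simp
      norm_num
    linarith only [h1, h2, h3, hφq]
  have hm := h.isMetricAt q hq'
  have hqnorm : ‖q‖ ≤ ρ / 2 := by simpa using hq
  have hlogmax : IsLocalMax (fun z ↦ 1 / 2 * Real.log (areaSq G u z)
      + N * Real.log (u z / T + c - ψ z)) q := by
    have c2 : ContinuousAt φ q :=
      (((hu q hq').continuousAt.div_const T).add continuousAt_const).sub hψC.continuous.continuousAt
    have hlog {z : E} (hmz : IsMetricAt G z) (hz : 0 < φ z) :
        1 / 2 * Real.log (areaSq G u z) + N * Real.log (φ z) = Real.log (g z) := by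
      have h1 := hmz.areaSq_pos (u := u)
      simp only [hg]
      rw [max_eq_left hz.le, Real.log_mul (Real.sqrt_pos.2 h1).ne' (Real.rpow_pos_of_pos hz _).ne',
        Real.log_sqrt h1.le, Real.log_rpow hz]
      ring
    have : ∀ᶠ z in 𝓝 q, 1 / 2 * Real.log (areaSq G u z) + N * Real.log (φ z) ≤
        1 / 2 * Real.log (areaSq G u q) + N * Real.log (φ q) := by
      filter_upwards [hm.eventually, c2.eventually (lt_mem_nhds hφq),
        Metric.isOpen_ball.mem_nhds hqball] with z h1 h2 h3
      rw [hlog h1 h2, hlog hm hφq]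
      refine Real.log_le_log ?_ (hqmax (Metric.ball_subset_closedBall h3))
      simp only [hg]
      rw [max_eq_left h2.le]
      exact mul_pos (Real.sqrt_pos.2 h1.areaSq_pos) (Real.rpow_pos_of_pos h2 _)
    exact this
  have hJq : ∀ᶠ z in 𝓝 q, JangEquationOf G P t u z := by
    filter_upwards [Metric.isOpen_ball.mem_nhds hq'] with z hz using hJ z hz
  have hφq2 : φ q ≤ 2 := by
    have h1 : 0 ≤ 8 / ρ ^ 2 * ‖q‖ ^ 2 := by positivity
    linarith only [hφ2 q hq', h1]
  have hdψ := h.abs_fderiv_cutoff_le hρ hq' hqnorm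
  have hHψ := h.hessianOf_cutoff_le hρ hκ hR hq' hqnorm
  -- Above this threshold both largeness conditions `|X| ≥ 1` and `|X| ≥ 2 T · 8 / ρ` of
  -- `maximum_estimate` hold, and its conclusion contradicts `exponent_bound`.
  have hsmall : √(G q (gradOf G u q) (gradOf G u q)) ≤ 1 + 16 * (T / ρ) := by
    by_contra! hlarge
    have h1 : 2 * T * (8 / ρ) = 16 * (T / ρ) := by ring
    have := hm.maximum_estimate (hu q hq') hψC.contDiffAt (hP q hq') (hPs q hq') ht hT
      (N := N) (c := c) (by linarith only [hN, hK1]) hP₀ hP₁ hκ (by positivity) hJq (hp q hq') (hDp q hq') (hR q hq')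
      (htu q hq') hHψ hdψ
      (by linarith only [hlarge, hTρ]) (by linarith only [h1, hlarge]) hφq
      hφq2 hlogmax
    exact absurd hexp (not_lt.2 this)
  have hWq : √(areaSq G u q) ≤ 16 * K := by
    set b := √(G q (gradOf G u q) (gradOf G u q)) with hb
    have h1 : b ^ 2 = G q (gradOf G u q) (gradOf G u q) := Real.sq_sqrt (hm.nonneg _)
    have h2 : 0 ≤ b := Real.sqrt_nonneg _
    have h3 : √(areaSq G u q) ≤ 1 + b := by
      rw [Real.sqrt_le_left (by positivity), areaSq, ← h1]
      nlinarith only [h2]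
    linarith only [h3, hsmall, hKlow, hK1]
  -- `φ ≤ 2`, `N = 80 K` and `log 2 ≤ 0.7` give the exponent `56 K`.
  have hpow : (max (φ q) 0) ^ N ≤ Real.exp (56 * K) := by
    have h1 : max (φ q) 0 ≤ 2 := max_le hφq2 (by norm_num)
    calc (max (φ q) 0) ^ N ≤ 2 ^ N := Real.rpow_le_rpow (le_max_right _ _) h1 (by positivity)
      _ = Real.exp (Real.log 2 * N) := Real.rpow_def_of_pos (by norm_num) _
      _ ≤ Real.exp (56 * K) := by
        refine Real.exp_le_exp.2 ?_
        have h3 : Real.log 2 ≤ 0.7 := by linarith only [Real.log_two_lt_d9]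
        have h4 := mul_le_mul_of_nonneg_right h3 (show 0 ≤ N by positivity)
        linarith only [h4, hN]
  calc √(G 0 (gradOf G u 0) (gradOf G u 0)) ≤ √(areaSq G u 0) :=
        Real.sqrt_le_sqrt (by unfold areaSq; linarith only)
    _ ≤ √(areaSq G u q) * (max (φ q) 0) ^ N := hgq
    _ ≤ Real.exp (16 * K) * Real.exp (56 * K) := by
        refine mul_le_mul (hWq.trans ?_) hpow (by positivity) (by positivity)
        linarith only [Real.add_one_le_exp (16 * K)]
    _ = Real.exp (72 * K) := by rw [← Real.exp_add]; ring_nf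
    _ ≤ Real.exp (100 * K) := Real.exp_le_exp.2 (by linarith only [hK1])

end IsNormalMetric

end GradientEstimate

end Jang

end


noncomputable section

open Filter Topology

set_option maxSynthPendingDepth 3
set_option synthInstance.maxHeartbeats 200000

namespace Jang

/-! ### Pulling back fields of bilinear forms from the manifold to a vector space. -/

section Pullback

variable {n : ℕ} {M : Type*} [TopologicalSpace M] [ChartedSpace (Model n) M]
  {E E₁ : Type*} [NormedAddCommGroup E] [NormedSpace ℝ E]
  [NormedAddCommGroup E₁] [NormedSpace ℝ E₁]

/-- The differential of a map from a vector space to a manifold. -/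
def tangentFrame (n : ℕ) {M : Type*} [TopologicalSpace M] [ChartedSpace (Model n) M]
    (f : E → M) (y : E) : E →L[ℝ] Tan n (f y) :=
  mfderiv 𝓘(ℝ, E) (𝓡 n) f y

/-- The pullback of a field of bilinear forms to a vector space. -/
def pullForm (f : E → M) (B : ∀ q : M, Tan n q →L[ℝ] Tan n q →L[ℝ] ℝ) (y : E) :
    E →L[ℝ] E →L[ℝ] ℝ :=
  (ContinuousLinearMap.precomp ℝ (tangentFrame n f y)) ∘L (B (f y)) ∘L (tangentFrame n f y)

theorem pullForm_apply (f : E → M) (B : ∀ q : M, Tan n q →L[ℝ] Tan n q →L[ℝ] ℝ) (y v w : E) :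
    pullForm f B y v w = B (f y) (tangentFrame n f y v) (tangentFrame n f y w) := rfl

theorem pullForm_comp_apply {h : E₁ → M} {θ : E → E₁} {f : E → M} {y : E}
    (B : ∀ q : M, Tan n q →L[ℝ] Tan n q →L[ℝ] ℝ)
    (hh : MDifferentiableAt 𝓘(ℝ, E₁) (𝓡 n) h (θ y)) (hθ : DifferentiableAt ℝ θ y)
    (hf : f =ᶠ[𝓝 y] h ∘ θ) (v w : E) :
    pullForm f B y v w = pullForm h B (θ y) (fderiv ℝ θ y v) (fderiv ℝ θ y w) := by
  have h0 : f y = h (θ y) := hf.self_of_nhds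
  have h1 : mfderiv 𝓘(ℝ, E) (𝓡 n) f y = mfderiv 𝓘(ℝ, E) (𝓡 n) (h ∘ θ) y := hf.mfderiv_eq
  have h2 : mfderiv 𝓘(ℝ, E) (𝓡 n) (h ∘ θ) y
      = (mfderiv 𝓘(ℝ, E₁) (𝓡 n) h (θ y)).comp (mfderiv 𝓘(ℝ, E) 𝓘(ℝ, E₁) θ y) :=
    mfderiv_comp y hh hθ.mdifferentiableAt
  rw [mfderiv_eq_fderiv] at h2
  rw [pullForm_apply, pullForm_apply]
  have h3 (v : E) : tangentFrame n f y v = (tangentFrame n h (θ y) (fderiv ℝ θ y v) : Model n) := by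
    unfold tangentFrame
    exact congrArg (fun A : E →L[ℝ] Model n ↦ A v) (h1.trans h2)
  -- The base points `f y` and `h (θ y)` are equal only propositionally; the vectors are moved
  -- between the two tangent spaces through the common model space.
  have h4 (q q' : M) (hq : q = q') (a b : Model n) :
      B q (show Tan n q from a) (show Tan n q from b) = B q' (show Tan n q' from a) (show Tan n q' from b) := by
    subst hq; rfl
  have := h4 _ _ h0 (tangentFrame n f y v) (tangentFrame n f y w)
  refine this.trans ?_
  have h5 (a b a' b' : Tan n (h (θ y))) (h : a = a') (h' : b = b') : B _ a b = B _ a' b' := by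
    rw [h, h']
  exact h5 _ _ _ _ (h3 v) (h3 w)

variable [IsManifold (𝓡 n) ∞ M] 

theorem contMDiffOn_tangentFrame {f : E → M} {s : Set E} {m : ℕ} (hs : IsOpen s)
    (hf : ContMDiffOn 𝓘(ℝ, E) (𝓡 n) (m + 1) f s) (v : E) :
    ContMDiffOn 𝓘(ℝ, E) ((𝓡 n).prod 𝓘(ℝ, Model n)) m
      (fun y ↦ TotalSpace.mk' (Model n) (E := fun x : M ↦ TangentSpace (𝓡 n) x) (f y)
        (tangentFrame n f y v)) s := by
  intro y hy
  have hfy : ContMDiffAt 𝓘(ℝ, E) (𝓡 n) (m + 1) f y := (hf y hy).contMDiffAt (hs.mem_nhds hy)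
  have : IsManifold (𝓡 n) 1 M := IsManifold.of_le (n := ∞) (by simp)
  have h1 := hfy.mfderiv_const (m := m) le_rfl
  refine ContMDiffAt.contMDiffWithinAt ?_
  have h2 : ContMDiffAt 𝓘(ℝ, E) (𝓘(ℝ, E).prod 𝓘(ℝ, E)) m
      (fun y : E ↦ TotalSpace.mk' E (E := fun x : E ↦ TangentSpace 𝓘(ℝ, E) x) y v) y :=
    contMDiffAt_vectorSpace_iff_contDiffAt.2 contDiffAt_const
  exact ContMDiffAt.clm_apply_of_inCoordinates (IB₁ := 𝓘(ℝ, E)) (IB₂ := 𝓡 n)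
    (b₁ := fun y : E ↦ y) (b₂ := f)
    (E₁ := fun x : E ↦ TangentSpace 𝓘(ℝ, E) x) (E₂ := fun x : M ↦ TangentSpace (𝓡 n) x)
    (ϕ := fun y ↦ mfderiv 𝓘(ℝ, E) (𝓡 n) f y) (v := fun _ ↦ v) h1 h2 (hfy.of_le (by simp))

/-- A field of bilinear forms is of class `C^m`. -/
def IsSmoothForm (m : ℕ) (B : ∀ q : M, Tan n q →L[ℝ] Tan n q →L[ℝ] ℝ) : Prop :=
  ContMDiff (𝓡 n) ((𝓡 n).prod 𝓘(ℝ, Model n →L[ℝ] Model n →L[ℝ] ℝ)) m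
    (fun x ↦ TotalSpace.mk' (Model n →L[ℝ] Model n →L[ℝ] ℝ)
      (E := fun x : M ↦ (TangentSpace (𝓡 n) x →L[ℝ] TangentSpace (𝓡 n) x →L[ℝ] ℝ)) x (B x))

theorem contDiffOn_pullForm [FiniteDimensional ℝ E] {f : E → M} {s : Set E} {m : ℕ} (hs : IsOpen s)
    (hf : ContMDiffOn 𝓘(ℝ, E) (𝓡 n) (m + 1) f s)
    {B : ∀ q : M, Tan n q →L[ℝ] Tan n q →L[ℝ] ℝ} (hB : IsSmoothForm m B) :
    ContDiffOn ℝ m (pullForm f B) s := by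
  refine contDiffOn_clm_apply.2 fun v ↦ contDiffOn_clm_apply.2 fun w ↦ ?_
  rw [← contMDiffOn_iff_contDiffOn]
  have : ContMDiffOn 𝓘(ℝ, E) ((𝓡 n).prod 𝓘(ℝ)) m
      (fun y ↦ TotalSpace.mk' ℝ (E := Bundle.Trivial M ℝ) (f y)
        (B (f y) (tangentFrame n f y v) (tangentFrame n f y w))) s := by
    apply ContMDiffOn.clm_bundle_apply₂ (F₁ := Model n) (F₂ := Model n)
    · exact (ContMDiff.comp_contMDiffOn hB (hf.of_le (by simp)) :)
    · exact contMDiffOn_tangentFrame hs hf v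
    · exact contMDiffOn_tangentFrame hs hf w
  intro y hy
  have h2 := this y hy
  simp only [contMDiffWithinAt_totalSpace] at h2
  exact h2.2

end Pullback

end Jang

end


noncomputable section

open Filter Topology

set_option maxSynthPendingDepth 3
set_option synthInstance.maxHeartbeats 200000

namespace Jang

/-! ### Parametrizations and the transfer of the geometric quantities. -/

section Parametrization

variable {n : ℕ} {M : Type*} [TopologicalSpace M] [ChartedSpace (Model n) M]
  {E : Type*} [NormedAddCommGroup E] [NormedSpace ℝ E]

/-- A smooth map from an open set of a vector space to a manifold, with bijective differentials. -/
structure IsParametrization (n : ℕ) {M : Type*} [TopologicalSpace M] [ChartedSpace (Model n) M]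
    (f : E → M) (s : Set E) : Prop where
  isOpen : IsOpen s
  contMDiffOn : ContMDiffOn 𝓘(ℝ, E) (𝓡 n) ∞ f s
  bijective : ∀ y ∈ s, Function.Bijective (tangentFrame n f y)

theorem _root_.IsLocalDiffeomorphOn.isParametrization {f : E → M} {s : Set E} (hs : IsOpen s)
    (hf : IsLocalDiffeomorphOn 𝓘(ℝ, E) (𝓡 n) ∞ f s) : IsParametrization n f s where
  isOpen := hs
  contMDiffOn := hf.contMDiffOn
  bijective y hy := ((hf ⟨y, hy⟩).mfderivToContinuousLinearEquiv (by simp)).bijective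

variable {f : E → M} {s : Set E} {y : E}

theorem IsParametrization.contMDiffAt (hf : IsParametrization n f s) (hy : y ∈ s) :
    ContMDiffAt 𝓘(ℝ, E) (𝓡 n) ∞ f y :=
  (hf.contMDiffOn y hy).contMDiffAt (hf.isOpen.mem_nhds hy)

variable [IsManifold (𝓡 n) ∞ M]

theorem isParametrization_extChartAt_symm (x : M) :
    IsParametrization n (extChartAt (𝓡 n) x).symm (extChartAt (𝓡 n) x).target where
  isOpen := isOpen_extChartAt_target x
  contMDiffOn := contMDiffOn_extChartAt_symm x
  bijective y hy := by
    have : IsManifold (𝓡 n) 1 M := IsManifold.of_le (n := ∞) (by simp)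
    have := isInvertible_mfderivWithin_extChartAt_symm (I := 𝓡 n) hy
    rw [ModelWithCorners.range_eq_univ, mfderivWithin_univ] at this
    exact this.bijective

theorem contDiffAt_comp_extChartAt_symm {u : M → ℝ} {m : ℕ} {x : M}
    (hu : ContMDiffAt (𝓡 n) 𝓘(ℝ, ℝ) m u x) :
    ContDiffAt ℝ m (u ∘ (extChartAt (𝓡 n) x).symm) (extChartAt (𝓡 n) x x) := by
  rw [← contMDiffAt_iff_contDiffAt]
  refine ContMDiffAt.comp _ (by rwa [extChartAt_to_inv])
    (((isParametrization_extChartAt_symm x).contMDiffAt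
      (mem_extChartAt_target x)).of_le (by exact_mod_cast le_top))

namespace IsParametrization


omit [IsManifold (𝓡 n) ∞ M] in
theorem mdifferentiableAt (hf : IsParametrization n f s) (hy : y ∈ s) :
    MDifferentiableAt 𝓘(ℝ, E) (𝓡 n) f y :=
  (hf.contMDiffAt hy).mdifferentiableAt (by simp)

theorem contDiffAt_pullForm [FiniteDimensional ℝ E] (hf : IsParametrization n f s) (hy : y ∈ s)
    {m : ℕ} {B : ∀ q : M, Tan n q →L[ℝ] Tan n q →L[ℝ] ℝ} (hB : IsSmoothForm m B) :
    ContDiffAt ℝ m (pullForm f B) y :=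
  (contDiffOn_pullForm hf.isOpen
    (hf.contMDiffOn.of_le (by exact_mod_cast le_top)) hB).contDiffAt (hf.isOpen.mem_nhds hy)

theorem contDiffAt_extChartAt_comp (hf : IsParametrization n f s) (hy : y ∈ s) {x : M}
    (hx : f y ∈ (extChartAt (𝓡 n) x).source) {m : ℕ} :
    ContDiffAt ℝ m (extChartAt (𝓡 n) x ∘ f) y := by
  rw [← contMDiffAt_iff_contDiffAt]
  have h1 : ContMDiffAt (𝓡 n) 𝓘(ℝ, Model n) m (extChartAt (𝓡 n) x) (f y) :=
    (contMDiffAt_extChartAt' (n := ∞) (by rwa [extChartAt_source] at hx)).of_le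
      (by exact_mod_cast le_top)
  exact h1.comp y ((hf.contMDiffAt hy).of_le (by exact_mod_cast le_top))

omit [IsManifold (𝓡 n) ∞ M] in
theorem eventuallyEq_comp (hf : IsParametrization n f s) (hy : y ∈ s) {x : M}
    (hx : f y ∈ (extChartAt (𝓡 n) x).source) :
    f =ᶠ[𝓝 y] (extChartAt (𝓡 n) x).symm ∘ (extChartAt (𝓡 n) x ∘ f) := by
  filter_upwards [(hf.contMDiffAt hy).continuousAt.eventually
    ((isOpen_extChartAt_source x).mem_nhds hx)] with z hz
  exact ((extChartAt (𝓡 n) x).left_inv hz).symm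

theorem pullForm_eq_chartForm (hf : IsParametrization n f s) (hy : y ∈ s) {x : M}
    (hx : f y ∈ (extChartAt (𝓡 n) x).source) (B : ∀ q : M, Tan n q →L[ℝ] Tan n q →L[ℝ] ℝ)
    (v w : E) :
    pullForm f B y v w = chartForm B x (extChartAt (𝓡 n) x (f y))
      (fderiv ℝ (extChartAt (𝓡 n) x ∘ f) y v) (fderiv ℝ (extChartAt (𝓡 n) x ∘ f) y w) :=
  pullForm_comp_apply (θ := extChartAt (𝓡 n) x ∘ f) B ((isParametrization_extChartAt_symm x).mdifferentiableAt
    ((extChartAt (𝓡 n) x).map_source hx))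
    ((hf.contDiffAt_extChartAt_comp hy hx (m := 1)).differentiableAt (by simp))
    (hf.eventuallyEq_comp hy hx) v w

theorem bijective_fderiv_extChartAt_comp (hf : IsParametrization n f s) (hy : y ∈ s) {x : M}
    (hx : f y ∈ (extChartAt (𝓡 n) x).source) :
    Function.Bijective (fderiv ℝ (extChartAt (𝓡 n) x ∘ f) y) := by
  have : IsManifold (𝓡 n) 1 M := IsManifold.of_le (n := ∞) (by simp)
  have hx' : f y ∈ (chartAt (Model n) x).source := by rwa [extChartAt_source] at hx
  have h1 : mfderiv 𝓘(ℝ, E) 𝓘(ℝ, Model n) (extChartAt (𝓡 n) x ∘ f) y =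
      (mfderiv (𝓡 n) 𝓘(ℝ, Model n) (extChartAt (𝓡 n) x) (f y)).comp
        (mfderiv 𝓘(ℝ, E) (𝓡 n) f y) :=
    mfderiv_comp y (mdifferentiableAt_extChartAt hx') (hf.mdifferentiableAt hy)
  rw [mfderiv_eq_fderiv] at h1
  rw [h1]
  exact (isInvertible_mfderiv_extChartAt hx).bijective.comp (hf.bijective y hy)

/-- Tangent vectors at a point are coordinate vectors in its own preferred chart, so the
differential of that chart there is the identity. This links the chart-based definitions with
pullbacks. -/
theorem fderiv_extChartAt_comp_self (hf : IsParametrization n f s) (hy : y ∈ s) (v : E) :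
    fderiv ℝ (extChartAt (𝓡 n) (f y) ∘ f) y v = tangentFrame n f y v := by
  have : IsManifold (𝓡 n) 1 M := IsManifold.of_le (n := ∞) (by simp)
  have h1 : mfderiv 𝓘(ℝ, E) 𝓘(ℝ, Model n) (extChartAt (𝓡 n) (f y) ∘ f) y =
      (mfderiv (𝓡 n) 𝓘(ℝ, Model n) (extChartAt (𝓡 n) (f y)) (f y)).comp
        (mfderiv 𝓘(ℝ, E) (𝓡 n) f y) :=
    mfderiv_comp y (mdifferentiableAt_extChartAt (mem_chart_source _ _)) (hf.mdifferentiableAt hy)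
  rw [mfderiv_eq_fderiv, mfderiv_extChartAt_self] at h1
  exact congrArg (fun A : E →L[ℝ] Model n ↦ A v) h1

end IsParametrization

section Metric

variable [RiemannianBundle (fun x : M ↦ TangentSpace (𝓡 n) x)]

/-- The pullback of the Riemannian metric to a vector space. -/
abbrev pullMetric (n : ℕ) {M : Type*} [TopologicalSpace M] [ChartedSpace (Model n) M]
    [RiemannianBundle (fun x : M ↦ TangentSpace (𝓡 n) x)] (f : E → M) (y : E) :
    E →L[ℝ] E →L[ℝ] ℝ :=
  pullForm f (metricForm (n := n)) y

omit [IsManifold (𝓡 n) ∞ M] in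
theorem pullMetric_self (f : E → M) (y v : E) :
    pullMetric n f y v v = ‖tangentFrame n f y v‖ ^ 2 := by
  refine (pullForm_apply f _ y v v).trans ?_
  exact real_inner_self_eq_norm_sq (F := Tan n (f y)) _

omit [IsManifold (𝓡 n) ∞ M] in
theorem pullMetric_symm (f : E → M) (y v w : E) :
    pullMetric n f y v w = pullMetric n f y w v :=
  real_inner_comm (F := Tan n (f y)) (tangentFrame n f y w) (tangentFrame n f y v)

variable [FiniteDimensional ℝ E]

theorem isSmoothForm_metricForm
    [IsContMDiffRiemannianBundle (𝓡 n) ∞ (Model n) (fun x : M ↦ TangentSpace (𝓡 n) x)]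
    (m : ℕ) : IsSmoothForm m (metricForm (n := n) (M := M)) := by
  obtain ⟨g, hg, hg'⟩ := IsContMDiffRiemannianBundle.exists_contMDiff (IB := 𝓡 n) (n := ∞)
    (F := Model n) (E := fun x : M ↦ TangentSpace (𝓡 n) x)
  have h : metricForm (n := n) (M := M) = g := by
    funext q
    ext v w
    exact hg' q v w
  rw [h]
  exact hg.of_le (by exact_mod_cast le_top)

variable [IsContMDiffRiemannianBundle (𝓡 n) ∞ (Model n) (fun x : M ↦ TangentSpace (𝓡 n) x)]

theorem IsParametrization.isMetricAt (hf : IsParametrization n f s) (hy : y ∈ s) :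
    IsMetricAt (pullMetric n f) y where
  contDiffAt := hf.contDiffAt_pullForm hy (isSmoothForm_metricForm 2)
  symm_nhds := Eventually.of_forall fun z v w ↦ pullMetric_symm f z v w
  pos_nhds := by
    filter_upwards [hf.isOpen.mem_nhds hy] with z hz v hv
    rw [pullMetric_self]
    have : tangentFrame n f z v ≠ 0 := fun h ↦
      hv ((hf.bijective z hz).1 (h.trans (map_zero _).symm))
    positivity

/-- Passing from a parametrization to a chart preserves the metric by construction. The transfer of
covariant derivative, curvature and Hessian thus reduces to naturality under isometries. -/
theorem IsParametrization.isIsometryAt (hf : IsParametrization n f s) (hy : y ∈ s) {x : M}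
    (hx : f y ∈ (extChartAt (𝓡 n) x).source) :
    IsIsometryAt (pullMetric n f) (chartMetric x) (extChartAt (𝓡 n) x ∘ f) y where
  left := hf.isMetricAt hy
  right := (isParametrization_extChartAt_symm x).isMetricAt ((extChartAt (𝓡 n) x).map_source hx)
  contDiffAt := hf.contDiffAt_extChartAt_comp hy hx
  pullback := by
    filter_upwards [hf.isOpen.mem_nhds hy, (hf.contMDiffAt hy).continuousAt.eventually
      ((isOpen_extChartAt_source x).mem_nhds hx)] with z hz hz' v w
    exact hf.pullForm_eq_chartForm hz hz' _ v w
  surjective := by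
    filter_upwards [hf.isOpen.mem_nhds hy, (hf.contMDiffAt hy).continuousAt.eventually
      ((isOpen_extChartAt_source x).mem_nhds hx)] with z hz hz'
    exact (hf.bijective_fderiv_extChartAt_comp hz hz').2

theorem isMetricAt_chartMetric {x : M} {z : Model n}
    (hz : z ∈ (extChartAt (𝓡 n) x).target) : IsMetricAt (chartMetric x) z :=
  (isParametrization_extChartAt_symm x).isMetricAt hz

theorem IsParametrization.covDerivForm_eq (hf : IsParametrization n f s) (hy : y ∈ s)
    {B : ∀ q : M, Tan n q →L[ℝ] Tan n q →L[ℝ] ℝ} (hB : IsSmoothForm 1 B) (z v w : E) :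
    covDerivForm B (f y) (tangentFrame n f y z) (tangentFrame n f y v) (tangentFrame n f y w) =
      covDerivOf (pullMetric n f) (pullForm f B) y z v w := by
  have hx := mem_extChartAt_source (I := 𝓡 n) (f y)
  have hx' := (extChartAt (𝓡 n) (f y)).map_source hx
  have hB₂ : DifferentiableAt ℝ (chartForm B (f y)) (extChartAt (𝓡 n) (f y) (f y)) :=
    ((isParametrization_extChartAt_symm (f y)).contDiffAt_pullForm hx' hB).differentiableAt
      (by simp)
  rw [(hf.isIsometryAt hy hx).covDerivOf_eq
    ((hf.contDiffAt_pullForm hy hB).differentiableAt (by simp)) hB₂]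
  · simp only [hf.fderiv_extChartAt_comp_self hy, covDerivOf, covDerivForm, christoffel,
      Function.comp_apply]
    congr 2
    exact fderiv_apply_const₂ hB₂ _ _ _
  · filter_upwards [hf.isOpen.mem_nhds hy, (hf.contMDiffAt hy).continuousAt.eventually
      ((isOpen_extChartAt_source (f y)).mem_nhds hx)] with z hz hz' v w
    exact hf.pullForm_eq_chartForm hz hz' _ v w

theorem IsParametrization.curvature_eq (hf : IsParametrization n f s) (hy : y ∈ s) (v w z : E) :
    curvature (f y) (tangentFrame n f y v) (tangentFrame n f y w) (tangentFrame n f y z) =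
      tangentFrame n f y (curvatureOf (pullMetric n f) y v w z) := by
  have hx := mem_extChartAt_source (I := 𝓡 n) (f y)
  have hx' := (extChartAt (𝓡 n) (f y)).map_source hx
  have hΓ := (isMetricAt_chartMetric hx').contDiffAt_christoffelL.differentiableAt (by simp)
  have key := (hf.isIsometryAt hy hx).curvatureOf_eq v w z
  simp only [hf.fderiv_extChartAt_comp_self hy, Function.comp_apply] at key
  rw [key]
  simp only [curvature, curvatureOf, christoffel]
  congr 3 <;> exact fderiv_apply_const₂ hΓ _ _ _

theorem IsParametrization.hessian_eq (hf : IsParametrization n f s) (hy : y ∈ s) {u : M → ℝ}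
    (hu : ContMDiffAt (𝓡 n) 𝓘(ℝ, ℝ) 2 u (f y)) (v w : E) :
    hessian n u (f y) (tangentFrame n f y v) (tangentFrame n f y w) =
      hessianOf (pullMetric n f) (u ∘ f) y v w := by
  have hx := mem_extChartAt_source (I := 𝓡 n) (f y)
  have key := (hf.isIsometryAt hy hx).hessianOf_comp (contDiffAt_comp_extChartAt_symm hu) v w
  have h1 : (u ∘ (extChartAt (𝓡 n) (f y)).symm) ∘ (extChartAt (𝓡 n) (f y) ∘ f) =ᶠ[𝓝 y] u ∘ f := by
    filter_upwards [hf.eventuallyEq_comp hy hx] with z hz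
    simp only [Function.comp_apply] at hz ⊢
    rw [← hz]
  simp only [hf.fderiv_extChartAt_comp_self hy, Function.comp_apply] at key
  have h2 : hessianOf (pullMetric n f) (u ∘ f) y v w = hessianOf (pullMetric n f)
      ((u ∘ (extChartAt (𝓡 n) (f y)).symm) ∘ (extChartAt (𝓡 n) (f y) ∘ f)) y v w := by
    simp only [hessianOf, h1.fderiv_eq, h1.fderiv.fderiv_eq]
  rw [h2, key]
  simp only [hessian, hessianOf, christoffel]
  exact congrArg (_ - fderiv ℝ _ _ ·) (christoffelL_apply _ _ _ _).symm

theorem IsParametrization.tangentFrame_gradOf (hf : IsParametrization n f s) (hy : y ∈ s) {u : M → ℝ}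
    (hu : MDifferentiableAt (𝓡 n) 𝓘(ℝ, ℝ) u (f y)) :
    tangentFrame n f y (gradOf (pullMetric n f) (u ∘ f) y) = grad n u (f y) := by
  refine ext_inner_right ℝ fun w ↦ ?_
  obtain ⟨w, rfl⟩ := (hf.bijective y hy).2 w
  have h1 := (hf.isMetricAt hy).apply_gradOf (u ∘ f) w
  have h2 : mfderiv 𝓘(ℝ, E) 𝓘(ℝ, ℝ) (u ∘ f) y = (mfderiv (𝓡 n) 𝓘(ℝ, ℝ) u (f y)).comp
        (mfderiv 𝓘(ℝ, E) (𝓡 n) f y) := mfderiv_comp y hu (hf.mdifferentiableAt hy)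
  rw [mfderiv_eq_fderiv] at h2
  exact (h1.trans (congrArg (fun A : E →L[ℝ] ℝ ↦ A w) h2)).trans
    (InnerProductSpace.toDual_symm_apply (E := Tan n (f y))
      (x := tangentFrame n f y w) (y := mfderiv (𝓡 n) 𝓘(ℝ, ℝ) u (f y))).symm

end Metric

end Parametrization

end Jang

end


noncomputable section

open Filter Topology

set_option maxSynthPendingDepth 3
set_option synthInstance.maxHeartbeats 200000

namespace Jang

/-! ### Covariant acceleration and local uniqueness for the geodesic equation. -/

section Acceleration

variable {E E₁ E₂ : Type*} [NormedAddCommGroup E] [NormedSpace ℝ E]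
  [NormedAddCommGroup E₁] [NormedSpace ℝ E₁] [NormedAddCommGroup E₂] [NormedSpace ℝ E₂]

theorem contDiffAt_deriv {c : ℝ → E} {τ : ℝ} (hc : ContDiffAt ℝ 2 c τ) :
    ContDiffAt ℝ 1 (deriv c) τ := by
  have : deriv c = fun σ ↦ fderiv ℝ c σ 1 := by
    funext σ
    exact fderiv_apply_one_eq_deriv.symm
  rw [this]
  exact (hc.fderiv_right (m := 1) (by norm_num)).clm_apply contDiffAt_const

/-- The covariant acceleration of a curve in an open subset of a vector space. -/
def acceleration (G : E → E →L[ℝ] E →L[ℝ] ℝ) (c : ℝ → E) (τ : ℝ) : E :=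
  deriv (deriv c) τ + christoffelL G (c τ) (deriv c τ) (deriv c τ)

theorem acceleration_comp_mul (G : E → E →L[ℝ] E →L[ℝ] ℝ) (c : ℝ → E) (a τ : ℝ) :
    acceleration G (fun σ ↦ c (a * σ)) τ = (a * a) • acceleration G c (a * τ) := by
  have h1 : deriv (fun σ ↦ c (a * σ)) = fun σ ↦ a • deriv c (a * σ) := by
    funext σ
    exact deriv_comp_mul_left a c σ
  have h2 : deriv (fun σ ↦ a • deriv c (a * σ)) τ = a • a • deriv (deriv c) (a * τ) := by
    rw [deriv_fun_const_smul_field, deriv_comp_mul_left a (deriv c) τ]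
  simp only [acceleration, h1, h2, map_smul, smul_apply, smul_add, mul_smul]

variable [FiniteDimensional ℝ E₁] [FiniteDimensional ℝ E₂]

/-- The term `D²θ(c', c')` of the chain rule cancels the inhomogeneous term in the transformation
law of `Γ`. -/
theorem IsIsometryAt.acceleration_comp {G₁ : E₁ → E₁ →L[ℝ] E₁ →L[ℝ] ℝ}
    {G₂ : E₂ → E₂ →L[ℝ] E₂ →L[ℝ] ℝ} {θ : E₁ → E₂} {c : ℝ → E₁} {τ : ℝ}
    (h : IsIsometryAt G₁ G₂ θ (c τ)) (hc : ContDiffAt ℝ 2 c τ) :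
    acceleration G₂ (θ ∘ c) τ = fderiv ℝ θ (c τ) (acceleration G₁ c τ) := by
  have hd (σ : ℝ) (hθ : DifferentiableAt ℝ θ (c σ)) (hσ : DifferentiableAt ℝ c σ) :
      deriv (θ ∘ c) σ = fderiv ℝ θ (c σ) (deriv c σ) :=
    (hθ.hasFDerivAt.comp_hasDerivAt σ hσ.hasDerivAt).deriv
  have h1 : deriv (θ ∘ c) =ᶠ[𝓝 τ] fun σ ↦ fderiv ℝ θ (c σ) (deriv c σ) := by
    filter_upwards [hc.continuousAt.eventually h.eventually, hc.eventually (by simp)]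
      with σ h1 h2 using hd σ h1.differentiableAt (h2.differentiableAt (by simp))
  have hc' : HasDerivAt c (deriv c τ) τ := (hc.differentiableAt (by simp)).hasDerivAt
  have hc'' : HasDerivAt (deriv c) (deriv (deriv c) τ) τ := by
    have : ContDiffAt ℝ 1 (deriv c) τ := contDiffAt_deriv hc
    exact (this.differentiableAt (by simp)).hasDerivAt
  have h2 : HasDerivAt (fun σ ↦ fderiv ℝ θ (c σ)) (fderiv ℝ (fderiv ℝ θ) (c τ) (deriv c τ)) τ :=
    h.differentiableAt_fderiv.hasFDerivAt.comp_hasDerivAt τ hc'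
  have h3 := (h2.clm_apply hc'').deriv
  rw [acceleration, h1.deriv_eq, h3, hd τ h.differentiableAt hc'.differentiableAt, acceleration,
    map_add, h.fderiv_christoffelL]
  simp only [Function.comp_apply]
  abel

/-- As a first order system for `(c, c')` the geodesic equation has a vector field of class `C¹`,
hence locally Lipschitz, and ODE uniqueness applies. -/
theorem eventuallyEq_of_acceleration_eq_zero {G : E₁ → E₁ →L[ℝ] E₁ →L[ℝ] ℝ} {c₁ c₂ : ℝ → E₁} {τ : ℝ}
    (hG : IsMetricAt G (c₁ τ)) (hc₁ : ContDiffAt ℝ 2 c₁ τ) (hc₂ : ContDiffAt ℝ 2 c₂ τ)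
    (h₁ : ∀ᶠ σ in 𝓝 τ, acceleration G c₁ σ = 0) (h₂ : ∀ᶠ σ in 𝓝 τ, acceleration G c₂ σ = 0)
    (h0 : c₁ τ = c₂ τ) (h0' : deriv c₁ τ = deriv c₂ τ) : c₁ =ᶠ[𝓝 τ] c₂ := by
  let X : E₁ × E₁ → E₁ × E₁ := fun p ↦ (p.2, -christoffelL G p.1 p.2 p.2)
  have hX : ContDiffAt ℝ 1 X (c₁ τ, deriv c₁ τ) := by
    have h1 : ContDiffAt ℝ 1 (fun p : E₁ × E₁ ↦ christoffelL G p.1) (c₁ τ, deriv c₁ τ) :=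
      ContDiffAt.comp (g := christoffelL G) (c₁ τ, deriv c₁ τ)
        hG.contDiffAt_christoffelL contDiffAt_fst
    exact contDiffAt_snd.prodMk ((h1.clm_apply contDiffAt_snd).clm_apply contDiffAt_snd).neg
  obtain ⟨K, S, hS, hK⟩ := hX.exists_lipschitzOnWith
  have key (c : ℝ → E₁) (hc : ContDiffAt ℝ 2 c τ) (h : ∀ᶠ σ in 𝓝 τ, acceleration G c σ = 0)
      (hcS : S ∈ 𝓝 (c τ, deriv c τ)) :
      ∀ᶠ σ in 𝓝 τ, HasDerivAt (fun σ ↦ (c σ, deriv c σ)) (X (c σ, deriv c σ)) σ ∧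
        (c σ, deriv c σ) ∈ S := by
    have hd : ContDiffAt ℝ 1 (deriv c) τ := contDiffAt_deriv hc
    have hcont : ContinuousAt (fun σ ↦ (c σ, deriv c σ)) τ :=
      hc.continuousAt.prodMk hd.continuousAt
    filter_upwards [hc.eventually (by simp), hd.eventually (by simp), h, hcont.eventually hcS]
      with σ h1 h2 h3 h4
    refine ⟨(h1.differentiableAt (by simp)).hasDerivAt.prodMk ?_, h4⟩
    have := (h2.differentiableAt (by simp)).hasDerivAt
    rwa [eq_neg_of_add_eq_zero_left h3] at this
  have hfin := ODE_solution_unique_of_eventually (v := fun _ ↦ X) (s := fun _ ↦ S) (K := K)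
    (f := fun σ ↦ (c₁ σ, deriv c₁ σ)) (g := fun σ ↦ (c₂ σ, deriv c₂ σ)) (t₀ := τ)
    (Eventually.of_forall fun _ ↦ hK) (key c₁ hc₁ h₁ hS) (key c₂ hc₂ h₂ (by rwa [← h0, ← h0']))
    (by simp only [h0, h0'])
  filter_upwards [hfin] with σ hσ using congrArg Prod.fst hσ

end Acceleration

/-! ### Geodesics on the manifold and their uniqueness. -/

section Geodesic

variable {n : ℕ} {M : Type*} [TopologicalSpace M] [ChartedSpace (Model n) M]
  [IsManifold (𝓡 n) ∞ M] [RiemannianBundle (fun x : M ↦ TangentSpace (𝓡 n) x)]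
  [IsContMDiffRiemannianBundle (𝓡 n) ∞ (Model n) (fun x : M ↦ TangentSpace (𝓡 n) x)]
  {γ γ₁ γ₂ : ℝ → M} {s s₁ s₂ : Set ℝ} {τ : ℝ}

omit [RiemannianBundle (fun x : M ↦ TangentSpace (𝓡 n) x)]
  [IsContMDiffRiemannianBundle (𝓡 n) ∞ (Model n) (fun x : M ↦ TangentSpace (𝓡 n) x)] in
theorem contDiffAt_extChartAt_comp_curve (hs : IsOpen s)
    (hγ : ContMDiffOn 𝓘(ℝ, ℝ) (𝓡 n) ∞ γ s) (hτ : τ ∈ s) {x : M}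
    (hx : γ τ ∈ (extChartAt (𝓡 n) x).source) {m : ℕ} :
    ContDiffAt ℝ m (fun σ ↦ extChartAt (𝓡 n) x (γ σ)) τ := by
  rw [← contMDiffAt_iff_contDiffAt]
  have h1 : ContMDiffAt (𝓡 n) 𝓘(ℝ, Model n) ∞ (extChartAt (𝓡 n) x) (γ τ) :=
    contMDiffAt_extChartAt' (n := ∞) (by rwa [extChartAt_source] at hx)
  exact (h1.comp τ ((hγ τ hτ).contMDiffAt (hs.mem_nhds hτ))).of_le (by exact_mod_cast le_top)

/-- The geodesic equation holds in every chart. -/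
theorem IsGeodesicOn.acceleration_eq_zero (hγ : IsGeodesicOn n γ s) (hs : IsOpen s) (hτ : τ ∈ s)
    {x : M} (hx : γ τ ∈ (extChartAt (𝓡 n) x).source) :
    acceleration (chartMetric x) (fun σ ↦ extChartAt (𝓡 n) x (γ σ)) τ = 0 := by
  let c : ℝ → Model n := fun σ ↦ extChartAt (𝓡 n) (γ τ) (γ σ)
  have hc : ContDiffAt ℝ 2 c τ :=
    contDiffAt_extChartAt_comp_curve hs hγ.1 hτ (mem_extChartAt_source _)
  have h1 : acceleration (chartMetric (γ τ)) c τ = 0 := by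
    have := hγ.2 τ hτ
    simp only [christoffel, ← christoffelL_apply] at this
    exact this
  have h2 : (extChartAt (𝓡 n) (γ τ)).symm (c τ) = γ τ := extChartAt_to_inv _
  have h3 : IsIsometryAt (chartMetric (γ τ)) (chartMetric x)
      (extChartAt (𝓡 n) x ∘ (extChartAt (𝓡 n) (γ τ)).symm) (c τ) :=
    (isParametrization_extChartAt_symm (γ τ)).isIsometryAt (mem_extChartAt_target _) (by rwa [h2])
  have h4 : (fun σ ↦ extChartAt (𝓡 n) x (γ σ)) =ᶠ[𝓝 τ]
      (extChartAt (𝓡 n) x ∘ (extChartAt (𝓡 n) (γ τ)).symm) ∘ c := by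
    filter_upwards [((hγ.1 τ hτ).contMDiffAt (hs.mem_nhds hτ)).continuousAt.eventually
      (extChartAt_source_mem_nhds (I := 𝓡 n) (γ τ))] with σ hσ
    simp only [Function.comp_apply, c]
    rw [(extChartAt (𝓡 n) (γ τ)).left_inv hσ]
  have h5 := h3.acceleration_comp hc
  rw [h1, map_zero] at h5
  rw [← h5]
  simp only [acceleration, h4.deriv_eq, h4.deriv.deriv_eq, h4.self_of_nhds]

theorem IsGeodesicOn.eventuallyEq (hγ₁ : IsGeodesicOn n γ₁ s₁) (hγ₂ : IsGeodesicOn n γ₂ s₂)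
    (hs₁ : IsOpen s₁) (hs₂ : IsOpen s₂) (hτ₁ : τ ∈ s₁) (hτ₂ : τ ∈ s₂) {x : M}
    (hx : γ₁ τ ∈ (extChartAt (𝓡 n) x).source) (h0 : γ₁ τ = γ₂ τ)
    (h0' : deriv (fun σ ↦ extChartAt (𝓡 n) x (γ₁ σ)) τ =
      deriv (fun σ ↦ extChartAt (𝓡 n) x (γ₂ σ)) τ) : γ₁ =ᶠ[𝓝 τ] γ₂ := by
  have hx₂ : γ₂ τ ∈ (extChartAt (𝓡 n) x).source := h0 ▸ hx
  have key {γ : ℝ → M} {s : Set ℝ} (hγ : IsGeodesicOn n γ s) (hs : IsOpen s) (hτ : τ ∈ s)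
      (hx : γ τ ∈ (extChartAt (𝓡 n) x).source) :
      ∀ᶠ σ in 𝓝 τ, γ σ ∈ (extChartAt (𝓡 n) x).source ∧
        acceleration (chartMetric x) (fun σ ↦ extChartAt (𝓡 n) x (γ σ)) σ = 0 := by
    filter_upwards [hs.mem_nhds hτ,
      ((hγ.1 τ hτ).contMDiffAt (hs.mem_nhds hτ)).continuousAt.eventually
      ((isOpen_extChartAt_source x).mem_nhds hx)] with σ h1 h2
    exact ⟨h2, hγ.acceleration_eq_zero hs h1 h2⟩
  have h := eventuallyEq_of_acceleration_eq_zero (G := chartMetric x)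
    (isMetricAt_chartMetric ((extChartAt (𝓡 n) x).map_source hx))
    (contDiffAt_extChartAt_comp_curve hs₁ hγ₁.1 hτ₁ hx)
    (contDiffAt_extChartAt_comp_curve hs₂ hγ₂.1 hτ₂ hx₂)
    ((key hγ₁ hs₁ hτ₁ hx).mono fun _ h ↦ h.2) ((key hγ₂ hs₂ hτ₂ hx₂).mono fun _ h ↦ h.2)
    (by rw [h0]) h0'
  filter_upwards [h, key hγ₁ hs₁ hτ₁ hx, key hγ₂ hs₂ hτ₂ hx₂] with σ h1 h2 h3
  exact (extChartAt (𝓡 n) x).injOn h2.1 h3.1 h1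

/-- A geodesic is determined by its initial point and its initial velocity. -/
theorem IsGeodesicOn.eqOn [T2Space M] (hγ₁ : IsGeodesicOn n γ₁ s₁) (hγ₂ : IsGeodesicOn n γ₂ s₂)
    (hs₁ : IsOpen s₁) (hs₂ : IsOpen s₂) (ho₁ : s₁.OrdConnected) (ho₂ : s₂.OrdConnected)
    (hτ₁ : τ ∈ s₁) (hτ₂ : τ ∈ s₂) {x : M}
    (hx : γ₁ τ ∈ (extChartAt (𝓡 n) x).source) (h0 : γ₁ τ = γ₂ τ)
    (h0' : deriv (fun σ ↦ extChartAt (𝓡 n) x (γ₁ σ)) τ =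
      deriv (fun σ ↦ extChartAt (𝓡 n) x (γ₂ σ)) τ) : Set.EqOn γ₁ γ₂ (s₁ ∩ s₂) := by
  have hpre : IsPreconnected (s₁ ∩ s₂) := (ho₁.inter ho₂).isPreconnected
  -- The set of times at which the germs agree is open. It is relatively closed because positions
  -- (`M` is Hausdorff) and velocities agree at limit times, where local uniqueness applies again.
  have hsub : s₁ ∩ s₂ ⊆ {σ | γ₁ =ᶠ[𝓝 σ] γ₂} := by
    refine hpre.subset_of_closure_inter_subset (isOpen_setOfPred_eventually_nhds)
      ⟨τ, ⟨hτ₁, hτ₂⟩, hγ₁.eventuallyEq hγ₂ hs₁ hs₂ hτ₁ hτ₂ hx h0 h0'⟩ ?_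
    rintro σ ⟨hσ, hσ₁, hσ₂⟩
    have hf : ∃ᶠ a in 𝓝 σ, γ₁ =ᶠ[𝓝 a] γ₂ := mem_closure_iff_frequently.1 hσ
    have e0 : γ₁ σ = γ₂ σ := by
      by_contra hne
      have hc := (((hγ₁.1 σ hσ₁).contMDiffAt (hs₁.mem_nhds hσ₁)).continuousAt.prodMk
        ((hγ₂.1 σ hσ₂).contMDiffAt (hs₂.mem_nhds hσ₂)).continuousAt).eventually
        ((isClosed_diagonal (X := M)).isOpen_compl.mem_nhds (x := (γ₁ σ, γ₂ σ)) hne)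
      obtain ⟨a, h1, h2⟩ := (hf.and_eventually hc).exists
      exact h2 h1.self_of_nhds
    have hσx := mem_extChartAt_source (I := 𝓡 n) (γ₁ σ)
    refine hγ₁.eventuallyEq hγ₂ hs₁ hs₂ hσ₁ hσ₂ hσx e0 ?_
    by_contra hne
    have hd₁ : ContDiffAt ℝ 1 (deriv (fun σ' ↦ extChartAt (𝓡 n) (γ₁ σ) (γ₁ σ'))) σ :=
      contDiffAt_deriv (contDiffAt_extChartAt_comp_curve hs₁ hγ₁.1 hσ₁ hσx (m := 2))
    have hd₂ : ContDiffAt ℝ 1 (deriv (fun σ' ↦ extChartAt (𝓡 n) (γ₁ σ) (γ₂ σ'))) σ :=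
      contDiffAt_deriv (contDiffAt_extChartAt_comp_curve hs₂ hγ₂.1 hσ₂ (e0 ▸ hσx) (m := 2))
    have hc := (hd₁.continuousAt.prodMk hd₂.continuousAt).eventually
        ((isClosed_diagonal (X := Model n)).isOpen_compl.mem_nhds hne)
    obtain ⟨a, h1, h2⟩ := (hf.and_eventually hc).exists
    refine h2 (EventuallyEq.deriv_eq ?_)
    filter_upwards [h1] with b hb using by rw [hb]
  exact fun σ hσ ↦ (hsub hσ).self_of_nhds

theorem IsGeodesicOn.comp_mul (hγ : IsGeodesicOn n γ s) (hs : IsOpen s) (a : ℝ) :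
    IsGeodesicOn n (fun σ ↦ γ (a * σ)) ((fun σ ↦ a * σ) ⁻¹' s) := by
  refine ⟨hγ.1.comp (contDiff_const.mul contDiff_id).contMDiff.contMDiffOn (fun _ h ↦ h),
    fun τ hτ ↦ ?_⟩
  have := hγ.acceleration_eq_zero hs hτ (mem_extChartAt_source (I := 𝓡 n) (γ (a * τ)))
  have h2 := acceleration_comp_mul (chartMetric (γ (a * τ)))
    (fun σ ↦ extChartAt (𝓡 n) (γ (a * τ)) (γ σ)) a τ
  rw [this, smul_zero, acceleration, christoffelL_apply] at h2
  exact h2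

end Geodesic

end Jang

end


noncomputable section

open Filter Topology

set_option maxSynthPendingDepth 3
set_option synthInstance.maxHeartbeats 200000

namespace Jang

/-! ### The exponential map gives normal coordinates. -/

section Exponential

variable {n : ℕ} {M : Type*} [TopologicalSpace M] [ChartedSpace (Model n) M]
  [IsManifold (𝓡 n) ∞ M] [RiemannianBundle (fun x : M ↦ TangentSpace (𝓡 n) x)]
  [IsContMDiffRiemannianBundle (𝓡 n) ∞ (Model n) (fun x : M ↦ TangentSpace (𝓡 n) x)]
  {x₀ : M} {F : Tan n x₀ → M} {r : ℝ≥0∞}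

/-- The geodesics from `x₀` are the images of the rays from the origin. -/
theorem exists_geodesic_of_isExp [T2Space M]
    (hF : ∀ v ∈ Metric.eball (0 : Tan n x₀) r, IsExp n x₀ v (F v))
    {v : Tan n x₀} (hv : v ∈ Metric.eball (0 : Tan n x₀) r) :
    ∃ (γ : ℝ → M) (s : Set ℝ), IsOpen s ∧ Set.Icc 0 1 ⊆ s ∧ IsGeodesicOn n γ s ∧ γ 0 = x₀ ∧
      deriv (fun σ ↦ extChartAt (𝓡 n) x₀ (γ σ)) 0 = v ∧
      ∀ τ ∈ s, τ • v ∈ Metric.eball (0 : Tan n x₀) r → F (τ • v) = γ τ := by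
  obtain ⟨γ, s, hs, ho, h01, hγ, h0, hd, -⟩ := hF v hv
  refine ⟨γ, s, hs, h01, hγ, h0, hd, fun τ hτ hτv ↦ ?_⟩
  obtain ⟨γ', s', hs', ho', h01', hγ', h0', hd', h1'⟩ := hF _ hτv
  have hs0 : (0 : ℝ) ∈ s := h01 (by simp)
  have ho'' : ((fun σ : ℝ ↦ τ * σ) ⁻¹' s).OrdConnected := by
    rw [← convex_iff_ordConnected] at ho ⊢
    exact ho.linear_preimage (LinearMap.mulLeft ℝ τ)
  -- The rescaled geodesic `σ ↦ γ (τ σ)` has initial velocity `τ v`, so by uniqueness it agrees with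
  -- the one defining `F (τ v)`; at `σ = 1` this is the claim.
  have key := hγ'.eqOn (hγ.comp_mul hs τ) hs' (hs.preimage (by fun_prop)) ho' ho'' (τ := 0) (x := x₀)
    (h01' (by simp)) (by simpa using hs0) (by rw [h0']; exact mem_extChartAt_source _)
    (by simp [h0, h0']) ?_
  · have := key (x := 1) ⟨h01' (by simp), by simpa using hτ⟩
    rw [← h1', this]
    simp
  · have h2 := deriv_comp_mul_left τ (fun σ ↦ extChartAt (𝓡 n) x₀ (γ σ)) 0
    refine (hd'.trans ?_).trans h2.symm
    rw [mul_zero, hd]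
    rfl

theorem isExp_zero [T2Space M]
    (hF : ∀ v ∈ Metric.eball (0 : Tan n x₀) r, IsExp n x₀ v (F v)) (hr : 0 < r) : F 0 = x₀ := by
  have h0 : (0 : Tan n x₀) ∈ Metric.eball (0 : Tan n x₀) r := Metric.mem_eball_self hr
  obtain ⟨γ, s, -, h01, -, hγ0, -, h⟩ := exists_geodesic_of_isExp hF h0
  have := h 0 (h01 (by simp)) (by simpa using h0)
  rwa [smul_zero, hγ0] at this

omit [IsManifold (𝓡 n) ∞ M]
  [IsContMDiffRiemannianBundle (𝓡 n) ∞ (Model n) (fun x : M ↦ TangentSpace (𝓡 n) x)] in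
theorem eventually_smul_mem_eball {v : Tan n x₀} {τ : ℝ}
    (hv : τ • v ∈ Metric.eball (0 : Tan n x₀) r) :
    ∀ᶠ σ in 𝓝 τ, σ • v ∈ Metric.eball (0 : Tan n x₀) r :=
  (by fun_prop : ContinuousAt (fun σ : ℝ ↦ σ • v) τ).eventually (Metric.isOpen_eball.mem_nhds hv)

/-- For small `v` the curve `τ ↦ F (τ v)` is the geodesic with initial velocity `v`, so the
differential fixes `v`; linearity extends this to all vectors. -/
theorem tangentFrame_isExp_zero [T2Space M]
    (hF : ∀ v ∈ Metric.eball (0 : Tan n x₀) r, IsExp n x₀ v (F v)) (hr : 0 < r)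
    (hP : IsParametrization n F (Metric.eball (0 : Tan n x₀) r)) (v : Tan n x₀) :
    (tangentFrame n F 0 v : Model n) = v := by
  have h0 : (0 : Tan n x₀) ∈ Metric.eball (0 : Tan n x₀) r := Metric.mem_eball_self hr
  have hF0 := isExp_zero hF hr
  have key (v : Tan n x₀) (hv : v ∈ Metric.eball (0 : Tan n x₀) r) :
      (tangentFrame n F 0 v : Model n) = v := by
    obtain ⟨γ, s, hs, h01, -, -, hd, h⟩ := exists_geodesic_of_isExp hF hv
    rw [← hP.fderiv_extChartAt_comp_self h0]
    have h1 : HasFDerivAt (extChartAt (𝓡 n) (F 0) ∘ F)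
        (fderiv ℝ (extChartAt (𝓡 n) (F 0) ∘ F) 0) ((0 : ℝ) • v) := by
      rw [zero_smul]
      exact ((hP.contDiffAt_extChartAt_comp h0 (mem_extChartAt_source _)
        (m := 1)).differentiableAt (by simp)).hasFDerivAt
    have h2 := (h1.comp_hasDerivAt (0 : ℝ) ((hasDerivAt_id (0 : ℝ)).smul_const v)).deriv
    rw [one_smul] at h2
    refine (h2.symm.trans (EventuallyEq.deriv_eq ?_)).trans hd
    filter_upwards [hs.mem_nhds (h01 (by simp)),
      eventually_smul_mem_eball (v := v) (τ := 0) (by simpa using h0)] with τ h3 h4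
    simp only [Function.comp_apply, id, hF0, h τ h3 h4]
  obtain ⟨a, ha, ha0⟩ := ((eventually_smul_mem_eball (v := v) (τ := 0)
    (by simpa using h0)).filter_mono nhdsWithin_le_nhds |>.and
      (self_mem_nhdsWithin (a := (0 : ℝ)) (s := Set.Ioi 0))).exists
  have h1 := key _ ha
  rw [map_smul] at h1
  exact smul_right_injective (Model n) (ne_of_gt ha0) h1

/-- The differential at the origin is the identity, which gives the value of the metric there. Rays
are mapped to geodesics by a local isometry, so their acceleration `Γ_y(y, y)` in the pullback
metric vanishes. -/
theorem isNormalMetric_of_isExp [T2Space M]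
    (hF : ∀ v ∈ Metric.eball (0 : Tan n x₀) r, IsExp n x₀ v (F v))
    (hP : IsParametrization n F (Metric.eball (0 : Tan n x₀) r)) {ρ : ℝ} (hρ : 0 < ρ)
    (hρr : ENNReal.ofReal ρ ≤ r) : IsNormalMetric (pullMetric n F) ρ where
  isMetricAt y hy := by
    refine hP.isMetricAt (Metric.eball_subset_eball hρr ?_)
    rwa [Metric.eball_ofReal]
  zero v w := by
    have hr : 0 < r := (ENNReal.ofReal_pos.2 hρ).trans_le hρr
    have h4 (q q' : M) (hq : q = q') (a b : Model n) :
        metricForm q (show Tan n q from a) (show Tan n q from b) =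
          metricForm q' (show Tan n q' from a) (show Tan n q' from b) := by
      subst hq; rfl
    refine (h4 _ x₀ (isExp_zero hF hr) (tangentFrame n F 0 v) (tangentFrame n F 0 w)).trans ?_
    have h5 := tangentFrame_isExp_zero hF hr hP
    have h6 (a b a' b' : Tan n x₀) (h : a = a') (h' : b = b') :
        metricForm x₀ a b = inner ℝ a' b' := by
      rw [h, h']; rfl
    exact h6 _ _ _ _ (h5 v) (h5 w)
  christoffelL_self y hy := by
    have hy' : y ∈ Metric.eball (0 : Tan n x₀) r := by
      refine Metric.eball_subset_eball hρr ?_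
      rwa [Metric.eball_ofReal]
    have hx := mem_extChartAt_source (I := 𝓡 n) (F y)
    obtain ⟨γ, s, hs, h01, hγ, -, -, h⟩ := exists_geodesic_of_isExp hF hy'
    let c : ℝ → Tan n x₀ := fun τ ↦ τ • y
    have hc1 : deriv c = fun _ ↦ y := by
      funext τ
      simpa using ((hasDerivAt_id τ).smul_const y).deriv
    have hc0 : c 1 = y := one_smul ℝ y
    have h1s : (1 : ℝ) ∈ s := h01 (by simp)
    have h2 : F ∘ c =ᶠ[𝓝 1] γ := by
      filter_upwards [hs.mem_nhds h1s, eventually_smul_mem_eball (v := y) (τ := 1)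
        (by simpa using hy')] with τ h3 h4 using h τ h3 h4
    have hγ1 : γ 1 = F y := by rw [← h2.self_of_nhds, Function.comp_apply, hc0]
    have h3 : IsIsometryAt (pullMetric n F) (chartMetric (F y)) (extChartAt (𝓡 n) (F y) ∘ F) (c 1) := by
      rw [hc0]
      exact hP.isIsometryAt hy' hx
    have h4 := h3.acceleration_comp (by fun_prop)
    have h5 : (extChartAt (𝓡 n) (F y) ∘ F) ∘ c =ᶠ[𝓝 1]
        fun σ ↦ extChartAt (𝓡 n) (F y) (γ σ) := by
      filter_upwards [h2] with τ hτ
      simp only [Function.comp_apply] at hτ ⊢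
      rw [hτ]
    have h6 : acceleration (chartMetric (F y)) ((extChartAt (𝓡 n) (F y) ∘ F) ∘ c) 1 = 0 := by
      rw [← hγ.acceleration_eq_zero hs h1s (x := F y) (by rwa [hγ1])]
      simp only [acceleration, h5.deriv_eq, h5.deriv.deriv_eq, h5.self_of_nhds]
    rw [h6] at h4
    have h7 : acceleration (pullMetric n F) c 1 = christoffelL (pullMetric n F) y y y := by
      simp [acceleration, hc1, hc0]
    rw [h7, hc0] at h4
    exact (hP.bijective_fderiv_extChartAt_comp hy' hx).1 (h4.symm.trans (map_zero _).symm)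

end Exponential

end Jang

end


noncomputable section

open Filter Topology

set_option maxSynthPendingDepth 3
set_option synthInstance.maxHeartbeats 200000

namespace Jang

/-! ### Reflection symmetry and the two one-sided bounds on `u`. -/

section Reflection

variable {E : Type*} [NormedAddCommGroup E] [InnerProductSpace ℝ E]

theorem gradOf_neg (G : E → E →L[ℝ] E →L[ℝ] ℝ) (u : E → ℝ) :
    gradOf G (-u) = -gradOf G u := by
  funext y
  simp only [gradOf, fderiv_neg, Pi.neg_apply, map_neg]

theorem areaSq_neg (G : E → E →L[ℝ] E →L[ℝ] ℝ) (u : E → ℝ) : areaSq G (-u) = areaSq G u := by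
  funext y
  simp only [areaSq, gradOf_neg, Pi.neg_apply, map_neg, neg_apply, neg_neg]

theorem covOp_neg (G : E → E →L[ℝ] E →L[ℝ] ℝ) (X : E → E) (y : E) :
    covOp G (-X) y = -covOp G X y := by
  ext w
  simp only [covOp_apply, fderiv_neg, Pi.neg_apply, map_neg, neg_apply]
  abel

theorem covDerivOf_neg (G P : E → E →L[ℝ] E →L[ℝ] ℝ) (y z v w : E) :
    covDerivOf G (-P) y z v w = -covDerivOf G P y z v w := by
  simp only [covDerivOf, fderiv_neg, Pi.neg_apply, neg_apply]
  ring

variable [FiniteDimensional ℝ E]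

/-- The regularized Jang equation is invariant under the reflection `(u, p) ↦ (-u, -p)`. -/
theorem JangEquationOf.neg {G P : E → E →L[ℝ] E →L[ℝ] ℝ} {t : ℝ} {u : E → ℝ} {y : E}
    (h : JangEquationOf G P t u y) : JangEquationOf G (-P) t (-u) y := by
  unfold JangEquationOf graphTraceOf at *
  simp only [areaSq_neg, gradOf_neg, covOp_neg, Pi.neg_apply, map_neg, neg_apply, neg_neg,
    ContinuousLinearMap.comp_neg]
  linear_combination -h

variable {G P : E → E →L[ℝ] E →L[ℝ] ℝ} {u : E → ℝ} {ρ t T P₀ P₁ Θ κ : ℝ}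

/-- A lower bound on `u` is an upper bound on `-u`, which solves the equation with `-p`; all other
bounds and the length of the gradient are unchanged. -/
theorem IsNormalMetric.gradient_estimate_of_or
    (h : IsNormalMetric G ρ) (hρ : 0 < ρ) (ht : 0 ≤ t) (hT : 0 < T)
    (hP₀ : 0 ≤ P₀) (hP₁ : 0 ≤ P₁) (hΘ : 0 ≤ Θ) (hκ : 0 ≤ κ)
    (hP : ∀ y ∈ Metric.ball (0 : E) ρ, DifferentiableAt ℝ P y)
    (hPs : ∀ y ∈ Metric.ball (0 : E) ρ, ∀ v w, P y v w = P y w v)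
    (hu : ∀ y ∈ Metric.ball (0 : E) ρ, ContDiffAt ℝ 3 u y)
    (hJ : ∀ y ∈ Metric.ball (0 : E) ρ, JangEquationOf G P t u y)
    (hosc : (∀ y ∈ Metric.ball (0 : E) ρ, u y ≤ u 0 + T) ∨
      (∀ y ∈ Metric.ball (0 : E) ρ, u y ≥ u 0 - T))
    (hp : ∀ y ∈ Metric.ball (0 : E) ρ, ∀ v w, |P y v w| ≤ P₀ * √(G y v v) * √(G y w w))
    (hDp : ∀ y ∈ Metric.ball (0 : E) ρ, ∀ z v w,
      |covDerivOf G P y z v w| ≤ P₁ * √(G y z z) * √(G y v v) * √(G y w w))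
    (hR : ∀ y ∈ Metric.ball (0 : E) ρ, ∀ v w,
      -(κ * G y v v * G y w w) ≤ G y (curvatureOf G y v w w) v)
    (htu : ∀ y ∈ Metric.ball (0 : E) ρ, t * |u y| ≤ Θ) :
    √(G 0 (gradOf G u 0) (gradOf G u 0)) ≤ Real.exp (100 * ((Module.finrank ℝ E + 1) * (1 + T)
      * (1 + 1 / ρ) * (1 + P₀ + P₁ + Θ + κ)) ^ 2) := by
  rcases hosc with hosc | hosc
  · exact h.gradient_estimate hρ ht hT hP₀ hP₁ hΘ hκ hP hPs hu hJ hosc hp hDp hR htu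
  · have := h.gradient_estimate (P := -P) (u := -u) hρ ht hT hP₀ hP₁ hΘ hκ
      (fun y hy ↦ (hP y hy).neg) (fun y hy v w ↦ by simp [hPs y hy v w])
      (fun y hy ↦ (hu y hy).neg) (fun y hy ↦ (hJ y hy).neg)
      (fun y hy ↦ by simp only [Pi.neg_apply]; linarith [hosc y hy])
      (fun y hy v w ↦ by simpa using hp y hy v w)
      (fun y hy z v w ↦ by rw [covDerivOf_neg, abs_neg]; exact hDp y hy z v w) hR
      (fun y hy ↦ by simpa using htu y hy)
    simpa only [gradOf_neg, Pi.neg_apply, map_neg, neg_apply, neg_neg] using this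

end Reflection

section Trace

theorem trace_eq_sum_of_inner {E V : Type*} [AddCommGroup E] [Module ℝ E]
    [NormedAddCommGroup V] [InnerProductSpace ℝ V] {ι : Type*} [Fintype ι]
    (b : OrthonormalBasis ι ℝ V) (J : E ≃ₗ[ℝ] V) (S : E →ₗ[ℝ] E) {B : V → V → ℝ}
    (h : ∀ v w, inner ℝ (J (S v)) (J w) = B (J v) (J w)) :
    LinearMap.trace ℝ E S = ∑ i, B (b i) (b i) := by
  rw [← LinearMap.trace_conj' S J, LinearMap.trace_eq_sum_inner _ b]
  refine Finset.sum_congr rfl fun i _ ↦ ?_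
  have := h (J.symm (b i)) (J.symm (b i))
  rw [J.apply_symm_apply] at this
  rw [← this, LinearEquiv.conj_apply_apply, real_inner_comm]

end Trace

/-! ### The Jang equation and the curvature bound in a parametrization. -/

section Pullback

variable {n : ℕ} {M : Type*} [TopologicalSpace M] [ChartedSpace (Model n) M]
  [IsManifold (𝓡 n) ∞ M] [RiemannianBundle (fun x : M ↦ TangentSpace (𝓡 n) x)]
  [IsContMDiffRiemannianBundle (𝓡 n) ∞ (Model n) (fun x : M ↦ TangentSpace (𝓡 n) x)]
  {E : Type*} [NormedAddCommGroup E] [NormedSpace ℝ E]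
  {f : E → M} {s : Set E} {y : E}

omit [IsManifold (𝓡 n) ∞ M]
  [IsContMDiffRiemannianBundle (𝓡 n) ∞ (Model n) (fun x : M ↦ TangentSpace (𝓡 n) x)] in
theorem sqrt_pullMetric_self (f : E → M) (y v : E) :
    √(pullMetric n f y v v) = ‖tangentFrame n f y v‖ := by
  rw [pullMetric_self, Real.sqrt_sq (norm_nonneg _)]

namespace IsParametrization

variable [FiniteDimensional ℝ E]

theorem areaSq_eq (hf : IsParametrization n f s) (hy : y ∈ s) {u : M → ℝ}
    (hu : MDifferentiableAt (𝓡 n) 𝓘(ℝ, ℝ) u (f y)) :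
    areaSq (pullMetric n f) (u ∘ f) y = 1 + ‖grad n u (f y)‖ ^ 2 := by
  rw [areaSq, pullMetric_self, hf.tangentFrame_gradOf hy hu]

omit [IsManifold (𝓡 n) ∞ M]
  [IsContMDiffRiemannianBundle (𝓡 n) ∞ (Model n) (fun x : M ↦ TangentSpace (𝓡 n) x)] in
theorem traceL_eq (hf : IsParametrization n f s) (hy : y ∈ s) (S : E →L[ℝ] E)
    (B : Tan n (f y) → Tan n (f y) → ℝ)
    (h : ∀ v w, pullMetric n f y (S v) w = B (tangentFrame n f y v) (tangentFrame n f y w)) :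
    traceL E S = ∑ i, B (stdOrthonormalBasis ℝ (Tan n (f y)) i)
      (stdOrthonormalBasis ℝ (Tan n (f y)) i) := by
  rw [traceL_apply]
  exact trace_eq_sum_of_inner _
    (LinearEquiv.ofBijective (tangentFrame n f y : E →ₗ[ℝ] Tan n (f y)) (hf.bijective y hy)) _ h

/-- The traces over an orthonormal basis become traces of endomorphisms of `E`, and the equation is
multiplied by `W`. -/
theorem jangEquationOf (hf : IsParametrization n f s) (hy : y ∈ s) {u : M → ℝ}
    (hu : ContMDiffAt (𝓡 n) 𝓘(ℝ, ℝ) 3 u (f y))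
    {p : ∀ q : M, Tan n q →L[ℝ] Tan n q →L[ℝ] ℝ} {t : ℝ} (h : JangEquationAt n p t u (f y)) :
    JangEquationOf (pullMetric n f) (pullForm f p) t (u ∘ f) y := by
  have hG := hf.isMetricAt hy
  have hud : MDifferentiableAt (𝓡 n) 𝓘(ℝ, ℝ) u (f y) := hu.mdifferentiableAt (by simp)
  have hu2 : ContMDiffAt (𝓡 n) 𝓘(ℝ, ℝ) 2 u (f y) := hu.of_le (by norm_num)
  have hu3 : ContDiffAt ℝ 3 (u ∘ f) y := by
    rw [← contMDiffAt_iff_contDiffAt]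
    exact hu.comp y ((hf.contMDiffAt hy).of_le
      ENat.LEInfty.out)
  have hJ := hf.tangentFrame_gradOf hy hud
  have hS (v w : E) : pullMetric n f y (covOp (pullMetric n f) (gradOf (pullMetric n f) (u ∘ f)) y v) w
      = hessian n u (f y) (tangentFrame n f y v) (tangentFrame n f y w) := by
    rw [hf.hessian_eq hy hu2, hG.apply_covOp_gradOf hu3]
  have hp (v w : E) : pullMetric n f y (((pullMetric n f y).inverse ∘L pullForm f p y) v) w
      = p (f y) (tangentFrame n f y v) (tangentFrame n f y w) := by
    rw [ContinuousLinearMap.comp_apply, hG.apply_inverse, pullForm_apply]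
  unfold JangEquationOf graphTraceOf
  rw [hf.traceL_eq hy _ (hessian n u (f y)) hS, hf.traceL_eq hy _ (fun v w ↦ p (f y) v w) hp, hS,
    pullForm_apply, hJ, hf.areaSq_eq hy hud]
  unfold JangEquationAt meanCurvature graphTrace at h
  have hpos : 0 < √(1 + ‖grad n u (f y)‖ ^ 2) := by positivity
  rw [Function.comp_apply, ← h]
  field_simp
  ring

/-- For dependent vectors the curvature term is zero. For independent ones Cauchy-Schwarz is strict,
so the denominator of the sectional curvature is positive; enlarging it to `|v|² |w|²` only weakens
the bound. -/
theorem neg_le_pullMetric_curvatureOf (hf : IsParametrization n f s) (hy : y ∈ s) {κ : ℝ}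
    (hκ : 0 ≤ κ)
    (h : ∀ v w : Tan n (f y), LinearIndependent ℝ ![v, w] → |sectionalCurvature (f y) v w| ≤ κ)
    (v w : E) :
    -(κ * pullMetric n f y v v * pullMetric n f y w w) ≤
      pullMetric n f y (curvatureOf (pullMetric n f) y v w w) v := by
  set a : Tan n (f y) := tangentFrame n f y v with ha
  set b : Tan n (f y) := tangentFrame n f y w with hb
  have e1 : pullMetric n f y (curvatureOf (pullMetric n f) y v w w) v =
      inner ℝ (curvature (f y) a b b) a := by
    rw [ha, hb, hf.curvature_eq hy]
    rfl
  rw [pullMetric_self, pullMetric_self, ← ha, ← hb]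
  by_cases hd : v = 0 ∨ ∃ c : ℝ, w = c • v
  · have : curvatureOf (pullMetric n f) y v w w = 0 := by
      rcases hd with rfl | ⟨c, rfl⟩
      · simp [curvatureOf]
      · simp only [curvatureOf, map_smul, smul_apply]
        module
    rw [this, map_zero, zero_apply, neg_nonpos]
    positivity
  · have hd' : ¬(a = 0 ∨ ∃ c : ℝ, b = c • a) := by
      rintro (h0 | ⟨c, hc⟩)
      · exact hd (Or.inl ((hf.bijective y hy).1 (h0.trans (map_zero _).symm)))
      · refine hd (Or.inr ⟨c, (hf.bijective y hy).1 ?_⟩)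
        rw [map_smul]
        exact hc
    have hlt : ‖(inner ℝ a b : ℝ)‖ < ‖a‖ * ‖b‖ :=
      lt_of_le_of_ne (norm_inner_le_norm a b) fun he ↦
        hd' (((norm_inner_eq_norm_tfae ℝ a b).out 0 2).1 he)
    push Not at hd'
    have hli : LinearIndependent ℝ ![a, b] :=
      (LinearIndependent.pair_iff' hd'.1).2 fun c hc ↦ hd'.2 c hc.symm
    have hD : 0 < ‖a‖ ^ 2 * ‖b‖ ^ 2 - (inner ℝ a b : ℝ) ^ 2 := by
      have := pow_lt_pow_left₀ hlt (norm_nonneg _) two_ne_zero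
      rw [Real.norm_eq_abs, sq_abs, mul_pow] at this
      linarith
    have h1 := (abs_le.1 (h a b hli)).1
    rw [sectionalCurvature, le_div_iff₀ hD] at h1
    rw [e1]
    refine le_trans ?_ h1
    have : 0 ≤ κ * (inner ℝ a b : ℝ) ^ 2 := by positivity
    linarith

end IsParametrization

end Pullback

end Jang

end


noncomputable section

open Filter Topology

set_option maxSynthPendingDepth 3
set_option synthInstance.maxHeartbeats 200000

namespace Jang

/-! ### Geodesic balls and the main theorem. -/

section Main

variable {n : ℕ} {M : Type*} [EMetricSpace M] [ChartedSpace (Model n) M]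
  [RiemannianBundle (fun x : M ↦ TangentSpace (𝓡 n) x)]
  [IsRiemannianManifold (𝓡 n) M] {x₀ : M} {F : Tan n x₀ → M} {ρ : ℝ}

/-- The exponential map sends balls to geodesic balls. -/
theorem mem_eball_of_isNormalMetric (hP : IsParametrization n F (Metric.ball (0 : Tan n x₀) ρ))
    (h : IsNormalMetric (pullMetric n F) ρ) (h0 : F 0 = x₀) {y : Tan n x₀}
    (hy : y ∈ Metric.ball (0 : Tan n x₀) ρ) : F y ∈ Metric.eball x₀ (ENNReal.ofReal ρ) := by
  let c : ℝ → Tan n x₀ := fun τ ↦ τ • y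
  have hmem {τ : ℝ} (hτ : τ ∈ Set.Icc (0 : ℝ) 1) : c τ ∈ Metric.ball (0 : Tan n x₀) ρ :=
    smul_mem_ball_zero hy hτ
  have hc : ContDiff ℝ ∞ c := by fun_prop
  have hsmooth : ContMDiffOn 𝓘(ℝ, ℝ) (𝓡 n) 1 (F ∘ c) (Set.Icc 0 1) :=
    (hP.contMDiffOn.comp hc.contMDiff.contMDiffOn fun τ hτ ↦ hmem hτ).of_le (by simp)
  have hle := Manifold.riemannianEDist_le_pathELength (I := 𝓡 n) hsmooth
    (x := x₀) (y := F y) (by simp [c, h0]) (by simp [c]) zero_le_one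
  -- The image of the ray has constant speed `|y|`, hence length `|y| < ρ`, which bounds the
  -- Riemannian distance to `F y`.
  have hspeed (τ : ℝ) (hτ : τ ∈ Set.Icc (0 : ℝ) 1) :
      ‖mfderiv 𝓘(ℝ, ℝ) (𝓡 n) (F ∘ c) τ 1‖ₑ = ENNReal.ofReal ‖y‖ := by
    have h1 : HasDerivAt c y τ := by
      simpa only [one_smul] using! (hasDerivAt_id τ).smul_const y
    have h2 := ((hP.mdifferentiableAt (hmem hτ)).hasMFDerivAt.comp τ h1.hasFDerivAt.hasMFDerivAt).mfderiv
    have h3 : mfderiv 𝓘(ℝ, ℝ) (𝓡 n) (F ∘ c) τ 1 = tangentFrame n F (c τ) y := by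
      rw [h2]
      change tangentFrame n F (c τ) ((1 : ℝ) • y) = _
      rw [one_smul]
    have h4 := h.apply_ray_self hy hτ
    rw [pullMetric_self, real_inner_self_eq_norm_sq] at h4
    rw [h3, ← ofReal_norm]
    congr 1
    exact (sq_eq_sq₀ (norm_nonneg _) (norm_nonneg _)).1 h4
  rw [Manifold.pathELength_eq_lintegral_mfderiv_Icc,
    MeasureTheory.setLIntegral_congr_fun measurableSet_Icc hspeed] at hle
  rw [Metric.mem_eball', IsRiemannianManifold.out (I := 𝓡 n) x₀ (F y)]
  refine hle.trans_lt ?_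
  simp only [MeasureTheory.lintegral_const, MeasureTheory.Measure.restrict_apply_univ,
    Real.volume_Icc, sub_zero, ENNReal.ofReal_one, mul_one]
  rw [mem_ball_zero_iff] at hy
  exact (ENNReal.ofReal_lt_ofReal_iff_of_nonneg (norm_nonneg _)).2 hy

end Main

end Jang

end

theorem mainTheorem4 {n : ℕ} {M : Type*} [EMetricSpace M] [CompleteSpace M]
    [ChartedSpace (EuclideanSpace ℝ (Fin n)) M] [IsManifold (𝓡 n) ∞ M]
    [RiemannianBundle (fun x : M ↦ TangentSpace (𝓡 n) x)]
    [IsContMDiffRiemannianBundle (𝓡 n) ∞ (EuclideanSpace ℝ (Fin n))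
      (fun x : M ↦ TangentSpace (𝓡 n) x)]
    [IsRiemannianManifold (𝓡 n) M]
    (p : ∀ x : M, TangentSpace (𝓡 n) x →L[ℝ] TangentSpace (𝓡 n) x →L[ℝ] ℝ)
    (hp : ContMDiff (𝓡 n)
      ((𝓡 n).prod
        𝓘(ℝ, EuclideanSpace ℝ (Fin n) →L[ℝ] EuclideanSpace ℝ (Fin n) →L[ℝ] ℝ)) 1
      (fun x ↦ TotalSpace.mk'
        (EuclideanSpace ℝ (Fin n) →L[ℝ] EuclideanSpace ℝ (Fin n) →L[ℝ] ℝ) x (p x)))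
    (hp_symm : ∀ x v w, p x v w = p x w v)
    (x₀ : M) (ρ t T P₀ P₁ Θ κ : ℝ)
    (hρ : 0 < ρ) (hρ_inj : ENNReal.ofReal ρ < Jang.injRadius n x₀)
    (ht : 0 ≤ t) (hT : 0 < T)
    (hP₀ : 0 ≤ P₀) (hP₁ : 0 ≤ P₁) (hΘ : 0 ≤ Θ) (hκ : 0 ≤ κ)
    (u : M → ℝ)
    (hu : ContMDiffOn (𝓡 n) 𝓘(ℝ, ℝ) 3 u (Metric.eball x₀ (ENNReal.ofReal ρ)))
    (hu_cont : ContinuousOn u (Metric.closedEBall x₀ (ENNReal.ofReal ρ)))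
    (hu_eq : ∀ x ∈ Metric.eball x₀ (ENNReal.ofReal ρ), Jang.JangEquationAt n p t u x)
    (hu_osc : (∀ x ∈ Metric.eball x₀ (ENNReal.ofReal ρ), u x ≤ u x₀ + T) ∨
      (∀ x ∈ Metric.eball x₀ (ENNReal.ofReal ρ), u x ≥ u x₀ - T))
    (hp_bound : ∀ x ∈ Metric.eball x₀ (ENNReal.ofReal ρ), ∀ v w : TangentSpace (𝓡 n) x,
      |p x v w| ≤ P₀ * ‖v‖ * ‖w‖)
    (hDp_bound : ∀ x ∈ Metric.eball x₀ (ENNReal.ofReal ρ), ∀ z v w : TangentSpace (𝓡 n) x,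
      |Jang.covDerivForm p x z v w| ≤ P₁ * ‖z‖ * ‖v‖ * ‖w‖)
    (htu_bound : ∀ x ∈ Metric.eball x₀ (ENNReal.ofReal ρ), t * |u x| ≤ Θ)
    (hsec_bound : ∀ x ∈ Metric.eball x₀ (ENNReal.ofReal ρ), ∀ v w : TangentSpace (𝓡 n) x,
      LinearIndependent ℝ ![v, w] → |Jang.sectionalCurvature x v w| ≤ κ) :
    ‖Jang.grad n u x₀‖ ≤
      Real.exp (100 * ((n + 1) * (1 + T) * (1 + 1 / ρ) * (1 + P₀ + P₁ + Θ + κ)) ^ 2) := by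
  open Jang in
  -- The strict inequality yields an admissible radius `r > ρ`, so the exponential map is defined
  -- and a local diffeomorphism on the whole ball of radius `ρ`.
  obtain ⟨r, ⟨F, hexp, -, hloc⟩, hr⟩ := lt_sSup_iff.1 hρ_inj
  have hparam_r : IsParametrization n F (Metric.eball (0 : Tan n x₀) r) :=
    hloc.isParametrization Metric.isOpen_eball
  have hr0 : 0 < r := (ENNReal.ofReal_pos.2 hρ).trans hr
  have hF0 : F 0 = x₀ := isExp_zero hexp hr0
  have hnormal := isNormalMetric_of_isExp hexp hparam_r hρ hr.le
  have hsub : Metric.ball (0 : Tan n x₀) ρ ⊆ Metric.eball (0 : Tan n x₀) r := by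
    rw [← Metric.eball_ofReal]
    exact Metric.eball_subset_eball hr.le
  have hparam : IsParametrization n F (Metric.ball (0 : Tan n x₀) ρ) :=
    ⟨Metric.isOpen_ball, hparam_r.contMDiffOn.mono hsub, fun y hy ↦ hparam_r.bijective y (hsub hy)⟩
  have hball {y : Tan n x₀} (hy : y ∈ Metric.ball (0 : Tan n x₀) ρ) :
      F y ∈ Metric.eball x₀ (ENNReal.ofReal ρ) := mem_eball_of_isNormalMetric hparam hnormal hF0 hy
  have h0 : (0 : Tan n x₀) ∈ Metric.ball (0 : Tan n x₀) ρ := Metric.mem_ball_self hρ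
  have huat {y : Tan n x₀} (hy : y ∈ Metric.ball (0 : Tan n x₀) ρ) :
      ContMDiffAt (𝓡 n) 𝓘(ℝ, ℝ) 3 u (F y) :=
    (hu _ (hball hy)).contMDiffAt (Metric.isOpen_eball.mem_nhds (hball hy))
  have hps : IsSmoothForm 1 p := hp
  have key := hnormal.gradient_estimate_of_or (P := pullForm F p) (u := u ∘ F) (t := t) (T := T)
    (P₀ := P₀) (P₁ := P₁) (Θ := Θ) (κ := κ) hρ ht hT hP₀ hP₁ hΘ hκ
    (fun y hy ↦ (hparam.contDiffAt_pullForm hy hps).differentiableAt (by simp))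
    (fun y hy v w ↦ hp_symm _ _ _)
    (fun y hy ↦ by
      rw [← contMDiffAt_iff_contDiffAt]
      exact (huat hy).comp y ((hparam.contMDiffAt hy).of_le
        ENat.LEInfty.out))
    (fun y hy ↦ hparam.jangEquationOf hy (huat hy) (hu_eq _ (hball hy)))
    (hu_osc.imp (fun h y hy ↦ by simpa [hF0] using h _ (hball hy))
      (fun h y hy ↦ by simpa [hF0] using h _ (hball hy)))
    (fun y hy v w ↦ by
      rw [sqrt_pullMetric_self, sqrt_pullMetric_self]
      exact hp_bound _ (hball hy) _ _)
    (fun y hy z v w ↦ by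
      rw [sqrt_pullMetric_self, sqrt_pullMetric_self, sqrt_pullMetric_self,
        ← hparam.covDerivForm_eq hy hps]
      exact hDp_bound _ (hball hy) _ _ _)
    (fun y hy v w ↦ hparam.neg_le_pullMetric_curvatureOf hy hκ (hsec_bound _ (hball hy)) v w)
    (fun y hy ↦ htu_bound _ (hball hy))
  have hfin : Module.finrank ℝ (Tan n x₀) = n := finrank_euclideanSpace_fin (𝕜 := ℝ)
  rw [sqrt_pullMetric_self, hparam.tangentFrame_gradOf h0 ((huat h0).mdifferentiableAt (by simp)),
    hfin, hF0] at key
  exact key
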